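/- Let $d\ge 1$, let $\lambda$ be the Lebesgue measure on $\mathbb R^d$ and write $\mathbb R_+=[0,\infty)$. Let $\theta$ be a non-zero locally finite measure on $\mathbb R_+$, let $\nu$ be a probability measure on $\mathbb R_+$ with $\nu(\{0\})<1$, and let $\eta$ be a Poisson process on $\mathbb X=\mathbb R^d\times\mathbb R_+\times\mathbb R_+$ with intensity measure $\mu=\lambda\otimes\theta\otimes\nu$. A point $(x,t_x,v_x)$ is called exposed in a counting measure $M$ on $\mathbb X$ if there is no other point $(y,t_y,v_y)\neq(x,t_x,v_x)$ of $M$ with $t_y\le t_x$ and $\|x-y\|\le v_y(t_x-t_y)$; let $H_{(x,t_x,v_x)}(M)\in\{0,1\}$ be the indicator of this property. For $W\subset\mathbb R^d$ and $a\in(0,\infty)$ let $F$ be the number of points $(x,t_x,v_x)$ of $\eta$ that are exposed in $\eta$ and satisfy $x\in W$ and $t_x\le a$. Let $\omega_d$ be the volume of the Euclidean unit ball of $\mathbb R^d$, and put $$\nu_k=\int_0^\infty v^k\,\nu(dv),\qquad \Lambda(t)=\omega_d\int_{[0,t]}(t-s)^d\,\theta(ds),\qquad w(t)=e^{-\nu_d\Lambda(t)}.$$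 Assume: (A) $W$ is compact and convex with non-empty interior; (B) $\int_0^\infty e^{-x\Lambda(t)}\,\theta(dt)<\infty$ for all $x>0$; (C) $\nu_{7d}<\infty$. Then $F$ is square integrable, $w(t)=\mathbb E[H_{(0,t,v)}(\eta)]$ for all $t,v\ge 0$, and $$\frac{\operatorname{Var}(F)}{\lambda(W)}\ \ge\ \int_{[0,a]}w(t)\,\theta(dt)-2\omega_d\nu_d\int_{[0,a]}\int_{[0,t]}(t-s)^d\,w(s)w(t)\,\theta(ds)\,\theta(dt),$$ $$\frac{\operatorname{Var}(F)}{\lambda(W)}\ \le\ 2\int_{[0,a]}w(t)^{1/2}\,\theta(dt)+\omega_d^2\,\nu_{2d}\int_{[0,a]^2}\int_{[0,t_1\wedge t_2]}(t_1-s)^d(t_2-s)^d\,w(t_1)^{1/2}w(t_2)^{1/2}\,\theta(ds)\,\theta^2(d(t_1,t_2)).$$ Moreover, let $\tau>-1$. There are real constants $C_1>0$, $C_1'$ and $C_2>0$ depending only on $d$ and $\tau$, with $C_1(d-1-\tau)<C_1'$, such that if $\theta(dt)=t^\tau\,dt$ (for which (B) always holds), then for all $a\in(0,\infty)$ and all $W$,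 $\nu$ as above satisfying (A) and (C), $$C_1'\ \le\ \frac{\operatorname{Var}(F)}{\lambda(W)\,l_{a,\tau}(\nu_d)}\ \le\ C_2\bigl(1+\nu_{2d}\,\nu_d^{-2}\bigr),$$ where, for $x>0$, $$l_{a,\tau}(x)=\gamma\Bigl(\tfrac{\tau+1}{d+\tau+1},\,a^{d+\tau+1}x\Bigr)\,x^{-\frac{\tau+1}{d+\tau+1}},\qquad \gamma(p,z)=\int_0^z t^{p-1}e^{-t}\,dt.$$ -/

import Mathlib

open MeasureTheory ProbabilityTheory
open scoped NNReal ENNReal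

noncomputable section

namespace BirthGrowth

/-- The space `ℝ^d × ℝ₊ × ℝ₊`. A seed `x = (x.1, x.2.1, x.2.2)` is born at location `x.1` at time
`x.2.1` and grows with speed `x.2.2`. -/
abbrev Seed (d : ℕ) : Type := EuclideanSpace ℝ (Fin d) × ℝ≥0 × ℝ≥0

/-! ### Counting measures and Poisson processes -/

/-- A `σ`-finite counting measure: a `σ`-finite sum of Dirac masses at countably many points
(repetitions are allowed). -/
def IsCountingMeasure {X : Type*} [MeasurableSpace X] (M : Measure X) : Prop :=
  SigmaFinite M ∧
    ∃ (I : Set ℕ) (p : ℕ → X), M = Measure.sum (fun i : I => Measure.dirac (p i))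

/-- `η` is a Poisson process with intensity measure `μ`, defined on the probability space `(Ω, P)`.
The `σ`-algebra that Mathlib puts on `Measure X` is the smallest one for which all evaluations
`M ↦ M A`, `A` measurable, are measurable. -/
structure IsPoissonProcess {Ω X : Type*} [MeasurableSpace Ω] [MeasurableSpace X]
    (η : Ω → Measure X) (μ : Measure X) (P : Measure Ω) : Prop where
  counting : ∀ ω, IsCountingMeasure (η ω)
  measurable : Measurable η
  law : ∀ A : Set X, MeasurableSet A → μ A ≠ ∞ →
    P.map (fun ω => η ω A) = (poissonMeasure (μ A).toNNReal).map (fun n : ℕ => (n : ℝ≥0∞))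
  law_top : ∀ A : Set X, MeasurableSet A → μ A = ∞ → ∀ᵐ ω ∂P, η ω A = ∞
  indep : ∀ (n : ℕ) (A : Fin n → Set X), (∀ i, MeasurableSet (A i)) →
    Pairwise (fun i j => Disjoint (A i) (A j)) → iIndepFun (fun i ω => η ω (A i)) P

/-! ### The birth-growth model -/

/-- The intensity measure `λ ⊗ θ ⊗ ν`, where `λ` is the Lebesgue measure on `ℝ^d`. -/
def intensity (d : ℕ) (θ ν : Measure ℝ≥0) : Measure (Seed d) :=
  (volume : Measure (EuclideanSpace ℝ (Fin d))).prod (θ.prod ν)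

/-- The space-time region occupied by the cell that grows from the seed `x`. -/
def growthRegion {d : ℕ} (x : Seed d) : Set (EuclideanSpace ℝ (Fin d) × ℝ≥0) :=
  {z | x.2.1 ≤ z.2 ∧ ‖z.1 - x.1‖ ≤ (x.2.2 : ℝ) * ((z.2 : ℝ) - (x.2.1 : ℝ))}

/-- `x` is exposed in `M` if it lies in the growth region of no other point of `M`; a point `y`
belongs to `M` if `M {y} ≥ 1`. -/
def SeedExposed {d : ℕ} (x : Seed d) (M : Measure (Seed d)) : Prop :=
  ∀ y : Seed d, 1 ≤ M {y} → y ≠ x → (x.1, x.2.1) ∉ growthRegion y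

open Classical in
/-- The exposure indicator `H_x(M)`. -/
def exposure {d : ℕ} (x : Seed d) (M : Measure (Seed d)) : ℝ :=
  if SeedExposed x M then 1 else 0

open Classical in
/-- The number of exposed points of `M` located in `W` and born no later than time `a`,
`∫ 1{x ∈ W} 1{t_x ≤ a} H_x(M) M(dx)`. -/
def exposedCount {d : ℕ} (W : Set (EuclideanSpace ℝ (Fin d))) (a : ℝ≥0)
    (M : Measure (Seed d)) : ℝ :=
  (∫⁻ x, if x.1 ∈ W ∧ x.2.1 ≤ a ∧ SeedExposed x M then 1 else 0 ∂M).toReal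

/-- The volume of the Euclidean unit ball in `ℝ^d`. -/
def ballVol (d : ℕ) : ℝ :=
  volume.real (Metric.closedBall (0 : EuclideanSpace ℝ (Fin d)) 1)

/-- The moment of order `k` of the speed distribution. -/
def speedMoment (ν : Measure ℝ≥0) (k : ℕ) : ℝ :=
  ∫ v, (v : ℝ) ^ k ∂ν

/-- `Λ(t) = ω_d ∫_{[0,t]} (t - s)^d θ(ds)`. -/
def Lam (d : ℕ) (θ : Measure ℝ≥0) (t : ℝ≥0) : ℝ :=
  ballVol d * ∫ s in Set.Icc 0 t, ((t : ℝ) - (s : ℝ)) ^ d ∂θ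

/-- `w(t) = exp (-ν_d Λ(t))`. -/
def wt (d : ℕ) (θ ν : Measure ℝ≥0) (t : ℝ≥0) : ℝ :=
  Real.exp (-(speedMoment ν d * Lam d θ t))

/-- The window is compact and convex with nonempty interior. -/
def WindowCondition {d : ℕ} (W : Set (EuclideanSpace ℝ (Fin d))) : Prop :=
  IsCompact W ∧ Convex ℝ W ∧ (interior W).Nonempty

/-- `∫ exp (-x Λ(t)) θ(dt) < ∞` for all `x > 0`. -/
def TimeCondition (d : ℕ) (θ : Measure ℝ≥0) : Prop :=
  ∀ x : ℝ, 0 < x → Integrable (fun t => Real.exp (-(x * Lam d θ t))) θ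

/-- The speed distribution has a finite moment of order `7d`. -/
def SpeedCondition (d : ℕ) (ν : Measure ℝ≥0) : Prop :=
  Integrable (fun v : ℝ≥0 => (v : ℝ) ^ (7 * d)) ν

/-! ### Power-law birth times -/

/-- The measure `θ(dt) = t^τ dt` on `ℝ₊`: the Lebesgue measure on `(0, ∞)` with density `t^τ`,
regarded as a measure on `ℝ₊`. -/
def powerTheta (τ : ℝ) : Measure ℝ≥0 :=
  (((volume : Measure ℝ).restrict (Set.Ioi 0)).withDensity
    (fun t => ENNReal.ofReal (t ^ τ))).map Real.toNNReal

/-- The lower incomplete Gamma function `γ(p, z) = ∫_0^z t^(p-1) e^(-t) dt`. -/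
def lowerGamma (p z : ℝ) : ℝ :=
  ∫ t in (0 : ℝ)..z, t ^ (p - 1) * Real.exp (-t)

/-- `l_{a,τ}(x) = γ((τ+1)/(d+τ+1), a^(d+τ+1) x) x^(-(τ+1)/(d+τ+1))`. -/
def lFun (d : ℕ) (a τ x : ℝ) : ℝ :=
  lowerGamma ((τ + 1) / (d + τ + 1)) (a ^ ((d : ℝ) + τ + 1) * x)
    * x ^ (-((τ + 1) / (d + τ + 1)))

end BirthGrowth

end

open BirthGrowth

namespace BirthGrowth

/-! ### Moments of the Poisson distribution -/

/-! The variance is read off an exact second moment formula. Write μ for the intensity and L_x for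
the open past cone of x, the seeds that reach the birth point of x strictly. Boundaries of cones
have no intensity, so almost surely a point x of the process is exposed exactly when L_x carries no
point (`ae_seedExposed_iff`). Since μ(L_x) = ν_d Λ(t_x), this void event has probability w(t_x), and
with all integrals over the window E F = ∫ w dμ, E F² = ∬ exp(-μ(L_x ∪ L_y)) + ∫ w dμ, where the
double integral runs over pairs neither of which lies in the cone of the other.

These are Mecke formulas for void events. For a fixed set B they follow from independence on
disjoint sets (`setLIntegral_void_apply`, `setLIntegral_void_apply_mul`). The relation y ∈ L_x is
open, hence a countable union of rectangles; with finitely many rectangles the cone takes finitely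
many values, the fixed-set rule can be summed, and dominated convergence gives the general case
(`lintegral_measure_void`).

Upper bound: exp(-μ(L_x ∪ L_y)) exceeds w(t_x) w(t_y) by at most w(t_x)^(1/2) w(t_y)^(1/2) μ(L_x ∩
L_y) (`exp_neg_le_mul_add`), and integrating the intersection over its common ancestors produces
ω_d² ν_{2d}. Lower bound: exp(-μ(L_x ∪ L_y)) ≥ w(t_x) w(t_y), so only the related pairs of (E F)²
are lost, once in each order.

For θ(dt) = t^τ dt one has w(t) = exp(-b t^p) with p = d + τ + 1, and l is p times the integral G of
t^τ exp(-ν_d t^p) over [0,a]. Changing the rate from ν_d to a fixed multiple costs a constant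
uniform in a, and the upper bound follows after separating variables. For τ > d - 1 the lower
constant may be 0. For τ ≤ d - 1, integration by parts shows that the first-order lower bound is
non-negative, but at τ = d - 1 it degenerates as b a^p grows; a second-order gain in the inner
integral keeps it comparable to G (`exists_pos_mul_powExpInt_le`). -/

theorem lintegral_poissonMeasure (r : ℝ≥0) (g : ℕ → ℝ≥0∞) :
    ∫⁻ n, g n ∂(poissonMeasure r)
      = ∑' n : ℕ, ENNReal.ofReal (Real.exp (-r) * r ^ n / n.factorial) * g n := by
  simp [poissonMeasure, lintegral_sum_measure, lintegral_smul_measure]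

/-- The Chen–Stein identity: n rⁿ/n! = r · rⁿ⁻¹/(n-1)!, and the term n = 0 drops out. Both moments
below are instances. -/
theorem lintegral_poissonMeasure_mul (r : ℝ≥0) (g : ℕ → ℝ≥0∞) :
    ∫⁻ n, (n : ℝ≥0∞) * g n ∂(poissonMeasure r)
      = r * ∫⁻ n, g (n + 1) ∂(poissonMeasure r) := by
  rw [lintegral_poissonMeasure, lintegral_poissonMeasure, tsum_eq_zero_add' ENNReal.summable,
    ← ENNReal.tsum_mul_left]
  simp only [Nat.cast_zero, zero_mul, mul_zero, zero_add]
  refine tsum_congr fun n => ?_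
  have h : ENNReal.ofReal (Real.exp (-r) * r ^ (n + 1) / (n + 1).factorial) * ((n + 1 : ℕ) : ℝ≥0∞)
      = r * ENNReal.ofReal (Real.exp (-r) * r ^ n / n.factorial) := by
    rw [← ENNReal.ofReal_natCast, ← ENNReal.ofReal_coe_nnreal, ← ENNReal.ofReal_mul (by positivity),
      ← ENNReal.ofReal_mul (by positivity)]
    congr 1
    rw [Nat.factorial_succ]
    push_cast
    field_simp
    ring
  rw [← mul_assoc, h, mul_assoc]

theorem lintegral_natCast_poissonMeasure (r : ℝ≥0) :
    ∫⁻ n, (n : ℝ≥0∞) ∂(poissonMeasure r) = r := by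
  simpa using lintegral_poissonMeasure_mul r (fun _ => 1)

theorem lintegral_natCast_sq_poissonMeasure (r : ℝ≥0) :
    ∫⁻ n, (n : ℝ≥0∞) * n ∂(poissonMeasure r) = r * (r + 1) := by
  rw [lintegral_poissonMeasure_mul r (fun n => (n : ℝ≥0∞))]
  push_cast
  rw [lintegral_add_right _ measurable_const, lintegral_natCast_poissonMeasure]
  simp

/-! ### Poisson processes: moments, void probabilities and pair sums -/

section Poisson

variable {Ω X : Type*} [MeasurableSpace Ω] [MeasurableSpace X] {η : Ω → Measure X}
  {μ : Measure X} {P : Measure Ω}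

namespace IsPoissonProcess

theorem measurable_apply (h : IsPoissonProcess η μ P) {A : Set X} (hA : MeasurableSet A) :
    Measurable fun ω => η ω A :=
  (Measure.measurable_coe hA).comp h.measurable

theorem sigmaFinite (h : IsPoissonProcess η μ P) (ω : Ω) : SigmaFinite (η ω) :=
  (h.counting ω).1

theorem lintegral_comp (h : IsPoissonProcess η μ P) {A : Set X} (hA : MeasurableSet A)
    (hμ : μ A ≠ ∞) {g : ℝ≥0∞ → ℝ≥0∞} (hg : Measurable g) :
    ∫⁻ ω, g (η ω A) ∂P = ∫⁻ n, g (n : ℕ) ∂(poissonMeasure (μ A).toNNReal) := by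
  rw [← lintegral_map hg (h.measurable_apply hA), h.law A hA hμ,
    lintegral_map hg (by fun_prop)]

theorem lintegral_apply (h : IsPoissonProcess η μ P) {A : Set X} (hA : MeasurableSet A)
    (hμ : μ A ≠ ∞) : ∫⁻ ω, η ω A ∂P = μ A := by
  have e := h.lintegral_comp hA hμ measurable_id
  simp only [id] at e
  rw [e]
  simp only [lintegral_natCast_poissonMeasure, ENNReal.coe_toNNReal hμ]

theorem lintegral_apply_sq (h : IsPoissonProcess η μ P) {A : Set X} (hA : MeasurableSet A)
    (hμ : μ A ≠ ∞) : ∫⁻ ω, η ω A * η ω A ∂P = μ A * (μ A + 1) := by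
  rw [h.lintegral_comp hA hμ (g := fun x => x * x) (by fun_prop)]
  simp only [lintegral_natCast_sq_poissonMeasure, ENNReal.coe_toNNReal hμ]

theorem void_prob (h : IsPoissonProcess η μ P) {A : Set X} (hA : MeasurableSet A)
    (hμ : μ A ≠ ∞) : P {ω | η ω A = 0} = ENNReal.ofReal (Real.exp (-(μ A).toReal)) := by
  have h1 : P {ω | η ω A = 0} = P.map (fun ω => η ω A) {0} := by
    rw [Measure.map_apply (h.measurable_apply hA) (measurableSet_singleton _)]
    rfl
  rw [h1, h.law A hA hμ, Measure.map_apply (by fun_prop) (measurableSet_singleton _)]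
  have h2 : (fun n : ℕ => (n : ℝ≥0∞)) ⁻¹' {0} = {0} := by ext n; simp
  rw [h2, poissonMeasure_singleton]
  simp [ENNReal.coe_toNNReal_eq_toReal]

theorem ae_apply_lt_top (h : IsPoissonProcess η μ P) {A : Set X} (hA : MeasurableSet A)
    (hμ : μ A ≠ ∞) : ∀ᵐ ω ∂P, η ω A < ∞ :=
  ae_lt_top (h.measurable_apply hA) (by rw [h.lintegral_apply hA hμ]; exact hμ)

theorem measurableSet_void (h : IsPoissonProcess η μ P) {B : Set X} (hB : MeasurableSet B) :
    MeasurableSet {ω | η ω B = 0} :=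
  h.measurable_apply hB (measurableSet_singleton 0)

theorem indepFun_apply (h : IsPoissonProcess η μ P) {A B : Set X} (hA : MeasurableSet A)
    (hB : MeasurableSet B) (hAB : Disjoint A B) :
    IndepFun (fun ω => η ω A) (fun ω => η ω B) P := by
  have := h.indep 2 ![A, B] (by intro i; fin_cases i <;> simpa) (by
    intro i j hij
    fin_cases i <;> fin_cases j <;> simp_all [disjoint_comm])
  simpa using this.indepFun (show (0 : Fin 2) ≠ 1 by decide)

/-- `E[1{η(B) = 0} η(A)] = P(η(B) = 0) μ(A \ B)`. -/
theorem setLIntegral_void_apply (h : IsPoissonProcess η μ P) {A B : Set X}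
    (hA : MeasurableSet A) (hB : MeasurableSet B) (hμ : μ A ≠ ∞) :
    ∫⁻ ω in {ω | η ω B = 0}, η ω A ∂P = P {ω | η ω B = 0} * μ (A \ B) := by
  have hV := h.measurableSet_void hB
  have hAB := hA.diff hB
  -- On the void event of `B` the counts of `A` and `A \ B` agree, and the latter is independent of
  -- the count of `B`.
  have e1 : ∫⁻ ω in {ω | η ω B = 0}, η ω A ∂P
      = ∫⁻ ω, ((Set.indicator {0} 1 : ℝ≥0∞ → ℝ≥0∞) (η ω B)) * η ω (A \ B) ∂P := by
    rw [← lintegral_indicator hV]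
    refine lintegral_congr fun ω => ?_
    by_cases hω : η ω B = 0
    · simp [Set.indicator, hω, measure_sdiff_null hω]
    · simp [Set.indicator, hω]
  have hg : Measurable (Set.indicator {0} 1 : ℝ≥0∞ → ℝ≥0∞) :=
    measurable_one.indicator (measurableSet_singleton _)
  rw [e1]
  have e2 := lintegral_mul_eq_lintegral_mul_lintegral_of_indepFun
    (hg.comp (h.measurable_apply hB)) (h.measurable_apply hAB)
    ((h.indepFun_apply hB hAB Set.disjoint_sdiff_right).comp hg measurable_id)
  simp only [Pi.mul_apply, Function.comp_apply] at e2
  rw [e2, h.lintegral_apply hAB (measure_ne_top_of_subset Set.sdiff_subset hμ)]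
  congr 1
  rw [← lintegral_indicator_one hV]
  rfl

/-- `E[1{η(B) = 0} η(A₁) η(A₂)]` for `A₁`, `A₂` of finite intensity. -/
theorem setLIntegral_void_apply_mul (h : IsPoissonProcess η μ P) {A₁ A₂ B : Set X}
    (hA₁ : MeasurableSet A₁) (hA₂ : MeasurableSet A₂) (hB : MeasurableSet B)
    (hμ₁ : μ A₁ ≠ ∞) (hμ₂ : μ A₂ ≠ ∞) :
    ∫⁻ ω in {ω | η ω B = 0}, η ω A₁ * η ω A₂ ∂P
      = P {ω | η ω B = 0} * (μ (A₁ \ B) * μ (A₂ \ B) + μ ((A₁ ∩ A₂) \ B)) := by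
  have hV := h.measurableSet_void hB
  -- `B` and the three atoms of `A₁`, `A₂` outside `B` are disjoint, so all mixed products factor.
  -- Only the square of the count of the common atom `C 1` does not; its excess over μ(C 1)² is the
  -- extra term μ((A₁ ∩ A₂) \ B).
  set C : Fin 4 → Set X := ![B, (A₁ ∩ A₂) \ B, (A₁ \ A₂) \ B, (A₂ \ A₁) \ B] with hCdef
  have hC : ∀ i, MeasurableSet (C i) := by
    intro i
    fin_cases i
    · exact hB
    · exact (hA₁.inter hA₂).diff hB
    · exact (hA₁.diff hA₂).diff hB
    · exact (hA₂.diff hA₁).diff hB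
  have hdisj : Pairwise fun i j => Disjoint (C i) (C j) := by
    intro i j hij
    rw [Set.disjoint_left]
    intro x
    fin_cases i <;> fin_cases j <;> simp [hCdef] at hij ⊢ <;> tauto
  have hm : ∀ i, Measurable fun ω => η ω (C i) := fun i => h.measurable_apply (hC i)
  have hind := h.indep 4 C hC hdisj
  set u : ℝ≥0∞ → ℝ≥0∞ := Set.indicator {0} 1 with hu
  have hum : Measurable u := measurable_one.indicator (measurableSet_singleton _)
  have hu0 : ∫⁻ ω, u (η ω (C 0)) ∂P = P {ω | η ω B = 0} := by
    rw [← lintegral_indicator_one hV]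
    rfl
  have hfin : ∀ i, i ≠ 0 → μ (C i) ≠ ∞ := by
    intro i hi
    fin_cases i
    · simp at hi
    · exact measure_ne_top_of_subset (Set.sdiff_subset.trans Set.inter_subset_left) hμ₁
    · exact measure_ne_top_of_subset (Set.sdiff_subset.trans Set.sdiff_subset) hμ₁
    · exact measure_ne_top_of_subset (Set.sdiff_subset.trans Set.sdiff_subset) hμ₂
  have t1 : ∀ i, i ≠ 0 → ∫⁻ ω, u (η ω (C 0)) * η ω (C i) ∂P = P {ω | η ω B = 0} * μ (C i) := by
    intro i hi
    have e2 := lintegral_mul_eq_lintegral_mul_lintegral_of_indepFun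
      (hum.comp (hm 0)) (hm i) ((hind.indepFun hi.symm).comp hum measurable_id)
    simp only [Pi.mul_apply, Function.comp_apply] at e2
    rw [e2, hu0, h.lintegral_apply (hC i) (hfin i hi)]
  have t2 : ∀ i j, i ≠ 0 → j ≠ 0 → i ≠ j → ∫⁻ ω, u (η ω (C 0)) * η ω (C i) * η ω (C j) ∂P
      = P {ω | η ω B = 0} * μ (C i) * μ (C j) := by
    intro i j hi hj hij
    have hi2 : IndepFun ((u ∘ fun ω => η ω (C 0)) * fun ω => η ω (C i)) (fun ω => η ω (C j)) P :=
      (hind.indepFun_prodMk hm 0 i j hj.symm hij).comp (φ := fun z : ℝ≥0∞ × ℝ≥0∞ => u z.1 * z.2)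
        ((hum.comp measurable_fst).mul measurable_snd) measurable_id
    have e2 := lintegral_mul_eq_lintegral_mul_lintegral_of_indepFun
      ((hum.comp (hm 0)).mul (hm i)) (hm j) hi2
    simp only [Pi.mul_apply, Function.comp_apply] at e2
    rw [e2, t1 i hi, h.lintegral_apply (hC j) (hfin j hj)]
  have t3 : ∀ i, i ≠ 0 → ∫⁻ ω, u (η ω (C 0)) * (η ω (C i) * η ω (C i)) ∂P
      = P {ω | η ω B = 0} * (μ (C i) * (μ (C i) + 1)) := by
    intro i hi
    have e2 := lintegral_mul_eq_lintegral_mul_lintegral_of_indepFun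
      (hum.comp (hm 0)) ((hm i).mul (hm i)) ((hind.indepFun hi.symm).comp (ψ := fun z => z * z) hum
        (by fun_prop))
    simp only [Pi.mul_apply, Function.comp_apply] at e2
    rw [e2, hu0, h.lintegral_apply_sq (hC i) (hfin i hi)]
  have split : ∀ (M : Measure X) (A A' : Set X), MeasurableSet A' →
      M (A \ B) = M ((A ∩ A') \ B) + M ((A \ A') \ B) := by
    intro M A A' hA'
    rw [← measure_inter_add_sdiff (A \ B) hA']
    congr 2 <;> ext x <;> simp <;> tauto
  have s1 : ∀ M : Measure X, M (A₁ \ B) = M (C 1) + M (C 2) := fun M => split M A₁ A₂ hA₂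
  have s2 : ∀ M : Measure X, M (A₂ \ B) = M (C 1) + M (C 3) := by
    intro M
    rw [split M A₂ A₁ hA₁, Set.inter_comm]
    rfl
  have e1 : ∫⁻ ω in {ω | η ω B = 0}, η ω A₁ * η ω A₂ ∂P
      = ∫⁻ ω, (u (η ω (C 0)) * (η ω (C 1) * η ω (C 1)) + u (η ω (C 0)) * η ω (C 1) * η ω (C 3))
          + (u (η ω (C 0)) * η ω (C 1) * η ω (C 2)
            + u (η ω (C 0)) * η ω (C 2) * η ω (C 3)) ∂P := by
    rw [← lintegral_indicator hV]
    refine lintegral_congr fun ω => ?_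
    by_cases hω : η ω B = 0
    · have : u (η ω (C 0)) = 1 := by
        change u (η ω B) = 1
        simp [hu, hω]
      rw [this, Set.indicator_of_mem (by exact hω), ← measure_sdiff_null (s := A₁) hω,
        ← measure_sdiff_null (s := A₂) hω, s1, s2]
      ring
    · have : u (η ω (C 0)) = 0 := by
        change u (η ω B) = 0
        simp [hu, hω]
      rw [this, Set.indicator_of_notMem (by exact hω)]
      simp
  have mu0 : Measurable fun ω => u (η ω (C 0)) := hum.comp (hm 0)
  have hm1 := hm 1
  have hm2 := hm 2
  have hm3 := hm 3
  rw [e1, lintegral_add_left (by fun_prop), lintegral_add_left (by fun_prop),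
    lintegral_add_left (by fun_prop), t3 1 (by decide), t2 1 3 (by decide) (by decide) (by decide),
    t2 1 2 (by decide) (by decide) (by decide), t2 2 3 (by decide) (by decide) (by decide),
    s1, s2, show (A₁ ∩ A₂) \ B = C 1 from rfl]
  ring

end IsPoissonProcess

end Poisson

/-! ### From void events of fixed sets to void events of moving sets -/

section Moving

open Filter Topology

variable {X Y : Type*}

/-- The union of those `B i` whose label set `R i` contains `y`. -/
def movingUnion (R : ℕ → Set Y) (B : ℕ → Set X) (y : Y) : Set X := ⋃ i, ⋃ (_ : y ∈ R i), B i

open Classical in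
/-- The indices below `n` of the label sets that contain `y`. -/
noncomputable def activeIndices (R : ℕ → Set Y) (n : ℕ) (y : Y) : Finset ℕ :=
  (Finset.range n).filter fun i => y ∈ R i

/-- The union of the `B i` over a finite set of indices. -/
def finUnion (B : ℕ → Set X) (S : Finset ℕ) : Set X := ⋃ i ∈ S, B i

theorem movingUnion_eq_iUnion (R : ℕ → Set Y) (B : ℕ → Set X) (y : Y) :
    movingUnion R B y = ⋃ n, finUnion B (activeIndices R n y) := by
  ext x
  simp only [movingUnion, finUnion, activeIndices, Set.mem_iUnion, Finset.mem_filter,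
    Finset.mem_range, exists_prop]
  constructor
  · rintro ⟨i, h1, h2⟩
    exact ⟨i + 1, i, ⟨Nat.lt_succ_self i, h1⟩, h2⟩
  · rintro ⟨n, i, ⟨-, h1⟩, h2⟩
    exact ⟨i, h1, h2⟩

theorem monotone_finUnion_activeIndices (R : ℕ → Set Y) (B : ℕ → Set X) (y : Y) :
    Monotone fun n => finUnion B (activeIndices R n y) := by
  intro m n hmn
  refine Set.biUnion_subset_biUnion_left ?_
  intro i
  simp only [activeIndices, Finset.coe_filter, Finset.mem_range, Set.mem_ofPred_eq]
  exact fun h => ⟨h.1.trans_le hmn, h.2⟩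

theorem activeIndices_mem_powerset (R : ℕ → Set Y) (n : ℕ) (y : Y) :
    activeIndices R n y ∈ (Finset.range n).powerset := by
  classical
  exact Finset.mem_powerset.2 (Finset.filter_subset _ _)

variable [MeasurableSpace X]

theorem measurableSet_finUnion {B : ℕ → Set X} (hB : ∀ i, MeasurableSet (B i)) (S : Finset ℕ) :
    MeasurableSet (finUnion B S) :=
  Finset.measurableSet_biUnion _ fun i _ => hB i

theorem preimage_void_eq (R : ℕ → Set Y) (B : ℕ → Set X) (M : Measure X) (n : ℕ) :
    {y | M (finUnion B (activeIndices R n y)) = 0}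
      = activeIndices R n ⁻¹' {S | M (finUnion B S) = 0} := rfl

variable [MeasurableSpace Y]

theorem measurableSet_activeIndices_preimage {R : ℕ → Set Y} (hR : ∀ i, MeasurableSet (R i))
    (n : ℕ) (U : Set (Finset ℕ)) : MeasurableSet (activeIndices R n ⁻¹' U) := by
  rw [← Set.biUnion_preimage_singleton]
  refine MeasurableSet.biUnion U.to_countable fun S _ => ?_
  have : activeIndices R n ⁻¹' {S} = ⋂ i, {y | (i < n ∧ y ∈ R i) ↔ i ∈ S} := by
    ext y
    simp [activeIndices, Finset.ext_iff]
  rw [this]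
  refine MeasurableSet.iInter fun i => ?_
  by_cases h1 : i < n <;> by_cases h2 : i ∈ S <;> simp only [h1, h2, true_and, false_and, iff_true,
    iff_false]
  · exact hR i
  · exact (hR i).compl
  · exact MeasurableSet.const _
  · exact MeasurableSet.const _

/-- The set of active indices below `n` has finitely many possible values, and the moving set is
constant on each level set. This reduces a moving set to fixed ones. -/
theorem measure_eq_sum_activeIndices {R : ℕ → Set Y} (hR : ∀ i, MeasurableSet (R i))
    (n : ℕ) (m : Measure Y) (U : Set (Finset ℕ)) :
    m (activeIndices R n ⁻¹' U)
      = ∑ S ∈ (Finset.range n).powerset,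
          U.indicator (fun S => m (activeIndices R n ⁻¹' {S})) S := by
  have h := sum_measure_preimage_singleton (μ := m.restrict (activeIndices R n ⁻¹' U))
    (Finset.range n).powerset (f := activeIndices R n)
    (fun S _ => measurableSet_activeIndices_preimage hR n {S})
  have huniv : activeIndices R n ⁻¹' ((Finset.range n).powerset : Set (Finset ℕ)) = Set.univ :=
    Set.eq_univ_of_forall fun y => activeIndices_mem_powerset R n y
  rw [huniv, Measure.restrict_apply_univ] at h
  rw [← h]
  refine Finset.sum_congr rfl fun S _ => ?_
  rw [Measure.restrict_apply (measurableSet_activeIndices_preimage hR n {S})]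
  by_cases hS : S ∈ U
  · rw [Set.indicator_of_mem hS]
    congr 1
    ext y
    simp only [Set.mem_inter_iff, Set.mem_preimage, Set.mem_singleton_iff, and_iff_left_iff_imp]
    rintro rfl
    exact hS
  · rw [Set.indicator_of_notMem hS]
    refine measure_mono_null (t := ∅) ?_ measure_empty
    rintro y ⟨h1, h2⟩
    simp only [Set.mem_preimage, Set.mem_singleton_iff] at h1 h2
    exact hS (h1 ▸ h2)

variable {Ω : Type*} [MeasurableSpace Ω] {P : Measure Ω} [IsProbabilityMeasure P]
  {η : Ω → Measure X} {κ : Ω → Measure Y} {ρ : Measure Y} {pts : Y → Set X}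
  {R : ℕ → Set Y} {B : ℕ → Set X}

/-- Continuity from above: the void events decrease in `n`, and a countable union is null exactly
when all its finite stages are. -/
theorem tendsto_measure_void [IsFiniteMeasure ρ] (hR : ∀ i, MeasurableSet (R i)) (M : Measure X) :
    Tendsto (fun n => ρ {y | M (finUnion B (activeIndices R n y)) = 0}) atTop
      (𝓝 (ρ {y | M (movingUnion R B y) = 0})) := by
  have hset : {y | M (movingUnion R B y) = 0}
      = ⋂ n, {y | M (finUnion B (activeIndices R n y)) = 0} := by
    ext y
    simp [movingUnion_eq_iUnion, measure_iUnion_null_iff]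
  rw [hset]
  refine tendsto_measure_iInter_atTop (fun n => ?_) ?_ ⟨0, measure_ne_top _ _⟩
  · rw [preimage_void_eq]
    exact (measurableSet_activeIndices_preimage hR n _).nullMeasurableSet
  · intro m n hmn y hy
    exact measure_mono_null (monotone_finUnion_activeIndices R B y hmn) hy

theorem measurable_measure_void_fin (hη : Measurable η) (hκ : Measurable κ)
    (hR : ∀ i, MeasurableSet (R i)) (hB : ∀ i, MeasurableSet (B i)) (n : ℕ) :
    Measurable fun ω => κ ω {y | η ω (finUnion B (activeIndices R n y)) = 0} := by
  have hsum : ∀ ω, κ ω {y | η ω (finUnion B (activeIndices R n y)) = 0}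
      = ∑ S ∈ (Finset.range n).powerset, ({S | η ω (finUnion B S) = 0} : Set (Finset ℕ)).indicator
        (fun S => κ ω (activeIndices R n ⁻¹' {S})) S := fun ω => by
    rw [preimage_void_eq, measure_eq_sum_activeIndices hR n]
  simp_rw [hsum]
  refine Finset.measurable_fun_sum _ fun S _ => ?_
  have : (fun ω => ({S | η ω (finUnion B S) = 0} : Set (Finset ℕ)).indicator
      (fun S => κ ω (activeIndices R n ⁻¹' {S})) S)
      = {ω | η ω (finUnion B S) = 0}.indicator (fun ω => κ ω (activeIndices R n ⁻¹' {S})) := by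
    ext ω
    simp [Set.indicator]
  rw [this]
  exact ((Measure.measurable_coe (measurableSet_activeIndices_preimage hR n {S})).comp
    hκ).indicator (((Measure.measurable_coe (measurableSet_finUnion hB S)).comp hη)
      (measurableSet_singleton 0))

theorem measurable_measure_void (hη : Measurable η) (hκ : Measurable κ)
    (hfin : ∀ ω, IsFiniteMeasure (κ ω))
    (hR : ∀ i, MeasurableSet (R i)) (hB : ∀ i, MeasurableSet (B i)) :
    Measurable fun ω => κ ω {y | η ω (movingUnion R B y) = 0} := by
  refine measurable_of_tendsto_metrizable (measurable_measure_void_fin hη hκ hR hB)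
    (tendsto_pi_nhds.2 fun ω => ?_)
  have := hfin ω
  exact tendsto_measure_void hR (η ω)

/-- If `E[1{η(B) = 0} κ(D)] = P(η(B) = 0) ρ{y ∈ D : pts y ∩ B = ∅}` for all fixed sets `B`, the same
holds for sets `B` that depend on `y`. -/
theorem lintegral_measure_void [IsFiniteMeasure ρ] (hη : Measurable η) (hκ : Measurable κ)
    (hfin : ∀ ω, IsFiniteMeasure (κ ω))
    (hpts : ∀ B, MeasurableSet B → MeasurableSet {y | Disjoint (pts y) B})
    (rule : ∀ B D, MeasurableSet B → MeasurableSet D →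
      ∫⁻ ω in {ω | η ω B = 0}, κ ω D ∂P
        = P {ω | η ω B = 0} * ρ (D ∩ {y | Disjoint (pts y) B}))
    (hR : ∀ i, MeasurableSet (R i)) (hB : ∀ i, MeasurableSet (B i)) :
    ∫⁻ ω, κ ω {y | η ω (movingUnion R B y) = 0} ∂P
      = ∫⁻ y, {y | Disjoint (pts y) (movingUnion R B y)}.indicator
          (fun y => P {ω | η ω (movingUnion R B y) = 0}) y ∂ρ := by
  have hvoid : ∀ S, MeasurableSet {ω | η ω (finUnion B S) = 0} := fun S =>
    ((Measure.measurable_coe (measurableSet_finUnion hB S)).comp hη) (measurableSet_singleton 0)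
  -- The total mass of `κ` will dominate; the rule with `B = ∅` shows that it is integrable.
  have hbound : ∫⁻ ω, κ ω Set.univ ∂P ≠ ∞ := by
    have h0 := rule ∅ Set.univ MeasurableSet.empty MeasurableSet.univ
    simp only [measure_empty, Set.ofPred_true, setLIntegral_univ] at h0
    rw [h0]
    exact ENNReal.mul_ne_top (measure_ne_top _ _) (measure_ne_top _ _)
  have hterm : ∀ n S, MeasurableSet (activeIndices R n ⁻¹' {S} ∩
      {y | Disjoint (pts y) (finUnion B S)}) := fun n S =>
    (measurableSet_activeIndices_preimage hR n {S}).inter (hpts _ (measurableSet_finUnion hB S))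
  set Φ : ℕ → Y → ℝ≥0∞ := fun n y =>
    {y | Disjoint (pts y) (finUnion B (activeIndices R n y))}.indicator
      (fun y => P {ω | η ω (finUnion B (activeIndices R n y)) = 0}) y with hΦ
  -- At each `y` only the summand of the index set active at `y` can be non-zero.
  have hΦsum : ∀ n, Φ n = fun y => ∑ S ∈ (Finset.range n).powerset,
      (activeIndices R n ⁻¹' {S} ∩ {y | Disjoint (pts y) (finUnion B S)}).indicator
        (fun _ => P {ω | η ω (finUnion B S) = 0}) y := by
    intro n
    ext y
    rw [Finset.sum_eq_single_of_mem _ (activeIndices_mem_powerset R n y)]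
    · by_cases hy : Disjoint (pts y) (finUnion B (activeIndices R n y))
      · rw [Set.indicator_of_mem (by exact ⟨rfl, hy⟩)]
        exact Set.indicator_of_mem (by exact hy) _
      · rw [Set.indicator_of_notMem (by exact fun h => hy h.2)]
        exact Set.indicator_of_notMem (by exact hy) _
    · intro S _ hS
      refine Set.indicator_of_notMem ?_ _
      rintro ⟨h1, -⟩
      exact hS h1.symm
  have hΦm : ∀ n, Measurable (Φ n) := by
    intro n
    rw [hΦsum]
    exact Finset.measurable_fun_sum _ fun S _ => measurable_const.indicator (hterm n S)
  have hstep : ∀ n, ∫⁻ ω, κ ω {y | η ω (finUnion B (activeIndices R n y)) = 0} ∂P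
      = ∫⁻ y, Φ n y ∂ρ := by
    intro n
    have hk : ∀ S, Measurable fun ω => κ ω (activeIndices R n ⁻¹' {S}) := fun S =>
      (Measure.measurable_coe (measurableSet_activeIndices_preimage hR n {S})).comp hκ
    rw [hΦsum, lintegral_finsetSum _ fun S _ => measurable_const.indicator (hterm n S)]
    have : ∀ ω, κ ω {y | η ω (finUnion B (activeIndices R n y)) = 0}
        = ∑ S ∈ (Finset.range n).powerset, {ω | η ω (finUnion B S) = 0}.indicator
          (fun ω => κ ω (activeIndices R n ⁻¹' {S})) ω := by
      intro ω
      rw [preimage_void_eq, measure_eq_sum_activeIndices hR n]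
      rfl
    simp_rw [this]
    rw [lintegral_finsetSum _ fun S _ => (hk S).indicator (hvoid S)]
    refine Finset.sum_congr rfl fun S _ => ?_
    rw [lintegral_indicator (hvoid S), rule _ _ (measurableSet_finUnion hB S)
      (measurableSet_activeIndices_preimage hR n {S}), lintegral_indicator_const (hterm n S)]
  have hlim1 : Tendsto
      (fun n => ∫⁻ ω, κ ω {y | η ω (finUnion B (activeIndices R n y)) = 0} ∂P) atTop
      (𝓝 (∫⁻ ω, κ ω {y | η ω (movingUnion R B y) = 0} ∂P)) := by
    refine tendsto_lintegral_of_dominated_convergence (fun ω => κ ω Set.univ)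
      (measurable_measure_void_fin hη hκ hR hB)
      (fun n => Eventually.of_forall fun ω => measure_mono (Set.subset_univ _)) hbound
      (Eventually.of_forall fun ω => ?_)
    have := hfin ω
    exact tendsto_measure_void hR (η ω)
  have hlim2 : Tendsto (fun n => ∫⁻ y, Φ n y ∂ρ) atTop
      (𝓝 (∫⁻ y, {y | Disjoint (pts y) (movingUnion R B y)}.indicator
          (fun y => P {ω | η ω (movingUnion R B y) = 0}) y ∂ρ)) := by
    refine tendsto_lintegral_of_dominated_convergence (fun _ => 1) hΦm
      (fun n => Eventually.of_forall fun y => ?_) (by simp)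
      (Eventually.of_forall fun y => ?_)
    · exact (Set.indicator_le_self' (by simp) y).trans prob_le_one
    · by_cases hy : Disjoint (pts y) (movingUnion R B y)
      · have hy' : ∀ n, Disjoint (pts y) (finUnion B (activeIndices R n y)) := by
          intro n
          refine hy.mono_right ?_
          rw [movingUnion_eq_iUnion]
          exact Set.subset_iUnion (fun n => finUnion B (activeIndices R n y)) n
        simp only [hΦ, Set.indicator, Set.mem_ofPred_eq, hy, hy', if_true]
        have hset : {ω | η ω (movingUnion R B y) = 0}
            = ⋂ n, {ω | η ω (finUnion B (activeIndices R n y)) = 0} := by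
          ext ω
          simp [movingUnion_eq_iUnion, measure_iUnion_null_iff]
        rw [hset]
        refine tendsto_measure_iInter_atTop (fun n => (hvoid _).nullMeasurableSet) ?_
          ⟨0, measure_ne_top _ _⟩
        intro m n hmn ω hω
        exact measure_mono_null (monotone_finUnion_activeIndices R B y hmn) hω
      -- A point of `pts y` in the limiting set already lies in some finite stage, so the indicators
      -- vanish from that stage on.
      · rw [Set.indicator_of_notMem (by exact hy)]
        obtain ⟨x, hx1, hx2⟩ := Set.not_disjoint_iff.1 hy
        rw [movingUnion_eq_iUnion, Set.mem_iUnion] at hx2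
        obtain ⟨n, hn⟩ := hx2
        refine tendsto_const_nhds.congr' ?_
        filter_upwards [eventually_ge_atTop n] with m hm
        refine (Set.indicator_of_notMem ?_ _).symm
        exact fun hd => Set.disjoint_left.1 hd hx1 (monotone_finUnion_activeIndices R B y hm hn)
  refine tendsto_nhds_unique hlim1 ?_
  simp_rw [hstep]
  exact hlim2

/-- An open set in a product of second countable spaces is a countable union of open rectangles. -/
theorem exists_movingUnion_of_isOpen {X Y : Type*} [TopologicalSpace X] [TopologicalSpace Y]
    [SecondCountableTopology X] [SecondCountableTopology Y] {O : Set (Y × X)} (hO : IsOpen O) :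
    ∃ (R : ℕ → Set Y) (B : ℕ → Set X), (∀ i, IsOpen (R i)) ∧ (∀ i, IsOpen (B i)) ∧
      ∀ y, movingUnion R B y = {x | (y, x) ∈ O} := by
  classical
  set T : Set (Set Y × Set X) :=
    {q | q ∈ TopologicalSpace.countableBasis Y ×ˢ TopologicalSpace.countableBasis X ∧
      q.1 ×ˢ q.2 ⊆ O} with hT
  -- The empty rectangle is added so that the family is non-empty and can be enumerated by ℕ; it
  -- contributes nothing to the unions.
  have hTc : (insert (∅, ∅) T : Set (Set Y × Set X)).Countable :=
    ((((TopologicalSpace.countable_countableBasis Y).prod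
      (TopologicalSpace.countable_countableBasis X)).mono fun q hq => hq.1)).insert _
  obtain ⟨f, hf⟩ := hTc.exists_eq_range (Set.insert_nonempty _ _)
  have hfmem : ∀ i, f i = (∅, ∅) ∨ f i ∈ T := fun i => by
    have : f i ∈ insert ((∅, ∅) : Set Y × Set X) T := hf ▸ Set.mem_range_self i
    simpa using this
  refine ⟨fun i => (f i).1, fun i => (f i).2, fun i => ?_, fun i => ?_, fun y => ?_⟩
  · rcases hfmem i with h | h
    · simp [h]
    · exact (TopologicalSpace.isBasis_countableBasis Y).isOpen h.1.1
  · rcases hfmem i with h | h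
    · simp [h]
    · exact (TopologicalSpace.isBasis_countableBasis X).isOpen h.1.2
  · ext x
    simp only [movingUnion, Set.mem_iUnion, exists_prop, Set.mem_ofPred_eq]
    constructor
    · rintro ⟨i, h1, h2⟩
      rcases hfmem i with h | h
      · simp [h] at h1
      · exact h.2 ⟨h1, h2⟩
    · intro hx
      obtain ⟨q, ⟨u, hu, v, hv, rfl⟩, hq1, hq2⟩ :=
        ((TopologicalSpace.isBasis_countableBasis Y).prod
          (TopologicalSpace.isBasis_countableBasis X)).exists_subset_of_mem_open hx hO
      have : (u, v) ∈ Set.range f := hf ▸ Set.mem_insert_of_mem _ ⟨⟨hu, hv⟩, hq2⟩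
      obtain ⟨i, hi⟩ := this
      exact ⟨i, by simpa [hi] using hq1.1, by simpa [hi] using hq1.2⟩

end Moving

/-! ### Restricted processes, their pair sums, and the void rule for pairs -/

theorem setOf_disjoint_pair {X : Type*} (B : Set X) :
    {z : X × X | Disjoint {z.1, z.2} B} = Bᶜ ×ˢ Bᶜ := by
  ext z
  simp [Set.disjoint_insert_left]

section Poisson

variable {Ω X : Type*} [MeasurableSpace Ω] [MeasurableSpace X] {η : Ω → Measure X}
  {μ : Measure X} {P : Measure Ω}

open Classical in
/-- The restriction of a random measure to `K`, set to zero where it is not finite on `K`. -/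
noncomputable def finRestrict (η : Ω → Measure X) (K : Set X) (ω : Ω) : Measure X :=
  if η ω K < ∞ then (η ω).restrict K else 0

instance isFiniteMeasure_finRestrict (η : Ω → Measure X) (K : Set X) (ω : Ω) :
    IsFiniteMeasure (finRestrict η K ω) := by
  unfold finRestrict
  split_ifs with h
  · exact ⟨by simpa using h⟩
  · infer_instance

theorem measurable_finRestrict (hη : Measurable η) {K : Set X} (hK : MeasurableSet K) :
    Measurable (finRestrict η K) := by
  classical
  refine Measurable.ite (((Measure.measurable_coe hK).comp hη) measurableSet_Iio) ?_
    measurable_const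
  refine Measure.measurable_of_measurable_coe _ fun s hs => ?_
  simp_rw [Measure.restrict_apply hs]
  exact (Measure.measurable_coe (hs.inter hK)).comp hη

/-- Rectangles form a π-system on which the product measure is a product of two measurable
functions; passing from there to all measurable sets uses that the measures are finite, which is the
purpose of `finRestrict`. -/
theorem measurable_finRestrict_prod (hη : Measurable η) {K : Set X} (hK : MeasurableSet K) :
    Measurable fun ω => (finRestrict η K ω).prod (finRestrict η K ω) := by
  have hm := measurable_finRestrict hη hK
  refine Measurable.measure_of_isPiSystem generateFrom_prod.symm isPiSystem_prod ?_ ?_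
  · rintro _ ⟨s, hs, t, ht, rfl⟩
    simp_rw [Measure.prod_prod]
    exact ((Measure.measurable_coe hs).comp hm).mul ((Measure.measurable_coe ht).comp hm)
  · simp_rw [← Set.univ_prod_univ, Measure.prod_prod]
    exact ((Measure.measurable_coe .univ).comp hm).mul ((Measure.measurable_coe .univ).comp hm)

/-- The second moment measure of a Poisson process with intensity measure `μ`. -/
noncomputable def pairIntensity (μ : Measure X) : Measure (X × X) :=
  μ.prod μ + μ.map fun x => (x, x)

instance isFiniteMeasure_pairIntensity (μ : Measure X) [IsFiniteMeasure μ] :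
    IsFiniteMeasure (pairIntensity μ) := by
  unfold pairIntensity
  infer_instance

theorem measurableSet_disjoint_singleton {B : Set X} (hB : MeasurableSet B) :
    MeasurableSet {x : X | Disjoint {x} B} := by
  simp only [Set.disjoint_singleton_left]
  exact hB.compl

namespace IsPoissonProcess

theorem ae_finRestrict_eq (h : IsPoissonProcess η μ P) {K : Set X} (hK : MeasurableSet K)
    (hμ : μ K ≠ ∞) : ∀ᵐ ω ∂P, finRestrict η K ω = (η ω).restrict K := by
  filter_upwards [h.ae_apply_lt_top hK hμ] with ω hω
  simp [finRestrict, hω]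

theorem setLIntegral_void_finRestrict (h : IsPoissonProcess η μ P) {K : Set X}
    (hK : MeasurableSet K) (hμ : μ K ≠ ∞) (B D : Set X) (hB : MeasurableSet B)
    (hD : MeasurableSet D) :
    ∫⁻ ω in {ω | η ω B = 0}, finRestrict η K ω D ∂P
      = P {ω | η ω B = 0} * μ.restrict K (D ∩ {x | Disjoint {x} B}) := by
  have e : ∫⁻ ω in {ω | η ω B = 0}, finRestrict η K ω D ∂P
      = ∫⁻ ω in {ω | η ω B = 0}, η ω (D ∩ K) ∂P := by
    refine lintegral_congr_ae (ae_restrict_of_ae ?_)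
    filter_upwards [h.ae_finRestrict_eq hK hμ] with ω hω
    rw [hω, Measure.restrict_apply hD]
  rw [e, h.setLIntegral_void_apply (hD.inter hK) hB
    (measure_ne_top_of_subset Set.inter_subset_right hμ),
    Measure.restrict_apply (hD.inter (measurableSet_disjoint_singleton hB))]
  congr 2
  ext x
  simp
  tauto

/-- As functions of `D` both sides are measures on pairs, so it suffices to compare them on
rectangles, where `setLIntegral_void_apply_mul` applies. Its excess term becomes the diagonal part
of `pairIntensity`, since the square of the process also pairs each point with itself. -/
theorem setLIntegral_void_finRestrict_prod [IsProbabilityMeasure P] (h : IsPoissonProcess η μ P)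
    {K : Set X} (hK : MeasurableSet K) (hμ : μ K ≠ ∞) (B : Set X) (D : Set (X × X))
    (hB : MeasurableSet B) (hD : MeasurableSet D) :
    ∫⁻ ω in {ω | η ω B = 0}, (finRestrict η K ω).prod (finRestrict η K ω) D ∂P
      = P {ω | η ω B = 0} *
        pairIntensity (μ.restrict K) (D ∩ {z | Disjoint {z.1, z.2} B}) := by
  have : IsFiniteMeasure (μ.restrict K) := ⟨by simpa using hμ.lt_top⟩
  have hm := measurable_finRestrict_prod h.measurable hK
  rw [setOf_disjoint_pair]
  have hG : MeasurableSet (Bᶜ ×ˢ Bᶜ) := hB.compl.prod hB.compl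
  set m₁ := (P.restrict {ω | η ω B = 0}).bind
    fun ω => (finRestrict η K ω).prod (finRestrict η K ω)
  set m₂ := P {ω | η ω B = 0} • (pairIntensity (μ.restrict K)).restrict (Bᶜ ×ˢ Bᶜ) with hm₂
  have hfin : IsFiniteMeasure m₂ := Measure.smul_finite _ (measure_ne_top _ _)
  -- The equality is stated in this direction because finiteness is evident for `m₂`.
  suffices m₂ = m₁ by
    rw [← Measure.bind_apply hD hm.aemeasurable]
    change m₁ D = _
    rw [← this, hm₂, Measure.smul_apply, Measure.restrict_apply hD, smul_eq_mul]
  refine Measure.ext_prod fun {s t} hs ht => ?_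
  have e : ∫⁻ ω in {ω | η ω B = 0}, (finRestrict η K ω).prod (finRestrict η K ω) (s ×ˢ t) ∂P
      = ∫⁻ ω in {ω | η ω B = 0}, η ω (s ∩ K) * η ω (t ∩ K) ∂P := by
    refine lintegral_congr_ae (ae_restrict_of_ae ?_)
    filter_upwards [h.ae_finRestrict_eq hK hμ] with ω hω
    rw [Measure.prod_prod, hω, Measure.restrict_apply hs, Measure.restrict_apply ht]
  rw [Measure.bind_apply (hs.prod ht) hm.aemeasurable, e, h.setLIntegral_void_apply_mul
    (hs.inter hK) (ht.inter hK) hB (measure_ne_top_of_subset Set.inter_subset_right hμ)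
    (measure_ne_top_of_subset Set.inter_subset_right hμ), hm₂, Measure.smul_apply,
    Measure.restrict_apply (hs.prod ht), smul_eq_mul, pairIntensity, Measure.add_apply,
    Set.prod_inter_prod, Measure.prod_prod, Measure.map_apply (by fun_prop)
      ((hs.inter hB.compl).prod (ht.inter hB.compl)),
    Measure.restrict_apply (hs.inter hB.compl), Measure.restrict_apply (ht.inter hB.compl),
    Measure.restrict_apply]
  · congr 3
    · congr 1
      ext x
      simp
      tauto
    · congr 1
      ext x
      simp
      tauto
    · ext x
      simp
      tauto
  · exact (measurable_id.prodMk measurable_id) ((hs.inter hB.compl).prod (ht.inter hB.compl))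

/-- A null set of pairs of distinct points carries no pair of points of the process. -/
theorem ae_prod_apply_eq_zero [IsProbabilityMeasure P] [SigmaFinite μ]
    (h : IsPoissonProcess η μ P) {D : Set (X × X)} (hD : MeasurableSet D)
    (hdiag : ∀ x, (x, x) ∉ D) (hμD : μ.prod μ D = 0) :
    ∀ᵐ ω ∂P, (η ω).prod (η ω) D = 0 := by
  set K := spanningSets μ
  have hKm : ∀ n, MeasurableSet (K n) := measurableSet_spanningSets μ
  have hKf : ∀ n, μ (K n) ≠ ∞ := fun n => (measure_spanningSets_lt_top μ n).ne
  have hn : ∀ n, ∀ᵐ ω ∂P, (finRestrict η (K n) ω).prod (finRestrict η (K n) ω) D = 0 := by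
    intro n
    have e := h.setLIntegral_void_finRestrict_prod (hKm n) (hKf n) ∅ D .empty hD
    simp only [measure_empty, Set.ofPred_true, setLIntegral_univ, Set.disjoint_empty,
      Set.inter_univ, measure_univ, one_mul] at e
    -- `D` avoids the diagonal, so only the product part of the pair intensity could charge it.
    have hz : pairIntensity (μ.restrict (K n)) D = 0 := by
      rw [pairIntensity, Measure.add_apply, Measure.map_apply (by fun_prop) hD,
        Measure.prod_restrict, add_eq_zero]
      refine ⟨le_antisymm ((Measure.restrict_le_self D).trans hμD.le) zero_le, ?_⟩
      have : (fun x : X => (x, x)) ⁻¹' D = ∅ := Set.eq_empty_of_forall_notMem hdiag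
      rw [this, measure_empty]
    rw [hz, lintegral_eq_zero_iff] at e
    · exact e
    · exact (Measure.measurable_coe hD).comp (measurable_finRestrict_prod h.measurable (hKm n))
  have hall : ∀ᵐ ω ∂P, ∀ n, finRestrict η (K n) ω = (η ω).restrict (K n) :=
    ae_all_iff.2 fun n => h.ae_finRestrict_eq (hKm n) (hKf n)
  filter_upwards [ae_all_iff.2 hn, hall] with ω h1 h2
  have := h.sigmaFinite ω
  -- As `K` is increasing, the squares `K n ×ˢ K n` exhaust the product space.
  have hcov : D = ⋃ n, D ∩ (K n ×ˢ K n) := by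
    rw [← Set.inter_iUnion, Set.iUnion_prod_of_monotone (monotone_spanningSets μ)
      (monotone_spanningSets μ), iUnion_spanningSets, Set.univ_prod_univ, Set.inter_univ]
  rw [hcov, measure_iUnion_null_iff]
  intro n
  have := h1 n
  rw [h2 n, Measure.prod_restrict, Measure.restrict_apply hD] at this
  exact this

end IsPoissonProcess

/-- A counting measure is carried by atoms of mass at least one. This turns the pointwise definition
of exposure into a void event. -/
theorem IsCountingMeasure.apply_eq_zero_iff [MeasurableSingletonClass X] {M : Measure X}
    (hM : IsCountingMeasure M) {S : Set X} (hS : MeasurableSet S) :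
    M S = 0 ↔ ∀ y ∈ S, ¬ 1 ≤ M {y} := by
  constructor
  · intro h y hy h1
    have : M {y} = 0 := measure_mono_null (Set.singleton_subset_iff.2 hy) h
    simp [this] at h1
  · intro h
    obtain ⟨-, I, p, rfl⟩ := hM
    rw [Measure.sum_apply _ hS, ENNReal.tsum_eq_zero]
    intro i
    rw [Measure.dirac_apply' _ hS, Set.indicator_of_notMem]
    intro hi
    refine h _ hi ?_
    calc (1 : ℝ≥0∞) = Measure.dirac (p i) {p i} := by simp
      _ ≤ _ := Measure.le_sum (fun i : I => Measure.dirac (p i)) i _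

end Poisson

/-! ### Past cones -/

section Cones

variable {d : ℕ}

/-- The seeds whose growth region contains the birth point of `x`. -/
def pastCone (x : Seed d) : Set (Seed d) := {y | (x.1, x.2.1) ∈ growthRegion y}

/-- The seeds `y` whose growth region contains the birth point of `x` in its interior. -/
def openPastCone (x : Seed d) : Set (Seed d) :=
  {y | ‖x.1 - y.1‖ < ((y.2.2 * (x.2.1 - y.2.1) : ℝ≥0) : ℝ)}

theorem mem_pastCone {x y : Seed d} :
    y ∈ pastCone x ↔ y.2.1 ≤ x.2.1 ∧ ‖x.1 - y.1‖ ≤ ((y.2.2 * (x.2.1 - y.2.1) : ℝ≥0) : ℝ) := by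
  change (y.2.1 ≤ x.2.1 ∧ ‖x.1 - y.1‖ ≤ (y.2.2 : ℝ) * ((x.2.1 : ℝ) - (y.2.1 : ℝ))) ↔ _
  refine and_congr_right fun h => ?_
  rw [NNReal.coe_mul, NNReal.coe_sub h]

theorem mem_openPastCone {x y : Seed d} :
    y ∈ openPastCone x ↔ ‖x.1 - y.1‖ < ((y.2.2 * (x.2.1 - y.2.1) : ℝ≥0) : ℝ) := Iff.rfl

theorem mem_openPastCone_iff_mem_ball {x y : Seed d} :
    y ∈ openPastCone x ↔ y.1 ∈ Metric.ball x.1 (y.2.2 * (x.2.1 - y.2.1) : ℝ≥0) := by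
  rw [mem_openPastCone, mem_ball_iff_norm']

theorem mem_openPastCone_iff_mem_ball' {x y : Seed d} :
    y ∈ openPastCone x ↔ x.1 ∈ Metric.ball y.1 (y.2.2 * (x.2.1 - y.2.1) : ℝ≥0) := by
  rw [mem_openPastCone, mem_ball_iff_norm]

/-- If `y` were born after `x`, the truncated time difference would be zero and the strict
inequality would bound a norm by zero; so the cone needs no separate condition on birth times. -/
theorem openPastCone_subset (x : Seed d) : openPastCone x ⊆ pastCone x := by
  intro y hy
  rw [mem_openPastCone] at hy
  refine mem_pastCone.2 ⟨?_, hy.le⟩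
  by_contra! hlt
  rw [tsub_eq_zero_of_le hlt.le, mul_zero, NNReal.coe_zero] at hy
  exact absurd hy (norm_nonneg _).not_gt

theorem notMem_openPastCone_self (x : Seed d) : x ∉ openPastCone x := by
  simp [mem_openPastCone]

/-- Openness is one reason for working with strict cones: it makes the relation a countable union of
rectangles. The other is that no seed lies in its own open cone, so no point has to be removed. -/
theorem isOpen_openPastCone_rel : IsOpen {z : Seed d × Seed d | z.2 ∈ openPastCone z.1} := by
  simp only [mem_openPastCone]
  exact isOpen_lt (by fun_prop) (by fun_prop)

theorem isClosed_pastCone_rel : IsClosed {z : Seed d × Seed d | z.2 ∈ pastCone z.1} := by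
  simp only [mem_pastCone]
  have h1 : IsClosed {z : Seed d × Seed d | z.2.2.1 ≤ z.1.2.1} :=
    isClosed_le (by fun_prop) (by fun_prop)
  have h2 : IsClosed {z : Seed d × Seed d |
      ‖z.1.1 - z.2.1‖ ≤ ((z.2.2.2 * (z.1.2.1 - z.2.2.1) : ℝ≥0) : ℝ)} :=
    isClosed_le (by fun_prop) (by fun_prop)
  exact h1.inter h2

theorem measurableSet_openPastCone (x : Seed d) : MeasurableSet (openPastCone x) :=
  measurable_prodMk_left isOpen_openPastCone_rel.measurableSet

theorem measurableSet_pastCone (x : Seed d) : MeasurableSet (pastCone x) :=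
  measurable_prodMk_left isClosed_pastCone_rel.measurableSet

theorem seedExposed_iff {M : Measure (Seed d)} (hM : IsCountingMeasure M) (x : Seed d) :
    SeedExposed x M ↔ M (pastCone x \ {x}) = 0 := by
  rw [hM.apply_eq_zero_iff ((measurableSet_pastCone x).diff (measurableSet_singleton x))]
  constructor
  · rintro h y ⟨hy, hyx⟩ h1
    exact h y h1 hyx hy
  · intro h y h1 hyx hy
    exact h y ⟨hy, hyx⟩ h1

theorem ofReal_ballVol (d : ℕ) :
    ENNReal.ofReal (ballVol d) = volume (Metric.ball (0 : EuclideanSpace ℝ (Fin d)) 1) := by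
  rw [ballVol, ofReal_measureReal (isCompact_closedBall _ _).measure_lt_top.ne,
    Measure.addHaar_unitClosedBall_eq_addHaar_unitBall]

theorem ballVol_pos (d : ℕ) : 0 < ballVol d := by
  rw [ballVol, measureReal_def, ENNReal.toReal_pos_iff]
  exact ⟨Metric.measure_closedBall_pos _ _ one_pos, (isCompact_closedBall _ _).measure_lt_top⟩

theorem nontrivial_euclideanSpace (hd : 1 ≤ d) : Nontrivial (EuclideanSpace ℝ (Fin d)) := by
  have : Nonempty (Fin d) := ⟨⟨0, hd⟩⟩
  infer_instance

theorem volume_ball_nnreal (hd : 1 ≤ d) (z : EuclideanSpace ℝ (Fin d)) (r : ℝ≥0) :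
    volume (Metric.ball z (r : ℝ)) = ENNReal.ofReal (ballVol d) * (r : ℝ≥0∞) ^ d := by
  have := nontrivial_euclideanSpace hd
  rw [Measure.addHaar_ball volume z (NNReal.coe_nonneg r), ofReal_ballVol,
    finrank_euclideanSpace_fin, ENNReal.ofReal_pow (NNReal.coe_nonneg r), ENNReal.ofReal_coe_nnreal,
    mul_comm]

variable {θ ν : Measure ℝ≥0}

instance sigmaFinite_intensity [IsLocallyFiniteMeasure θ] [IsProbabilityMeasure ν] :
    SigmaFinite (intensity d θ ν) := by
  unfold intensity
  infer_instance

/-- The spatial integral is put innermost: for a fixed birth time and speed a cone is a ball, whose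
volume is explicit. -/
theorem lintegral_intensity_symm [IsLocallyFiniteMeasure θ] [IsProbabilityMeasure ν]
    {f : Seed d → ℝ≥0∞} (hf : Measurable f) :
    ∫⁻ y, f y ∂(intensity d θ ν) = ∫⁻ s, ∫⁻ v, ∫⁻ z, f (z, s, v) ∂volume ∂ν ∂θ := by
  rw [intensity, lintegral_prod_symm _ hf.aemeasurable, lintegral_prod _ ?_]
  exact (hf.lintegral_prod_left').aemeasurable

/-- Integration over a past cone of a function of birth time and speed. -/
theorem setLIntegral_openPastCone [IsLocallyFiniteMeasure θ] [IsProbabilityMeasure ν]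
    (hd : 1 ≤ d) (x : Seed d) {g : ℝ≥0 × ℝ≥0 → ℝ≥0∞} (hg : Measurable g) :
    ∫⁻ y in openPastCone x, g y.2 ∂(intensity d θ ν)
      = ENNReal.ofReal (ballVol d) *
        ∫⁻ s, ∫⁻ v, ((v * (x.2.1 - s) : ℝ≥0) : ℝ≥0∞) ^ d * g (s, v) ∂ν ∂θ := by
  have hm := measurableSet_openPastCone x
  have hF : Measurable fun p : ℝ≥0 × ℝ≥0 => ((p.2 * (x.2.1 - p.1) : ℝ≥0) : ℝ≥0∞) ^ d * g p := by
    fun_prop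
  have hg2 : Measurable fun y : Seed d => g y.2 := hg.comp measurable_snd
  rw [← lintegral_indicator hm, lintegral_intensity_symm (hg2.indicator hm),
    ← lintegral_const_mul _ hF.lintegral_prod_right']
  refine lintegral_congr fun s => ?_
  have hFs : Measurable fun v : ℝ≥0 => ((v * (x.2.1 - s) : ℝ≥0) : ℝ≥0∞) ^ d * g (s, v) :=
    hF.comp measurable_prodMk_left
  rw [← lintegral_const_mul _ hFs]
  refine lintegral_congr fun v => ?_
  have : ∀ z, (openPastCone x).indicator (fun y : Seed d => g y.2) (z, s, v)
      = (Metric.ball x.1 (v * (x.2.1 - s) : ℝ≥0)).indicator (fun _ => g (s, v)) z := by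
    intro z
    by_cases hz : ((z, s, v) : Seed d) ∈ openPastCone x
    · rw [Set.indicator_of_mem hz, Set.indicator_of_mem (mem_openPastCone_iff_mem_ball.1 hz)]
    · rw [Set.indicator_of_notMem hz, Set.indicator_of_notMem
        (fun h => hz (mem_openPastCone_iff_mem_ball.2 h))]
  simp_rw [this]
  rw [lintegral_indicator_const Metric.isOpen_ball.measurableSet, volume_ball_nnreal hd]
  ring

/-- For a fixed birth time and speed the remaining locations lie on a sphere around `x.1`, which is
Lebesgue null, also at radius zero because d ≥ 1. -/
theorem intensity_pastCone_diff [IsLocallyFiniteMeasure θ] [IsProbabilityMeasure ν]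
    (hd : 1 ≤ d) (x : Seed d) : intensity d θ ν (pastCone x \ openPastCone x) = 0 := by
  have := nontrivial_euclideanSpace hd
  have hm := (measurableSet_pastCone x).diff (measurableSet_openPastCone x)
  rw [← lintegral_indicator_one hm, lintegral_intensity_symm (measurable_one.indicator hm)]
  have h0 : ∀ s v, ∫⁻ z, (pastCone x \ openPastCone x).indicator (1 : Seed d → ℝ≥0∞) (z, s, v)
      = 0 := by
    intro s v
    refine le_antisymm ?_ zero_le
    rw [← Measure.addHaar_sphere volume x.1 (v * (x.2.1 - s) : ℝ≥0),
      ← lintegral_indicator_one Metric.isClosed_sphere.measurableSet]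
    refine lintegral_mono fun z => ?_
    by_cases hz : ((z, s, v) : Seed d) ∈ pastCone x \ openPastCone x
    · have h1 := (mem_pastCone.1 hz.1).2
      have h2 := hz.2
      rw [mem_openPastCone, not_lt] at h2
      rw [Set.indicator_of_mem hz, Set.indicator_of_mem]
      · simp
      · rw [Metric.mem_sphere, dist_eq_norm, norm_sub_rev]
        exact le_antisymm h1 h2
    · rw [Set.indicator_of_notMem hz]
      exact zero_le
  simp [h0]

end Cones

/-! ### Speed moments, and Λ and w expressed through intensities of past cones -/

section Weights

variable {d : ℕ} {θ ν : Measure ℝ≥0}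

/-- Lower powers are dominated by v^(7d) + 1, split according to whether v ≤ 1. -/
theorem SpeedCondition.integrable_pow [IsProbabilityMeasure ν] (hν : SpeedCondition d ν) {k : ℕ}
    (hk : k ≤ 7 * d) : Integrable (fun v : ℝ≥0 => (v : ℝ) ^ k) ν := by
  refine Integrable.mono' (hν.add (integrable_const 1)) (by fun_prop)
    (Filter.Eventually.of_forall fun v => ?_)
  simp only [Pi.add_apply, norm_pow, Real.norm_eq_abs, NNReal.abs_eq]
  rcases le_total (v : ℝ) 1 with h | h
  · exact (pow_le_one₀ v.2 h).trans (le_add_of_nonneg_left (by positivity))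
  · exact (pow_le_pow_right₀ h hk).trans (le_add_of_nonneg_right zero_le_one)

theorem ofReal_nnreal_pow (v : ℝ≥0) (k : ℕ) :
    ENNReal.ofReal ((v : ℝ) ^ k) = (v : ℝ≥0∞) ^ k := by
  rw [ENNReal.ofReal_pow (NNReal.coe_nonneg v), ENNReal.ofReal_coe_nnreal]

theorem SpeedCondition.lintegral_pow [IsProbabilityMeasure ν] (hν : SpeedCondition d ν) {k : ℕ}
    (hk : k ≤ 7 * d) : ∫⁻ v, (v : ℝ≥0∞) ^ k ∂ν = ENNReal.ofReal (speedMoment ν k) := by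
  rw [speedMoment, ofReal_integral_eq_lintegral_ofReal (hν.integrable_pow hk)
    (Filter.Eventually.of_forall fun v => by positivity)]
  simp_rw [ofReal_nnreal_pow]

theorem speedMoment_nonneg (ν : Measure ℝ≥0) (k : ℕ) : 0 ≤ speedMoment ν k :=
  integral_nonneg fun v => by positivity

/-- A factor `(t - s)₊ ^ d` with `d ≥ 1` restricts an integral in `s` to `[0, t]`. -/
theorem lintegral_tsub_pow_mul (hd : 1 ≤ d) (t : ℝ≥0) (g : ℝ≥0 → ℝ≥0∞) :
    ∫⁻ s, ((t - s : ℝ≥0) : ℝ≥0∞) ^ d * g s ∂θ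
      = ∫⁻ s in Set.Icc 0 t, ((t - s : ℝ≥0) : ℝ≥0∞) ^ d * g s ∂θ := by
  rw [← lintegral_indicator measurableSet_Icc]
  refine lintegral_congr fun s => ?_
  by_cases hs : s ≤ t
  · rw [Set.indicator_of_mem (Set.mem_Icc.2 ⟨zero_le, hs⟩)]
  · rw [Set.indicator_of_notMem (fun h => hs h.2), tsub_eq_zero_of_le (not_le.1 hs).le]
    simp [Nat.one_le_iff_ne_zero.1 hd]

theorem measure_Icc_lt_top' [IsLocallyFiniteMeasure θ] (s t : ℝ≥0) : θ (Set.Icc s t) < ∞ :=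
  isCompact_Icc.measure_lt_top

theorem ofReal_sub_pow {s t : ℝ≥0} (h : s ≤ t) (k : ℕ) :
    ENNReal.ofReal (((t : ℝ) - s) ^ k) = ((t - s : ℝ≥0) : ℝ≥0∞) ^ k := by
  rw [← NNReal.coe_sub h, ofReal_nnreal_pow]

theorem ofReal_Lam [IsLocallyFiniteMeasure θ] (hd : 1 ≤ d) (t : ℝ≥0) :
    ENNReal.ofReal (Lam d θ t)
      = ENNReal.ofReal (ballVol d) * ∫⁻ s, ((t - s : ℝ≥0) : ℝ≥0∞) ^ d ∂θ := by
  have e := lintegral_tsub_pow_mul (θ := θ) hd t (fun _ => 1)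
  simp only [mul_one] at e
  have hint : IntegrableOn (fun s : ℝ≥0 => ((t : ℝ) - s) ^ d) (Set.Icc 0 t) θ :=
    ContinuousOn.integrableOn_compact isCompact_Icc (by fun_prop)
  rw [Lam, ENNReal.ofReal_mul (ballVol_pos d).le, e, ofReal_integral_eq_lintegral_ofReal hint]
  · congr 1
    exact setLIntegral_congr_fun measurableSet_Icc fun s hs => ofReal_sub_pow hs.2 d
  · filter_upwards [ae_restrict_mem measurableSet_Icc] with s hs
    have : (s : ℝ) ≤ t := hs.2
    exact pow_nonneg (sub_nonneg.2 this) d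

theorem Lam_nonneg (t : ℝ≥0) : 0 ≤ Lam d θ t := by
  refine mul_nonneg (ballVol_pos d).le (setIntegral_nonneg measurableSet_Icc fun s hs => ?_)
  have : (s : ℝ) ≤ t := hs.2
  exact pow_nonneg (sub_nonneg.2 this) d

variable [IsLocallyFiniteMeasure θ] [IsProbabilityMeasure ν]

theorem intensity_openPastCone (hd : 1 ≤ d) (hν : SpeedCondition d ν) (x : Seed d) :
    intensity d θ ν (openPastCone x)
      = ENNReal.ofReal (speedMoment ν d * Lam d θ x.2.1) := by
  have e := setLIntegral_openPastCone (θ := θ) (ν := ν) hd x (g := fun _ => 1) measurable_const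
  rw [setLIntegral_one] at e
  rw [e, ENNReal.ofReal_mul (speedMoment_nonneg ν d), ofReal_Lam hd,
    ← hν.lintegral_pow (by omega)]
  simp only [ENNReal.coe_mul, mul_pow, mul_one]
  have : ∀ s : ℝ≥0, ∫⁻ v : ℝ≥0, (v : ℝ≥0∞) ^ d * ((x.2.1 - s : ℝ≥0) : ℝ≥0∞) ^ d ∂ν
      = (∫⁻ v : ℝ≥0, (v : ℝ≥0∞) ^ d ∂ν) * ((x.2.1 - s : ℝ≥0) : ℝ≥0∞) ^ d := fun s =>
    lintegral_mul_const _ (by fun_prop)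
  simp_rw [this]
  rw [lintegral_const_mul _ (by fun_prop)]
  ring

theorem intensity_openPastCone_ne_top (hd : 1 ≤ d) (hν : SpeedCondition d ν) (x : Seed d) :
    intensity d θ ν (openPastCone x) ≠ ∞ := by
  rw [intensity_openPastCone hd hν]
  exact ENNReal.ofReal_ne_top

theorem toReal_intensity_openPastCone (hd : 1 ≤ d) (hν : SpeedCondition d ν) (x : Seed d) :
    (intensity d θ ν (openPastCone x)).toReal = speedMoment ν d * Lam d θ x.2.1 := by
  rw [intensity_openPastCone hd hν, ENNReal.toReal_ofReal
    (mul_nonneg (speedMoment_nonneg ν d) (Lam_nonneg _))]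

theorem wt_eq_exp_intensity (hd : 1 ≤ d) (hν : SpeedCondition d ν) (x : Seed d) :
    wt d θ ν x.2.1 = Real.exp (-(intensity d θ ν (openPastCone x)).toReal) := by
  rw [toReal_intensity_openPastCone hd hν, wt]

theorem intensity_pastCone_diff_singleton (hd : 1 ≤ d) (x : Seed d) :
    intensity d θ ν (pastCone x \ {x}) = intensity d θ ν (openPastCone x) := by
  refine le_antisymm ?_ (measure_mono fun y hy => ⟨openPastCone_subset x hy, ?_⟩)
  · calc intensity d θ ν (pastCone x \ {x})
        ≤ intensity d θ ν (openPastCone x ∪ (pastCone x \ openPastCone x)) := by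
          refine measure_mono fun y hy => ?_
          by_cases h : y ∈ openPastCone x
          · exact Or.inl h
          · exact Or.inr ⟨hy.1, h⟩
      _ ≤ _ := (measure_union_le _ _).trans (by rw [intensity_pastCone_diff hd, add_zero])
  · rintro rfl
    exact notMem_openPastCone_self y hy

theorem measurable_Lam (hd : 1 ≤ d) : Measurable (Lam d θ) := by
  have h : Lam d θ = fun t => (ENNReal.ofReal (ballVol d) *
      ∫⁻ s, ((t - s : ℝ≥0) : ℝ≥0∞) ^ d ∂θ).toReal := by
    ext t
    rw [← ofReal_Lam hd, ENNReal.toReal_ofReal (Lam_nonneg t)]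
  rw [h]
  refine (Measurable.const_mul ?_ _).ennreal_toReal
  have : Measurable fun p : ℝ≥0 × ℝ≥0 => ((p.1 - p.2 : ℝ≥0) : ℝ≥0∞) ^ d := by fun_prop
  exact this.lintegral_prod_right'

omit [IsProbabilityMeasure ν] in
theorem measurable_wt (hd : 1 ≤ d) : Measurable (wt d θ ν) := by
  unfold wt
  have := measurable_Lam (d := d) (θ := θ) hd
  fun_prop

omit [IsLocallyFiniteMeasure θ] [IsProbabilityMeasure ν] in
theorem wt_pos (t : ℝ≥0) : 0 < wt d θ ν t := Real.exp_pos _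

omit [IsLocallyFiniteMeasure θ] [IsProbabilityMeasure ν] in
theorem wt_le_one (t : ℝ≥0) : wt d θ ν t ≤ 1 :=
  Real.exp_le_one_iff.2 (neg_nonpos.2 (mul_nonneg (speedMoment_nonneg ν d) (Lam_nonneg t)))

end Weights

/-! ### First and second moments of the number of exposed points -/

section Model

variable {d : ℕ} {θ ν : Measure ℝ≥0} [IsLocallyFiniteMeasure θ] [IsProbabilityMeasure ν]
  {Ω : Type*} [MeasurableSpace Ω] {P : Measure Ω} [IsProbabilityMeasure P]
  {η : Ω → Measure (Seed d)}

omit [IsProbabilityMeasure P] in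
theorem prob_openPastCone_empty (hd : 1 ≤ d) (hν : SpeedCondition d ν)
    (h : IsPoissonProcess η (intensity d θ ν) P) (x : Seed d) :
    P {ω | η ω (openPastCone x) = 0} = ENNReal.ofReal (wt d θ ν x.2.1) := by
  rw [h.void_prob (measurableSet_openPastCone x) (intensity_openPastCone_ne_top hd hν x),
    wt_eq_exp_intensity hd hν]

omit [IsProbabilityMeasure P] in
/-- The exposure probability `w(t)` of a seed born at time `t`. -/
theorem integral_exposure (hd : 1 ≤ d) (hν : SpeedCondition d ν)
    (h : IsPoissonProcess η (intensity d θ ν) P) (x : Seed d) :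
    ∫ ω, exposure x (η ω) ∂P = wt d θ ν x.2.1 := by
  have hm : MeasurableSet (pastCone x \ {x}) :=
    (measurableSet_pastCone x).diff (measurableSet_singleton x)
  have e : ∀ ω, exposure x (η ω)
      = {ω | η ω (pastCone x \ {x}) = 0}.indicator (1 : Ω → ℝ) ω := by
    intro ω
    rw [exposure]
    by_cases hx : SeedExposed x (η ω)
    · rw [if_pos hx, Set.indicator_of_mem (by exact (seedExposed_iff (h.counting ω) x).1 hx)]
      rfl
    · rw [if_neg hx, Set.indicator_of_notMem
        (by exact fun h' => hx ((seedExposed_iff (h.counting ω) x).2 h'))]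
  simp_rw [e]
  have hne : intensity d θ ν (pastCone x \ {x}) ≠ ∞ := by
    rw [intensity_pastCone_diff_singleton hd]
    exact intensity_openPastCone_ne_top hd hν x
  rw [integral_indicator_one (h.measurableSet_void hm), measureReal_def, h.void_prob hm hne,
    intensity_pastCone_diff_singleton hd, ← wt_eq_exp_intensity hd hν,
    ENNReal.toReal_ofReal (wt_pos _).le]

/-- Almost surely, no birth point lies on the boundary of another growth region. -/
theorem ae_seedExposed_iff (hd : 1 ≤ d) (h : IsPoissonProcess η (intensity d θ ν) P) :
    ∀ᵐ ω ∂P, ∀ᵐ x ∂(η ω), SeedExposed x (η ω) ↔ η ω (openPastCone x) = 0 := by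
  -- Pairs whose second entry lies on the boundary of the past cone of the first. By Fubini this set
  -- is null for the product intensity, so almost surely no two distinct points form such a pair.
  set D : Set (Seed d × Seed d) :=
    ({z | z.2 ∈ pastCone z.1} \ {z | z.2 ∈ openPastCone z.1}) \ {z | z.1 = z.2} with hD
  have hDm : MeasurableSet D :=
    (isClosed_pastCone_rel.measurableSet.diff isOpen_openPastCone_rel.measurableSet).diff
      isClosed_diagonal.measurableSet
  have hsec : ∀ x, Prod.mk x ⁻¹' D = (pastCone x \ openPastCone x) \ {x} := by
    intro x
    ext y
    simp [hD, eq_comm]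
  have h0 : (intensity d θ ν).prod (intensity d θ ν) D = 0 := by
    rw [Measure.measure_prod_null hDm]
    refine Filter.Eventually.of_forall fun x => ?_
    change intensity d θ ν (Prod.mk x ⁻¹' D) = 0
    rw [hsec]
    exact measure_mono_null Set.sdiff_subset (intensity_pastCone_diff hd x)
  filter_upwards [h.ae_prod_apply_eq_zero hDm (fun x hx => hx.2 rfl) h0] with ω hω
  have := h.sigmaFinite ω
  filter_upwards [Measure.measure_ae_null_of_prod_null hω] with x hx
  rw [hsec] at hx
  rw [seedExposed_iff (h.counting ω)]
  constructor
  · intro h'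
    refine measure_mono_null (t := pastCone x \ {x}) ?_ h'
    refine fun y hy => ⟨openPastCone_subset x hy, ?_⟩
    rintro rfl
    exact notMem_openPastCone_self y hy
  · intro h'
    refine measure_mono_null (t := openPastCone x ∪ (pastCone x \ openPastCone x) \ {x}) ?_
      (measure_union_null h' hx)
    rintro y ⟨h1, h2⟩
    by_cases h3 : y ∈ openPastCone x
    · exact Or.inl h3
    · exact Or.inr ⟨⟨h1, h3⟩, h2⟩

/-- The seeds located in `W` and born no later than `a`. -/
def seedWindow (W : Set (EuclideanSpace ℝ (Fin d))) (a : ℝ≥0) : Set (Seed d) :=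
  {x | x.1 ∈ W ∧ x.2.1 ≤ a}

theorem seedWindow_eq_prod (W : Set (EuclideanSpace ℝ (Fin d))) (a : ℝ≥0) :
    seedWindow W a = W ×ˢ (Set.Icc 0 a ×ˢ Set.univ) := by
  ext x
  simp [seedWindow]

theorem measurableSet_seedWindow {W : Set (EuclideanSpace ℝ (Fin d))} (hW : MeasurableSet W)
    (a : ℝ≥0) : MeasurableSet (seedWindow W a) := by
  rw [seedWindow_eq_prod]
  exact hW.prod (measurableSet_Icc.prod .univ)

theorem intensity_seedWindow_ne_top {W : Set (EuclideanSpace ℝ (Fin d))} (hW : volume W ≠ ∞)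
    (a : ℝ≥0) : intensity d θ ν (seedWindow W a) ≠ ∞ := by
  rw [seedWindow_eq_prod, intensity, Measure.prod_prod, Measure.prod_prod, measure_univ, mul_one]
  exact ENNReal.mul_ne_top hW (measure_Icc_lt_top' 0 a).ne

theorem setLIntegral_seedWindow (W : Set (EuclideanSpace ℝ (Fin d)))
    (a : ℝ≥0) {g : ℝ≥0 → ℝ≥0∞} (hg : Measurable g) :
    ∫⁻ x in seedWindow W a, g x.2.1 ∂(intensity d θ ν)
      = volume W * ∫⁻ t in Set.Icc 0 a, g t ∂θ := by
  rw [seedWindow_eq_prod, intensity, ← Measure.prod_restrict, ← Measure.prod_restrict,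
    Measure.restrict_univ, lintegral_prod _ (by fun_prop)]
  simp only [lintegral_const, Measure.restrict_apply_univ]
  rw [lintegral_prod _ (by fun_prop), mul_comm]
  simp

/-- The number of points of the window that have no other point in their open past cone. -/
noncomputable def openExposedCount (W : Set (EuclideanSpace ℝ (Fin d))) (a : ℝ≥0)
    (η : Ω → Measure (Seed d)) (ω : Ω) : ℝ≥0∞ :=
  finRestrict η (seedWindow W a) ω {x | η ω (openPastCone x) = 0}

theorem measurableSet_setOf_openPastCone_null {M : Measure (Seed d)} :
    MeasurableSet {x | M (openPastCone x) = 0} := by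
  obtain ⟨R, B, hR, hB, hRB⟩ := exists_movingUnion_of_isOpen (isOpen_openPastCone_rel (d := d))
  have : ∀ x, openPastCone x = ⋃ n, finUnion B (activeIndices R n x) := fun x => by
    rw [← movingUnion_eq_iUnion, hRB]
    rfl
  simp_rw [this, measure_iUnion_null_iff, Set.ofPred_forall]
  refine MeasurableSet.iInter fun n => ?_
  rw [preimage_void_eq]
  exact measurableSet_activeIndices_preimage (fun i => (hR i).measurableSet) n _

theorem ae_exposedCount_eq (hd : 1 ≤ d) (h : IsPoissonProcess η (intensity d θ ν) P)
    {W : Set (EuclideanSpace ℝ (Fin d))} (hW : MeasurableSet W) (hW' : volume W ≠ ∞) (a : ℝ≥0) :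
    ∀ᵐ ω ∂P, exposedCount W a (η ω) = (openExposedCount W a η ω).toReal := by
  filter_upwards [ae_seedExposed_iff hd h, h.ae_finRestrict_eq (measurableSet_seedWindow hW a)
    (intensity_seedWindow_ne_top hW' a)] with ω h1 h2
  have hA : MeasurableSet {x | η ω (openPastCone x) = 0} := measurableSet_setOf_openPastCone_null
  have hK := measurableSet_seedWindow hW a
  rw [openExposedCount, h2, Measure.restrict_apply hA, ← lintegral_indicator_one (hA.inter hK),
    exposedCount]
  refine congrArg ENNReal.toReal (lintegral_congr_ae ?_)
  filter_upwards [h1] with x hx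
  by_cases hc : x.1 ∈ W ∧ x.2.1 ≤ a ∧ SeedExposed x (η ω)
  · rw [if_pos hc, Set.indicator_of_mem]
    · rfl
    · exact ⟨hx.1 hc.2.2, hc.1, hc.2.1⟩
  · rw [if_neg hc, Set.indicator_of_notMem]
    exact fun hc' => hc ⟨hc'.2.1, hc'.2.2, hx.2 hc'.1⟩

theorem measurable_openExposedCount (hη : Measurable η)
    {W : Set (EuclideanSpace ℝ (Fin d))} (hW : MeasurableSet W) (a : ℝ≥0) :
    Measurable (openExposedCount W a η) := by
  obtain ⟨R, B, hR, hB, hRB⟩ := exists_movingUnion_of_isOpen (isOpen_openPastCone_rel (d := d))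
  have := measurable_measure_void (R := R) (B := B) hη
    (measurable_finRestrict hη (measurableSet_seedWindow hW a)) (fun ω => inferInstance)
    (fun i => (hR i).measurableSet) (fun i => (hB i).measurableSet)
  have hRB' : ∀ x, movingUnion R B x = openPastCone x := hRB
  simp only [hRB'] at this
  exact this

/-- The void rule with the moving set `openPastCone x`: a seed is never in its own open cone, so the
disjointness indicator is 1 and the void probability w remains. -/
theorem lintegral_openExposedCount (hd : 1 ≤ d) (hν : SpeedCondition d ν)
    (h : IsPoissonProcess η (intensity d θ ν) P)
    {W : Set (EuclideanSpace ℝ (Fin d))} (hW : MeasurableSet W) (hW' : volume W ≠ ∞) (a : ℝ≥0) :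
    ∫⁻ ω, openExposedCount W a η ω ∂P
      = ∫⁻ x in seedWindow W a, ENNReal.ofReal (wt d θ ν x.2.1) ∂(intensity d θ ν) := by
  obtain ⟨R, B, hR, hB, hRB⟩ := exists_movingUnion_of_isOpen (isOpen_openPastCone_rel (d := d))
  have hK := measurableSet_seedWindow hW a
  have hKf : intensity d θ ν (seedWindow W a) ≠ ∞ := intensity_seedWindow_ne_top hW' a
  have : IsFiniteMeasure ((intensity d θ ν).restrict (seedWindow W a)) :=
    ⟨by simpa using hKf.lt_top⟩
  have e := lintegral_measure_void (R := R) (B := B) (pts := fun x => {x}) h.measurable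
    (measurable_finRestrict h.measurable hK) (fun ω => inferInstance)
    (fun B hB => measurableSet_disjoint_singleton hB)
    (h.setLIntegral_void_finRestrict hK hKf)
    (fun i => (hR i).measurableSet) (fun i => (hB i).measurableSet)
  have hRB' : ∀ x, movingUnion R B x = openPastCone x := hRB
  simp only [hRB', prob_openPastCone_empty hd hν h, Set.disjoint_singleton_left,
    notMem_openPastCone_self, not_false_eq_true, Set.ofPred_true, Set.indicator_univ] at e
  exact e

/-- The pairs of seeds neither of which lies in the open past cone of the other. -/
def unrelatedPairs (d : ℕ) : Set (Seed d × Seed d) :=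
  {z | z.1 ∉ openPastCone z.2 ∧ z.2 ∉ openPastCone z.1}

theorem isClosed_unrelatedPairs : IsClosed (unrelatedPairs d) := by
  have h1 : IsOpen {z : Seed d × Seed d | z.1 ∈ openPastCone z.2} :=
    isOpen_openPastCone_rel.preimage continuous_swap
  exact h1.isClosed_compl.inter isOpen_openPastCone_rel.isClosed_compl

/-- The square counts ordered pairs of points whose two cones are both empty, that is, whose union
of cones is empty. Such a pair can occur only if neither seed is in the cone of the other; the
diagonal part of the pair intensity gives the single integral of w. -/
theorem lintegral_openExposedCount_mul_self (hd : 1 ≤ d) (hν : SpeedCondition d ν)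
    (h : IsPoissonProcess η (intensity d θ ν) P)
    {W : Set (EuclideanSpace ℝ (Fin d))} (hW : MeasurableSet W) (hW' : volume W ≠ ∞) (a : ℝ≥0) :
    ∫⁻ ω, openExposedCount W a η ω * openExposedCount W a η ω ∂P
      = (∫⁻ z in unrelatedPairs d, ENNReal.ofReal (Real.exp
          (-(intensity d θ ν (openPastCone z.1 ∪ openPastCone z.2)).toReal))
          ∂(((intensity d θ ν).restrict (seedWindow W a)).prod
            ((intensity d θ ν).restrict (seedWindow W a))))
        + ∫⁻ x in seedWindow W a, ENNReal.ofReal (wt d θ ν x.2.1) ∂(intensity d θ ν) := by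
  have hO : IsOpen {q : (Seed d × Seed d) × Seed d |
      q.2 ∈ openPastCone q.1.1 ∪ openPastCone q.1.2} :=
    (isOpen_openPastCone_rel.preimage (f := fun q : (Seed d × Seed d) × Seed d => (q.1.1, q.2))
      (by fun_prop)).union
    (isOpen_openPastCone_rel.preimage (f := fun q : (Seed d × Seed d) × Seed d => (q.1.2, q.2))
      (by fun_prop))
  obtain ⟨R, B, hR, hB, hRB⟩ := exists_movingUnion_of_isOpen hO
  have hRB' : ∀ z : Seed d × Seed d, movingUnion R B z = openPastCone z.1 ∪ openPastCone z.2 := hRB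
  have hK := measurableSet_seedWindow hW a
  have hKf : intensity d θ ν (seedWindow W a) ≠ ∞ := intensity_seedWindow_ne_top hW' a
  set m := (intensity d θ ν).restrict (seedWindow W a) with hm
  have : IsFiniteMeasure m := ⟨by simpa [hm] using hKf.lt_top⟩
  have hGm : MeasurableSet (unrelatedPairs d) := isClosed_unrelatedPairs.measurableSet
  have e := lintegral_measure_void (R := R) (B := B)
    (pts := fun z : Seed d × Seed d => {z.1, z.2}) h.measurable
    (measurable_finRestrict_prod h.measurable hK) (fun ω => inferInstance)
    (fun B hB => by rw [setOf_disjoint_pair]; exact hB.compl.prod hB.compl)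
    (h.setLIntegral_void_finRestrict_prod hK hKf)
    (fun i => (hR i).measurableSet) (fun i => (hB i).measurableSet)
  have hvoid : ∀ z : Seed d × Seed d, P {ω | η ω (openPastCone z.1 ∪ openPastCone z.2) = 0}
      = ENNReal.ofReal (Real.exp
          (-(intensity d θ ν (openPastCone z.1 ∪ openPastCone z.2)).toReal)) := fun z =>
    h.void_prob ((measurableSet_openPastCone _).union (measurableSet_openPastCone _))
      (measure_union_ne_top (intensity_openPastCone_ne_top hd hν _)
        (intensity_openPastCone_ne_top hd hν _))
  have hG : {z : Seed d × Seed d | Disjoint {z.1, z.2} (openPastCone z.1 ∪ openPastCone z.2)}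
      = unrelatedPairs d := by
    ext z
    simp [unrelatedPairs, Set.disjoint_insert_left, notMem_openPastCone_self]
    tauto
  simp only [hRB', hG, hvoid] at e
  have e1 : ∀ ω, openExposedCount W a η ω * openExposedCount W a η ω
      = (finRestrict η (seedWindow W a) ω).prod (finRestrict η (seedWindow W a) ω)
        {z | η ω (openPastCone z.1 ∪ openPastCone z.2) = 0} := by
    intro ω
    rw [openExposedCount, ← Measure.prod_prod]
    congr 1
    ext z
    simp [measure_union_null_iff]
  simp_rw [e1]
  rw [e, pairIntensity]
  have hmeas : Measurable fun z : Seed d × Seed d =>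
      intensity d θ ν (openPastCone z.1 ∪ openPastCone z.2) :=
    measurable_measure_prodMk_left hO.measurableSet
  have hf : Measurable ((unrelatedPairs d).indicator fun z => ENNReal.ofReal (Real.exp
      (-(intensity d θ ν (openPastCone z.1 ∪ openPastCone z.2)).toReal))) :=
    Measurable.indicator (by fun_prop) hGm
  rw [lintegral_add_measure, lintegral_map hf (by fun_prop), lintegral_indicator hGm]
  congr 1
  refine lintegral_congr fun x => ?_
  rw [Set.indicator_of_mem (by exact ⟨notMem_openPastCone_self x, notMem_openPastCone_self x⟩)]
  simp only [Set.union_self]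
  rw [wt_eq_exp_intensity hd hν]

end Model

/-! ### Variance bounds in `ℝ≥0∞` -/

section Bounds

/-- Here α, β, c, u stand for the intensities of two cones, their intersection and their union.
Since e^(-α) e^(-β) = e^(-u) e^(-c), the excess is e^(-u)(1 - e^(-c)) ≤ c e^(-u). As c ≤ (α+β)/2,
also u ≥ (α+β)/2, which is the origin of the exponents 1/2. -/
theorem exp_neg_le_mul_add (α β c u : ℝ) (hc : 0 ≤ c) (hα : c ≤ α) (hβ : c ≤ β)
    (hu : u + c = α + β) :
    Real.exp (-u) ≤ Real.exp (-α) * Real.exp (-β)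
      + Real.exp (-α) ^ (1 / 2 : ℝ) * Real.exp (-β) ^ (1 / 2 : ℝ) * c := by
  have h1 : Real.exp (-α) * Real.exp (-β) = Real.exp (-u) * Real.exp (-c) := by
    rw [← Real.exp_add, ← Real.exp_add]
    congr 1
    linarith
  have h2 : Real.exp (-u) ≤ Real.exp (-α) ^ (1 / 2 : ℝ) * Real.exp (-β) ^ (1 / 2 : ℝ) := by
    rw [← Real.exp_mul, ← Real.exp_mul, ← Real.exp_add]
    exact Real.exp_le_exp.2 (by linarith)
  have h3 : 1 - c ≤ Real.exp (-c) := by linarith [Real.add_one_le_exp (-c)]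
  have h4 := mul_le_mul_of_nonneg_left h3 (Real.exp_pos (-u)).le
  have h5 := mul_le_mul_of_nonneg_right h2 hc
  rw [h1]
  linarith

variable {d : ℕ} {θ ν : Measure ℝ≥0} [IsLocallyFiniteMeasure θ] [IsProbabilityMeasure ν]

theorem exp_neg_intensity_union_le (hd : 1 ≤ d) (hν : SpeedCondition d ν) (x y : Seed d) :
    ENNReal.ofReal (Real.exp (-(intensity d θ ν (openPastCone x ∪ openPastCone y)).toReal))
      ≤ ENNReal.ofReal (wt d θ ν x.2.1) * ENNReal.ofReal (wt d θ ν y.2.1)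
        + ENNReal.ofReal (wt d θ ν x.2.1 ^ (1 / 2 : ℝ)) *
          ENNReal.ofReal (wt d θ ν y.2.1 ^ (1 / 2 : ℝ)) *
          intensity d θ ν (openPastCone x ∩ openPastCone y) := by
  have hx := intensity_openPastCone_ne_top (θ := θ) hd hν x
  have hy := intensity_openPastCone_ne_top (θ := θ) hd hν y
  have hi : intensity d θ ν (openPastCone x ∩ openPastCone y) ≠ ∞ :=
    measure_ne_top_of_subset Set.inter_subset_left hx
  have key := exp_neg_le_mul_add (intensity d θ ν (openPastCone x)).toReal
    (intensity d θ ν (openPastCone y)).toReal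
    (intensity d θ ν (openPastCone x ∩ openPastCone y)).toReal
    (intensity d θ ν (openPastCone x ∪ openPastCone y)).toReal ENNReal.toReal_nonneg
    (ENNReal.toReal_mono hx (measure_mono Set.inter_subset_left))
    (ENNReal.toReal_mono hy (measure_mono Set.inter_subset_right)) (by
      rw [← ENNReal.toReal_add (measure_union_ne_top hx hy) hi, ← ENNReal.toReal_add hx hy,
        measure_union_add_inter _ (measurableSet_openPastCone y)])
  rw [← wt_eq_exp_intensity hd hν, ← wt_eq_exp_intensity hd hν] at key
  have p1 := (wt_pos (d := d) (θ := θ) (ν := ν) x.2.1).le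
  have p2 := (wt_pos (d := d) (θ := θ) (ν := ν) y.2.1).le
  calc _ ≤ _ := ENNReal.ofReal_le_ofReal key
    _ = _ := by
      rw [ENNReal.ofReal_add (by positivity) (by positivity), ENNReal.ofReal_mul p1,
        ENNReal.ofReal_mul (by positivity), ENNReal.ofReal_mul (by positivity),
        ENNReal.ofReal_toReal hi]

theorem mul_wt_le_exp_neg_intensity_union (hd : 1 ≤ d) (hν : SpeedCondition d ν) (x y : Seed d) :
    ENNReal.ofReal (wt d θ ν x.2.1) * ENNReal.ofReal (wt d θ ν y.2.1)
      ≤ ENNReal.ofReal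
        (Real.exp (-(intensity d θ ν (openPastCone x ∪ openPastCone y)).toReal)) := by
  have hx := intensity_openPastCone_ne_top (θ := θ) hd hν x
  have hy := intensity_openPastCone_ne_top (θ := θ) hd hν y
  rw [← ENNReal.ofReal_mul (wt_pos _).le, wt_eq_exp_intensity hd hν, wt_eq_exp_intensity hd hν,
    ← Real.exp_add]
  refine ENNReal.ofReal_le_ofReal (Real.exp_le_exp.2 ?_)
  have := ENNReal.toReal_mono (ENNReal.add_ne_top.2 ⟨hx, hy⟩)
    (measure_union_le (μ := intensity d θ ν) (openPastCone x) (openPastCone y))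
  rw [ENNReal.toReal_add hx hy] at this
  linarith

/-- `∫ 1{y ∈ L_x} g(t_y) μ(dy) = ω_d ν_d ∫_{[0,t_x]} (t_x - s)^d g(s) θ(ds)`. -/
theorem setLIntegral_openPastCone_time (hd : 1 ≤ d) (x : Seed d) {g : ℝ≥0 → ℝ≥0∞}
    (hg : Measurable g) :
    ∫⁻ y in openPastCone x, g y.2.1 ∂(intensity d θ ν)
      = ENNReal.ofReal (ballVol d) * (∫⁻ v, (v : ℝ≥0∞) ^ d ∂ν) *
        ∫⁻ s in Set.Icc 0 x.2.1, ((x.2.1 - s : ℝ≥0) : ℝ≥0∞) ^ d * g s ∂θ := by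
  rw [setLIntegral_openPastCone hd x (g := fun p => g p.1) (by fun_prop),
    ← lintegral_tsub_pow_mul hd]
  have : ∀ s : ℝ≥0, ∫⁻ v : ℝ≥0, ((v * (x.2.1 - s) : ℝ≥0) : ℝ≥0∞) ^ d * g s ∂ν
      = (∫⁻ v : ℝ≥0, (v : ℝ≥0∞) ^ d ∂ν) * (((x.2.1 - s : ℝ≥0) : ℝ≥0∞) ^ d * g s) := fun s => by
    rw [← lintegral_mul_const _ (by fun_prop)]
    refine lintegral_congr fun v => ?_
    rw [ENNReal.coe_mul, mul_pow, mul_assoc]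
  simp_rw [this]
  rw [lintegral_const_mul _ (by fun_prop), mul_assoc]

/-- The intersection is written as an integral over common ancestors u and the order of integration
is exchanged. For fixed u, the location of `y` ranges over a ball around u of radius v_u (t - s),
and so does that of u around `x.1`, with the birth time of `x` in place of t; the two volumes
together give v_u^(2d). -/
theorem lintegral_mul_intensity_inter_le (hd : 1 ≤ d) (x : Seed d)
    (W : Set (EuclideanSpace ℝ (Fin d))) (hW : MeasurableSet W) (a : ℝ≥0)
    {g : ℝ≥0 → ℝ≥0∞} (hg : Measurable g) :
    ∫⁻ y in seedWindow W a, g y.2.1 * intensity d θ ν (openPastCone x ∩ openPastCone y)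
        ∂(intensity d θ ν)
      ≤ ENNReal.ofReal (ballVol d) ^ 2 * (∫⁻ v, (v : ℝ≥0∞) ^ (2 * d) ∂ν) *
        ∫⁻ t in Set.Icc 0 a, ∫⁻ s in Set.Icc 0 (min x.2.1 t),
          ((x.2.1 - s : ℝ≥0) : ℝ≥0∞) ^ d * ((t - s : ℝ≥0) : ℝ≥0∞) ^ d * g t ∂θ ∂θ := by
  have hrel : MeasurableSet {z : Seed d × Seed d | z.2 ∈ openPastCone z.1} :=
    isOpen_openPastCone_rel.measurableSet
  have hx := measurableSet_openPastCone x
  have hK := measurableSet_seedWindow hW a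
  have hJ : Measurable fun z : Seed d × Seed d =>
      g z.1.2.1 * (openPastCone z.1).indicator (1 : Seed d → ℝ≥0∞) z.2 := by
    have h1 : Measurable ({z : Seed d × Seed d | z.2 ∈ openPastCone z.1}.indicator
      (1 : Seed d × Seed d → ℝ≥0∞)) := measurable_one.indicator hrel
    exact (by fun_prop : Measurable fun z : Seed d × Seed d => g z.1.2.1).mul h1
  have e1 : ∀ y, g y.2.1 * intensity d θ ν (openPastCone x ∩ openPastCone y)
      = ∫⁻ u in openPastCone x, g y.2.1 * (openPastCone y).indicator (1 : Seed d → ℝ≥0∞) u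
        ∂(intensity d θ ν) := by
    intro y
    rw [lintegral_const_mul _ (measurable_one.indicator (measurableSet_openPastCone y)),
      lintegral_indicator_one (measurableSet_openPastCone y),
      Measure.restrict_apply (measurableSet_openPastCone y), Set.inter_comm]
  simp_rw [e1]
  rw [lintegral_lintegral_swap hJ.aemeasurable]
  set ψ : ℝ≥0 × ℝ≥0 → ℝ≥0∞ := fun p => ENNReal.ofReal (ballVol d) *
    ∫⁻ t in Set.Icc 0 a, ((p.2 * (t - p.1) : ℝ≥0) : ℝ≥0∞) ^ d * g t ∂θ with hψ
  have hψm : Measurable ψ := by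
    refine Measurable.const_mul ?_ _
    have : Measurable fun q : (ℝ≥0 × ℝ≥0) × ℝ≥0 =>
      ((q.1.2 * (q.2 - q.1.1) : ℝ≥0) : ℝ≥0∞) ^ d * g q.2 := by fun_prop
    exact this.lintegral_prod_right'
  have e2 : ∀ u : Seed d, ∫⁻ y in seedWindow W a,
      g y.2.1 * (openPastCone y).indicator (1 : Seed d → ℝ≥0∞) u ∂(intensity d θ ν)
        ≤ ψ u.2 := by
    intro u
    have hm2 : Measurable fun y : Seed d =>
        g y.2.1 * (openPastCone y).indicator (1 : Seed d → ℝ≥0∞) u :=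
      hJ.comp measurable_prodMk_right
    have hf : Measurable (({y : Seed d | y.2.1 ∈ Set.Icc 0 a}).indicator fun y =>
        g y.2.1 * (openPastCone y).indicator (1 : Seed d → ℝ≥0∞) u) :=
      hm2.indicator (measurableSet_Icc.preimage (by fun_prop))
    -- The only loss: the location of `y` is no longer confined to `W`.
    calc _ ≤ ∫⁻ y, ({y : Seed d | y.2.1 ∈ Set.Icc 0 a}).indicator (fun y =>
          g y.2.1 * (openPastCone y).indicator (1 : Seed d → ℝ≥0∞) u) y ∂(intensity d θ ν) := by
          rw [← lintegral_indicator hK]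
          refine lintegral_mono fun y => ?_
          refine Set.indicator_le_indicator_of_subset ?_ (fun _ => zero_le) y
          rintro y ⟨-, hy⟩
          exact ⟨zero_le, hy⟩
      _ = ∫⁻ t in Set.Icc 0 a, ENNReal.ofReal (ballVol d) *
            (((u.2.2 * (t - u.2.1) : ℝ≥0) : ℝ≥0∞) ^ d * g t) ∂θ := by
          rw [lintegral_intensity_symm hf, ← lintegral_indicator measurableSet_Icc]
          refine lintegral_congr fun t => ?_
          have hz : ∀ v : ℝ≥0, ∫⁻ z : EuclideanSpace ℝ (Fin d),
              ({y : Seed d | y.2.1 ∈ Set.Icc 0 a}).indicator (fun y =>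
              g y.2.1 * (openPastCone y).indicator (1 : Seed d → ℝ≥0∞) u) (z, t, v)
              = (Set.Icc 0 a).indicator (fun t => ENNReal.ofReal (ballVol d) *
                (((u.2.2 * (t - u.2.1) : ℝ≥0) : ℝ≥0∞) ^ d * g t)) t := by
            intro v
            by_cases ht : t ∈ Set.Icc 0 a
            · rw [Set.indicator_of_mem ht]
              have : ∀ z : EuclideanSpace ℝ (Fin d),
                  ({y : Seed d | y.2.1 ∈ Set.Icc 0 a}).indicator (fun y =>
                    g y.2.1 * (openPastCone y).indicator (1 : Seed d → ℝ≥0∞) u) (z, t, v)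
                  = (Metric.ball u.1 (u.2.2 * (t - u.2.1) : ℝ≥0)).indicator (fun _ => g t) z := by
                intro z
                rw [Set.indicator_of_mem (by exact ht)]
                by_cases hu : u ∈ openPastCone ((z, t, v) : Seed d)
                · rw [Set.indicator_of_mem hu,
                    Set.indicator_of_mem (mem_openPastCone_iff_mem_ball'.1 hu)]
                  simp
                · rw [Set.indicator_of_notMem hu, Set.indicator_of_notMem
                    (fun h => hu (mem_openPastCone_iff_mem_ball'.2 h)), mul_zero]
              simp_rw [this]
              rw [lintegral_indicator_const Metric.isOpen_ball.measurableSet,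
                volume_ball_nnreal hd]
              ring
            · have hn : ∀ z : EuclideanSpace ℝ (Fin d),
                  ({y : Seed d | y.2.1 ∈ Set.Icc 0 a}).indicator (fun y =>
                    g y.2.1 * (openPastCone y).indicator (1 : Seed d → ℝ≥0∞) u) (z, t, v) = 0 :=
                fun z => Set.indicator_of_notMem (by exact ht) _
              rw [Set.indicator_of_notMem ht]
              simp_rw [hn]
              exact lintegral_zero
          simp_rw [hz]
          simp
      _ = ψ u.2 := by rw [lintegral_const_mul _ (by fun_prop)]
  refine (lintegral_mono e2).trans ?_
  rw [setLIntegral_openPastCone hd x hψm]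
  have e3 : ∀ s, ∫⁻ v, ((v * (x.2.1 - s) : ℝ≥0) : ℝ≥0∞) ^ d * ψ (s, v) ∂ν
      = ENNReal.ofReal (ballVol d) * (∫⁻ v, (v : ℝ≥0∞) ^ (2 * d) ∂ν) *
        ∫⁻ t in Set.Icc 0 a,
          ((x.2.1 - s : ℝ≥0) : ℝ≥0∞) ^ d * ((t - s : ℝ≥0) : ℝ≥0∞) ^ d * g t ∂θ := by
    intro s
    have : ∀ v : ℝ≥0, ((v * (x.2.1 - s) : ℝ≥0) : ℝ≥0∞) ^ d * ψ (s, v)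
        = (v : ℝ≥0∞) ^ (2 * d) * (ENNReal.ofReal (ballVol d) * ∫⁻ t in Set.Icc 0 a,
          ((x.2.1 - s : ℝ≥0) : ℝ≥0∞) ^ d * ((t - s : ℝ≥0) : ℝ≥0∞) ^ d * g t ∂θ) := by
      intro v
      simp only [hψ, ENNReal.coe_mul, mul_pow, mul_assoc]
      rw [lintegral_const_mul _ (by fun_prop), lintegral_const_mul _ (by fun_prop)]
      ring
    simp_rw [this]
    rw [lintegral_mul_const _ (by fun_prop)]
    ring
  simp_rw [e3]
  have hjoint : Measurable fun q : ℝ≥0 × ℝ≥0 =>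
      ((x.2.1 - q.1 : ℝ≥0) : ℝ≥0∞) ^ d * ((q.2 - q.1 : ℝ≥0) : ℝ≥0∞) ^ d * g q.2 := by fun_prop
  rw [lintegral_const_mul _ hjoint.lintegral_prod_right',
    lintegral_lintegral_swap hjoint.aemeasurable]
  -- Beyond the smaller of the two times one truncated factor is zero, and d ≥ 1 keeps its power
  -- zero.
  have e4 : ∀ t, ∫⁻ s, ((x.2.1 - s : ℝ≥0) : ℝ≥0∞) ^ d * ((t - s : ℝ≥0) : ℝ≥0∞) ^ d * g t ∂θ
      = ∫⁻ s in Set.Icc 0 (min x.2.1 t),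
        ((x.2.1 - s : ℝ≥0) : ℝ≥0∞) ^ d * ((t - s : ℝ≥0) : ℝ≥0∞) ^ d * g t ∂θ := by
    intro t
    rw [← lintegral_indicator measurableSet_Icc]
    refine lintegral_congr fun s => ?_
    by_cases hs : s ≤ min x.2.1 t
    · rw [Set.indicator_of_mem (Set.mem_Icc.2 ⟨zero_le, hs⟩)]
    · rw [Set.indicator_of_notMem (fun h => hs h.2)]
      rcases lt_or_ge x.2.1 s with h | h
      · simp [tsub_eq_zero_of_le h.le, Nat.one_le_iff_ne_zero.1 hd]
      · have : t < s := by
          by_contra! h2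
          exact hs (le_min h h2)
        simp [tsub_eq_zero_of_le this.le, Nat.one_le_iff_ne_zero.1 hd]
  simp_rw [e4]
  rw [sq, mul_assoc, mul_assoc, mul_assoc]

variable {Ω : Type*} [MeasurableSpace Ω] {P : Measure Ω} [IsProbabilityMeasure P]
  {η : Ω → Measure (Seed d)} {W : Set (EuclideanSpace ℝ (Fin d))}

theorem lintegral_seedWindow_wt_ne_top (hW' : volume W ≠ ∞) (a : ℝ≥0) :
    ∫⁻ x in seedWindow W a, ENNReal.ofReal (wt d θ ν x.2.1) ∂(intensity d θ ν) ≠ ∞ := by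
  refine ne_top_of_le_ne_top (intensity_seedWindow_ne_top (θ := θ) (ν := ν) hW' a) ?_
  rw [← setLIntegral_one]
  exact lintegral_mono fun x => ENNReal.ofReal_le_one.2 (wt_le_one _)

theorem lintegral_openExposedCount_mul_self_ne_top (hd : 1 ≤ d) (hν : SpeedCondition d ν)
    (h : IsPoissonProcess η (intensity d θ ν) P) (hW : MeasurableSet W) (hW' : volume W ≠ ∞)
    (a : ℝ≥0) : ∫⁻ ω, openExposedCount W a η ω * openExposedCount W a η ω ∂P ≠ ∞ := by
  rw [lintegral_openExposedCount_mul_self hd hν h hW hW']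
  refine ENNReal.add_ne_top.2 ⟨?_, lintegral_seedWindow_wt_ne_top hW' a⟩
  have : IsFiniteMeasure ((intensity d θ ν).restrict (seedWindow W a)) :=
    ⟨by simpa using (intensity_seedWindow_ne_top (θ := θ) (ν := ν) hW' a).lt_top⟩
  refine ne_top_of_le_ne_top (measure_ne_top
    (((intensity d θ ν).restrict (seedWindow W a)).prod
      ((intensity d θ ν).restrict (seedWindow W a))) (unrelatedPairs d)) ?_
  rw [← setLIntegral_one]
  refine lintegral_mono fun z => ?_
  simp

theorem memLp_exposedCount (hd : 1 ≤ d) (hν : SpeedCondition d ν)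
    (h : IsPoissonProcess η (intensity d θ ν) P) (hW : MeasurableSet W) (hW' : volume W ≠ ∞)
    (a : ℝ≥0) : MemLp (fun ω => exposedCount W a (η ω)) 2 P := by
  have hm := measurable_openExposedCount h.measurable hW a
  refine MemLp.ae_eq (Filter.EventuallyEq.symm (ae_exposedCount_eq hd h hW hW' a)) ?_
  rw [memLp_two_iff_integrable_sq hm.ennreal_toReal.aestronglyMeasurable]
  have := integrable_toReal_of_lintegral_ne_top (hm.mul hm).aemeasurable
    (lintegral_openExposedCount_mul_self_ne_top hd hν h hW hW' a)
  refine this.congr (Filter.Eventually.of_forall fun ω => ?_)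
  simp [sq]

/-- `Var F + (E F)² = E[F²]`, with all terms explicit. -/
theorem ofReal_variance_exposedCount_add (hd : 1 ≤ d) (hν : SpeedCondition d ν)
    (h : IsPoissonProcess η (intensity d θ ν) P) (hW : MeasurableSet W) (hW' : volume W ≠ ∞)
    (a : ℝ≥0) :
    ENNReal.ofReal (variance (fun ω => exposedCount W a (η ω)) P)
      + (∫⁻ x in seedWindow W a, ENNReal.ofReal (wt d θ ν x.2.1) ∂(intensity d θ ν)) ^ 2
      = (∫⁻ z in unrelatedPairs d, ENNReal.ofReal (Real.exp
          (-(intensity d θ ν (openPastCone z.1 ∪ openPastCone z.2)).toReal))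
          ∂(((intensity d θ ν).restrict (seedWindow W a)).prod
            ((intensity d θ ν).restrict (seedWindow W a))))
        + ∫⁻ x in seedWindow W a, ENNReal.ofReal (wt d θ ν x.2.1) ∂(intensity d θ ν) := by
  have hm := measurable_openExposedCount h.measurable hW a
  have hfin := lintegral_openExposedCount_mul_self_ne_top hd hν h hW hW' a
  have hI := lintegral_seedWindow_wt_ne_top (θ := θ) (ν := ν) hW' a
  have hE1 : ∫ ω, exposedCount W a (η ω) ∂P = (∫⁻ ω, openExposedCount W a η ω ∂P).toReal := by
    rw [integral_congr_ae (ae_exposedCount_eq hd h hW hW' a)]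
    refine integral_toReal hm.aemeasurable (Filter.Eventually.of_forall fun ω => ?_)
    exact measure_lt_top _ _
  have hE2 : ∫ ω, exposedCount W a (η ω) ^ 2 ∂P
      = (∫⁻ ω, openExposedCount W a η ω * openExposedCount W a η ω ∂P).toReal := by
    have hmm : Measurable fun ω => openExposedCount W a η ω * openExposedCount W a η ω :=
      hm.mul hm
    rw [← integral_toReal hmm.aemeasurable (Filter.Eventually.of_forall fun ω =>
      ENNReal.mul_lt_top (measure_lt_top _ _) (measure_lt_top _ _))]
    refine integral_congr_ae ?_
    filter_upwards [ae_exposedCount_eq hd h hW hW' a] with ω hω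
    rw [hω, ENNReal.toReal_mul, sq]
  rw [← lintegral_openExposedCount_mul_self hd hν h hW hW',
    ← lintegral_openExposedCount hd hν h hW hW']
  rw [← lintegral_openExposedCount hd hν h hW hW'] at hI
  have hv := variance_eq_sub (memLp_exposedCount hd hν h hW hW' a)
  have hv' : variance (fun ω => exposedCount W a (η ω)) P
      + (∫⁻ ω, openExposedCount W a η ω ∂P).toReal ^ 2
      = (∫⁻ ω, openExposedCount W a η ω * openExposedCount W a η ω ∂P).toReal := by
    rw [hv, ← hE1, ← hE2]
    simp [Pi.pow_apply]
  rw [← ENNReal.ofReal_toReal hfin, ← hv', ENNReal.ofReal_add (variance_nonneg _ _)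
    (by positivity), ENNReal.ofReal_pow ENNReal.toReal_nonneg, ENNReal.ofReal_toReal hI]

theorem sq_lintegral_seedWindow_wt (hd : 1 ≤ d) (a : ℝ≥0) :
    (∫⁻ x in seedWindow W a, ENNReal.ofReal (wt d θ ν x.2.1) ∂(intensity d θ ν)) ^ 2
      = ∫⁻ z, ENNReal.ofReal (wt d θ ν z.1.2.1) * ENNReal.ofReal (wt d θ ν z.2.2.1)
          ∂(((intensity d θ ν).restrict (seedWindow W a)).prod
            ((intensity d θ ν).restrict (seedWindow W a))) := by
  have hw := measurable_wt (d := d) (θ := θ) (ν := ν) hd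
  have hw' : Measurable fun x : Seed d => ENNReal.ofReal (wt d θ ν x.2.1) := by fun_prop
  rw [sq, ← lintegral_prod_mul hw'.aemeasurable hw'.aemeasurable]

/-- Upper variance bound. -/
theorem ofReal_variance_exposedCount_le (hd : 1 ≤ d) (hν : SpeedCondition d ν)
    (h : IsPoissonProcess η (intensity d θ ν) P) (hW : MeasurableSet W) (hW' : volume W ≠ ∞)
    (a : ℝ≥0) :
    ENNReal.ofReal (variance (fun ω => exposedCount W a (η ω)) P)
      ≤ volume W * ((∫⁻ t in Set.Icc 0 a, ENNReal.ofReal (wt d θ ν t) ∂θ)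
        + ENNReal.ofReal (ballVol d) ^ 2 * (∫⁻ v, (v : ℝ≥0∞) ^ (2 * d) ∂ν) *
          ∫⁻ t₁ in Set.Icc 0 a, ∫⁻ t₂ in Set.Icc 0 a, ∫⁻ s in Set.Icc 0 (min t₁ t₂),
            ((t₁ - s : ℝ≥0) : ℝ≥0∞) ^ d * ((t₂ - s : ℝ≥0) : ℝ≥0∞) ^ d *
            ENNReal.ofReal (wt d θ ν t₁ ^ (1 / 2 : ℝ)) *
            ENNReal.ofReal (wt d θ ν t₂ ^ (1 / 2 : ℝ)) ∂θ ∂θ ∂θ) := by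
  have hw := measurable_wt (d := d) (θ := θ) (ν := ν) hd
  have hI := lintegral_seedWindow_wt_ne_top (θ := θ) (ν := ν) hW' a
  have hG : MeasurableSet (unrelatedPairs d) := isClosed_unrelatedPairs.measurableSet
  set m := (intensity d θ ν).restrict (seedWindow W a) with hm
  set S : Seed d × Seed d → ℝ≥0∞ := fun z => ENNReal.ofReal (wt d θ ν z.1.2.1 ^ (1 / 2 : ℝ)) *
          ENNReal.ofReal (wt d θ ν z.2.2.1 ^ (1 / 2 : ℝ)) *
          intensity d θ ν (openPastCone z.1 ∩ openPastCone z.2) with hS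
  have hrel : IsOpen {q : (Seed d × Seed d) × Seed d |
      q.2 ∈ openPastCone q.1.1 ∩ openPastCone q.1.2} :=
    (isOpen_openPastCone_rel.preimage (f := fun q : (Seed d × Seed d) × Seed d => (q.1.1, q.2))
      (by fun_prop)).inter
    (isOpen_openPastCone_rel.preimage (f := fun q : (Seed d × Seed d) × Seed d => (q.1.2, q.2))
      (by fun_prop))
  have hInt : Measurable fun z : Seed d × Seed d =>
      intensity d θ ν (openPastCone z.1 ∩ openPastCone z.2) := 
    measurable_measure_prodMk_left hrel.measurableSet
  have hSm : Measurable S := by fun_prop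
  have key := ofReal_variance_exposedCount_add hd hν h hW hW' a
  have h1 : ∫⁻ z in unrelatedPairs d, ENNReal.ofReal (Real.exp
          (-(intensity d θ ν (openPastCone z.1 ∪ openPastCone z.2)).toReal)) ∂(m.prod m)
      ≤ (∫⁻ x in seedWindow W a, ENNReal.ofReal (wt d θ ν x.2.1) ∂(intensity d θ ν)) ^ 2
        + ∫⁻ z, S z ∂(m.prod m) := by
    rw [sq_lintegral_seedWindow_wt hd, ← lintegral_add_right _ hSm]
    refine (setLIntegral_le_lintegral _ _).trans (lintegral_mono fun z => ?_)
    exact exp_neg_intensity_union_le hd hν z.1 z.2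
  have h2 : ENNReal.ofReal (variance (fun ω => exposedCount W a (η ω)) P)
      ≤ (∫⁻ x in seedWindow W a, ENNReal.ofReal (wt d θ ν x.2.1) ∂(intensity d θ ν))
        + ∫⁻ z, S z ∂(m.prod m) := by
    -- The square of the mean is finite and can be cancelled, so no subtraction in `ℝ≥0∞` is needed.
    refine (ENNReal.add_le_add_iff_right (ENNReal.pow_ne_top hI (n := 2))).1 ?_
    rw [key]
    refine (add_le_add_left h1 _).trans_eq ?_
    ring
  refine h2.trans ?_
  rw [setLIntegral_seedWindow W a (g := fun t => ENNReal.ofReal (wt d θ ν t)) (by fun_prop),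
    mul_add]
  refine add_le_add le_rfl ?_
  rw [lintegral_prod _ hSm.aemeasurable]
  -- An indicator replaces the domain that depends on the outer variables, so that measurability of
  -- the parameter integral applies.
  have hΨ : Measurable fun p : (ℝ≥0 × ℝ≥0) × ℝ≥0 =>
      (Set.Icc 0 (min p.1.1 p.1.2)).indicator (fun s =>
        ((p.1.1 - s : ℝ≥0) : ℝ≥0∞) ^ d * ((p.1.2 - s : ℝ≥0) : ℝ≥0∞) ^ d *
        ENNReal.ofReal (wt d θ ν p.1.2 ^ (1 / 2 : ℝ))) p.2 := by
    have hset : MeasurableSet {p : (ℝ≥0 × ℝ≥0) × ℝ≥0 | p.2 ≤ min p.1.1 p.1.2} :=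
      measurableSet_le (by fun_prop) (by fun_prop)
    have : Measurable ({p : (ℝ≥0 × ℝ≥0) × ℝ≥0 | p.2 ≤ min p.1.1 p.1.2}.indicator fun p =>
        ((p.1.1 - p.2 : ℝ≥0) : ℝ≥0∞) ^ d * ((p.1.2 - p.2 : ℝ≥0) : ℝ≥0∞) ^ d *
        ENNReal.ofReal (wt d θ ν p.1.2 ^ (1 / 2 : ℝ))) :=
      Measurable.indicator (by fun_prop) hset
    convert this using 1
    ext p
    simp [Set.indicator]
  have hΨ' : Measurable fun t₁ : ℝ≥0 =>
      ∫⁻ t₂ in Set.Icc 0 a, ∫⁻ s in Set.Icc 0 (min t₁ t₂),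
        ((t₁ - s : ℝ≥0) : ℝ≥0∞) ^ d * ((t₂ - s : ℝ≥0) : ℝ≥0∞) ^ d *
        ENNReal.ofReal (wt d θ ν t₂ ^ (1 / 2 : ℝ)) ∂θ ∂θ := by
    simp_rw [← lintegral_indicator (measurableSet_Icc (a := (0 : ℝ≥0)) (b := min _ _))]
    exact (hΨ.lintegral_prod_right').lintegral_prod_right'
  calc ∫⁻ x, ∫⁻ y, S (x, y) ∂m ∂m
      ≤ ∫⁻ x, ENNReal.ofReal (wt d θ ν x.2.1 ^ (1 / 2 : ℝ)) *
          (ENNReal.ofReal (ballVol d) ^ 2 * (∫⁻ v, (v : ℝ≥0∞) ^ (2 * d) ∂ν) *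
          ∫⁻ t₂ in Set.Icc 0 a, ∫⁻ s in Set.Icc 0 (min x.2.1 t₂),
          ((x.2.1 - s : ℝ≥0) : ℝ≥0∞) ^ d * ((t₂ - s : ℝ≥0) : ℝ≥0∞) ^ d *
          ENNReal.ofReal (wt d θ ν t₂ ^ (1 / 2 : ℝ)) ∂θ ∂θ) ∂m := by
        refine lintegral_mono fun x => ?_
        have hy : Measurable fun y : Seed d => ENNReal.ofReal (wt d θ ν y.2.1 ^ (1 / 2 : ℝ)) *
            intensity d θ ν (openPastCone x ∩ openPastCone y) := by
          have hIx : Measurable fun y : Seed d =>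
              intensity d θ ν (openPastCone x ∩ openPastCone y) := by
            have := hInt.comp (measurable_prodMk_left (x := x))
            simpa only [Function.comp_def] using this
          fun_prop
        simp only [hS, mul_assoc]
        rw [lintegral_const_mul _ hy]
        gcongr
        have := lintegral_mul_intensity_inter_le (θ := θ) (ν := ν) hd x W hW a
          (g := fun t => ENNReal.ofReal (wt d θ ν t ^ (1 / 2 : ℝ))) (by fun_prop)
        simpa only [mul_assoc] using this
    _ = _ := by
        rw [hm, setLIntegral_seedWindow W a (g := fun t₁ =>
          ENNReal.ofReal (wt d θ ν t₁ ^ (1 / 2 : ℝ)) *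
          (ENNReal.ofReal (ballVol d) ^ 2 * (∫⁻ v, (v : ℝ≥0∞) ^ (2 * d) ∂ν) *
          ∫⁻ t₂ in Set.Icc 0 a, ∫⁻ s in Set.Icc 0 (min t₁ t₂),
          ((t₁ - s : ℝ≥0) : ℝ≥0∞) ^ d * ((t₂ - s : ℝ≥0) : ℝ≥0∞) ^ d *
          ENNReal.ofReal (wt d θ ν t₂ ^ (1 / 2 : ℝ)) ∂θ ∂θ)) (by fun_prop)]
        congr 1
        simp_rw [mul_left_comm (ENNReal.ofReal (wt d θ ν _ ^ (1 / 2 : ℝ)))]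
        rw [lintegral_const_mul _ (by fun_prop)]
        congr 1
        refine lintegral_congr fun t₁ => ?_
        rw [← lintegral_const_mul' _ _ ENNReal.ofReal_ne_top]
        refine lintegral_congr fun t₂ => ?_
        rw [← lintegral_const_mul' _ _ ENNReal.ofReal_ne_top]
        refine lintegral_congr fun s => ?_
        ring

theorem lintegral_wt_mul_setLIntegral_openPastCone (hd : 1 ≤ d)
    (W : Set (EuclideanSpace ℝ (Fin d))) (a : ℝ≥0) :
    ∫⁻ x in seedWindow W a, ENNReal.ofReal (wt d θ ν x.2.1) *
      ∫⁻ y in openPastCone x, ENNReal.ofReal (wt d θ ν y.2.1) ∂(intensity d θ ν)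
        ∂(intensity d θ ν)
      = volume W * (ENNReal.ofReal (ballVol d) * (∫⁻ v, (v : ℝ≥0∞) ^ d ∂ν) *
          ∫⁻ t in Set.Icc 0 a, ∫⁻ s in Set.Icc 0 t, ((t - s : ℝ≥0) : ℝ≥0∞) ^ d *
            ENNReal.ofReal (wt d θ ν s) * ENNReal.ofReal (wt d θ ν t) ∂θ ∂θ) := by
  have hw := measurable_wt (d := d) (θ := θ) (ν := ν) hd
  have hΨ : Measurable fun t : ℝ≥0 => ∫⁻ s in Set.Icc 0 t, ((t - s : ℝ≥0) : ℝ≥0∞) ^ d *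
      ENNReal.ofReal (wt d θ ν s) ∂θ := by
    simp_rw [← lintegral_tsub_pow_mul hd]
    have : Measurable fun p : ℝ≥0 × ℝ≥0 => ((p.1 - p.2 : ℝ≥0) : ℝ≥0∞) ^ d *
      ENNReal.ofReal (wt d θ ν p.2) := by fun_prop
    exact this.lintegral_prod_right'
  have e : ∀ x : Seed d, ∫⁻ y in openPastCone x, ENNReal.ofReal (wt d θ ν y.2.1)
      ∂(intensity d θ ν) = _ := fun x =>
    setLIntegral_openPastCone_time (θ := θ) (ν := ν) hd x
      (g := fun t => ENNReal.ofReal (wt d θ ν t)) (by fun_prop)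
  simp_rw [e]
  rw [setLIntegral_seedWindow W a (g := fun t => ENNReal.ofReal (wt d θ ν t) *
    (ENNReal.ofReal (ballVol d) * (∫⁻ v, (v : ℝ≥0∞) ^ d ∂ν) *
      ∫⁻ s in Set.Icc 0 t, ((t - s : ℝ≥0) : ℝ≥0∞) ^ d * ENNReal.ofReal (wt d θ ν s) ∂θ))
    (by fun_prop)]
  congr 1
  simp_rw [mul_left_comm (ENNReal.ofReal (wt d θ ν _))]
  rw [lintegral_const_mul _ (by fun_prop)]
  congr 1
  refine lintegral_congr fun t => ?_
  rw [← lintegral_const_mul' _ _ ENNReal.ofReal_ne_top]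
  refine lintegral_congr fun s => ?_
  ring

/-- The part of `(E F)²` due to pairs whose second element is in the past cone of the first. -/
theorem setLIntegral_related_le (hd : 1 ≤ d) (W : Set (EuclideanSpace ℝ (Fin d))) (a : ℝ≥0) :
    ∫⁻ z in {z : Seed d × Seed d | z.2 ∈ openPastCone z.1},
        ENNReal.ofReal (wt d θ ν z.1.2.1) * ENNReal.ofReal (wt d θ ν z.2.2.1)
        ∂(((intensity d θ ν).restrict (seedWindow W a)).prod
          ((intensity d θ ν).restrict (seedWindow W a)))
      ≤ volume W * (ENNReal.ofReal (ballVol d) * (∫⁻ v, (v : ℝ≥0∞) ^ d ∂ν) *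
          ∫⁻ t in Set.Icc 0 a, ∫⁻ s in Set.Icc 0 t, ((t - s : ℝ≥0) : ℝ≥0∞) ^ d *
            ENNReal.ofReal (wt d θ ν s) * ENNReal.ofReal (wt d θ ν t) ∂θ ∂θ) := by
  have hw := measurable_wt (d := d) (θ := θ) (ν := ν) hd
  have hrel : MeasurableSet {z : Seed d × Seed d | z.2 ∈ openPastCone z.1} :=
    isOpen_openPastCone_rel.measurableSet
  have hfm : Measurable fun z : Seed d × Seed d =>
    ENNReal.ofReal (wt d θ ν z.1.2.1) * ENNReal.ofReal (wt d θ ν z.2.2.1) := by fun_prop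
  rw [← lintegral_wt_mul_setLIntegral_openPastCone hd W a, ← lintegral_indicator hrel,
    lintegral_prod _ (hfm.indicator hrel).aemeasurable]
  refine lintegral_mono fun x => ?_
  have hg : Measurable fun y : Seed d => ENNReal.ofReal (wt d θ ν y.2.1) := by fun_prop
  -- Letting the second seed leave the window only increases the integral.
  calc _ ≤ ∫⁻ y, {z : Seed d × Seed d | z.2 ∈ openPastCone z.1}.indicator (fun z =>
        ENNReal.ofReal (wt d θ ν z.1.2.1) * ENNReal.ofReal (wt d θ ν z.2.2.1)) (x, y)
          ∂(intensity d θ ν) := lintegral_mono' Measure.restrict_le_self le_rfl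
    _ = ∫⁻ y in openPastCone x,
        ENNReal.ofReal (wt d θ ν x.2.1) * ENNReal.ofReal (wt d θ ν y.2.1) ∂(intensity d θ ν) := by
      rw [← lintegral_indicator (measurableSet_openPastCone x)]
      refine lintegral_congr fun y => ?_
      by_cases hy : y ∈ openPastCone x
      · rw [Set.indicator_of_mem (by exact hy), Set.indicator_of_mem hy]
      · rw [Set.indicator_of_notMem (by exact hy), Set.indicator_of_notMem hy]
    _ = _ := lintegral_const_mul _ hg

theorem setLIntegral_related_swap (hd : 1 ≤ d) (W : Set (EuclideanSpace ℝ (Fin d))) (a : ℝ≥0) :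
    ∫⁻ z in {z : Seed d × Seed d | z.1 ∈ openPastCone z.2},
        ENNReal.ofReal (wt d θ ν z.1.2.1) * ENNReal.ofReal (wt d θ ν z.2.2.1)
        ∂(((intensity d θ ν).restrict (seedWindow W a)).prod
          ((intensity d θ ν).restrict (seedWindow W a)))
      = ∫⁻ z in {z : Seed d × Seed d | z.2 ∈ openPastCone z.1},
        ENNReal.ofReal (wt d θ ν z.1.2.1) * ENNReal.ofReal (wt d θ ν z.2.2.1)
        ∂(((intensity d θ ν).restrict (seedWindow W a)).prod
          ((intensity d θ ν).restrict (seedWindow W a))) := by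
  have hw := measurable_wt (d := d) (θ := θ) (ν := ν) hd
  have hrel : MeasurableSet {z : Seed d × Seed d | z.2 ∈ openPastCone z.1} :=
    isOpen_openPastCone_rel.measurableSet
  have hrel' : MeasurableSet {z : Seed d × Seed d | z.1 ∈ openPastCone z.2} :=
    (isOpen_openPastCone_rel.preimage continuous_swap).measurableSet
  have hfm : Measurable fun z : Seed d × Seed d =>
    ENNReal.ofReal (wt d θ ν z.1.2.1) * ENNReal.ofReal (wt d θ ν z.2.2.1) := by fun_prop
  rw [← lintegral_indicator hrel', ← lintegral_indicator hrel, ← lintegral_prod_swap]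
  refine lintegral_congr fun z => ?_
  by_cases hz : z.2 ∈ openPastCone z.1
  · rw [Set.indicator_of_mem (by exact hz), Set.indicator_of_mem (by exact hz)]
    exact mul_comm _ _
  · rw [Set.indicator_of_notMem (by exact hz), Set.indicator_of_notMem (by exact hz)]

/-- Lower variance bound. -/
theorem le_ofReal_variance_exposedCount (hd : 1 ≤ d) (hν : SpeedCondition d ν)
    (h : IsPoissonProcess η (intensity d θ ν) P) (hW : MeasurableSet W) (hW' : volume W ≠ ∞)
    (a : ℝ≥0) :
    volume W * (∫⁻ t in Set.Icc 0 a, ENNReal.ofReal (wt d θ ν t) ∂θ)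
      ≤ ENNReal.ofReal (variance (fun ω => exposedCount W a (η ω)) P)
        + 2 * (volume W * (ENNReal.ofReal (ballVol d) * (∫⁻ v, (v : ℝ≥0∞) ^ d ∂ν) *
          ∫⁻ t in Set.Icc 0 a, ∫⁻ s in Set.Icc 0 t, ((t - s : ℝ≥0) : ℝ≥0∞) ^ d *
            ENNReal.ofReal (wt d θ ν s) * ENNReal.ofReal (wt d θ ν t) ∂θ ∂θ)) := by
  have hI := lintegral_seedWindow_wt_ne_top (θ := θ) (ν := ν) hW' a
  have hG : MeasurableSet (unrelatedPairs d) := isClosed_unrelatedPairs.measurableSet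
  have key := ofReal_variance_exposedCount_add hd hν h hW hW' a
  have hA := setLIntegral_related_le (θ := θ) (ν := ν) hd W a
  have hB := (setLIntegral_related_swap (θ := θ) (ν := ν) hd W a).trans_le hA
  generalize volume W * (ENNReal.ofReal (ballVol d) * (∫⁻ v, (v : ℝ≥0∞) ^ d ∂ν) *
    ∫⁻ t in Set.Icc 0 a, ∫⁻ s in Set.Icc 0 t, ((t - s : ℝ≥0) : ℝ≥0∞) ^ d *
      ENNReal.ofReal (wt d θ ν s) * ENNReal.ofReal (wt d θ ν t) ∂θ ∂θ) = T at hA hB ⊢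
  have hw := measurable_wt (d := d) (θ := θ) (ν := ν) hd
  have h1 : (∫⁻ x in seedWindow W a, ENNReal.ofReal (wt d θ ν x.2.1) ∂(intensity d θ ν)) ^ 2
      ≤ (∫⁻ z in unrelatedPairs d, ENNReal.ofReal (Real.exp
          (-(intensity d θ ν (openPastCone z.1 ∪ openPastCone z.2)).toReal))
          ∂(((intensity d θ ν).restrict (seedWindow W a)).prod
            ((intensity d θ ν).restrict (seedWindow W a))))
        + (T + T) := by
    rw [sq_lintegral_seedWindow_wt hd, ← lintegral_add_compl _ hG]
    refine add_le_add (lintegral_mono fun z => ?_) ?_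
    · exact mul_wt_le_exp_neg_intensity_union hd hν z.1 z.2
    -- Pairs that fail to be unrelated are related in one of two orders, whence the factor 2.
    · refine (lintegral_mono_set (t := {z : Seed d × Seed d | z.1 ∈ openPastCone z.2} ∪
        {z : Seed d × Seed d | z.2 ∈ openPastCone z.1}) ?_).trans
        ((lintegral_union_le _ _ _).trans (add_le_add hB hA))
      intro z hz
      by_contra hc
      rw [Set.mem_union, not_or] at hc
      exact hz ⟨hc.1, hc.2⟩
  rw [← setLIntegral_seedWindow (ν := ν) W a (g := fun t => ENNReal.ofReal (wt d θ ν t))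
    (by fun_prop)]
  refine (ENNReal.add_le_add_iff_right (ENNReal.pow_ne_top hI (n := 2))).1 ?_
  rw [add_right_comm, key, two_mul]
  calc _ ≤ _ := add_le_add_right h1 _
    _ = _ := by ring

end Bounds

/-! ### Variance bounds in `ℝ` -/

section RealBounds

theorem sub_pow_nonneg {s t : ℝ≥0} (h : s ≤ t) (k : ℕ) : 0 ≤ ((t : ℝ) - s) ^ k :=
  pow_nonneg (sub_nonneg.2 (NNReal.coe_le_coe.2 h)) k

/-- Measurability is asked of `F` alone: below, `F` is built from truncated differences and `f` from
real ones, and the two correspond only on `S`. -/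
theorem setLIntegral_eq_ofReal_setIntegral {α : Type*} [MeasurableSpace α] {m : Measure α}
    {S : Set α} (hS : MeasurableSet S) {f : α → ℝ} {F : α → ℝ≥0∞} (hF : Measurable F)
    (h : ∀ s ∈ S, F s = ENNReal.ofReal (f s)) (hf : ∀ s ∈ S, 0 ≤ f s)
    (hfin : ∫⁻ s in S, F s ∂m ≠ ∞) :
    ∫⁻ s in S, F s ∂m = ENNReal.ofReal (∫ s in S, f s ∂m) := by
  have e : ∫ s in S, f s ∂m = ∫ s in S, (F s).toReal ∂m :=
    setIntegral_congr_fun hS fun s hs => by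
      simp only [h s hs, ENNReal.toReal_ofReal (hf s hs)]
  rw [e, integral_toReal hF.aemeasurable, ENNReal.ofReal_toReal hfin]
  filter_upwards [ae_restrict_mem hS] with s hs
  rw [h s hs]
  exact ENNReal.ofReal_lt_top

variable {d : ℕ} {θ ν : Measure ℝ≥0} [IsLocallyFiniteMeasure θ] [IsProbabilityMeasure ν]

theorem setLIntegral_Icc_ne_top {F : ℝ≥0 → ℝ≥0∞} {b : ℝ≥0} {c : ℝ≥0∞} (hc : c ≠ ∞)
    (hF : ∀ s ∈ Set.Icc 0 b, F s ≤ c) : ∫⁻ s in Set.Icc 0 b, F s ∂θ ≠ ∞ := by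
  refine ne_top_of_le_ne_top (ENNReal.mul_ne_top hc (measure_Icc_lt_top' (θ := θ) 0 b).ne) ?_
  rw [← setLIntegral_const]
  exact setLIntegral_mono measurable_const hF

omit [IsLocallyFiniteMeasure θ] [IsProbabilityMeasure ν] in
theorem wt_rpow_le_one (t : ℝ≥0) : wt d θ ν t ^ (1 / 2 : ℝ) ≤ 1 :=
  Real.rpow_le_one (wt_pos t).le (wt_le_one t) (by norm_num)

omit [IsProbabilityMeasure ν] in
theorem lintegral_wt_eq (hd : 1 ≤ d) (a : ℝ≥0) :
    ∫⁻ t in Set.Icc 0 a, ENNReal.ofReal (wt d θ ν t) ∂θ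
      = ENNReal.ofReal (∫ t in Set.Icc 0 a, wt d θ ν t ∂θ) := by
  have hw := measurable_wt (d := d) (θ := θ) (ν := ν) hd
  exact setLIntegral_eq_ofReal_setIntegral measurableSet_Icc (by fun_prop) (fun _ _ => rfl)
    (fun _ _ => (wt_pos _).le)
    (setLIntegral_Icc_ne_top ENNReal.one_ne_top fun t _ => ENNReal.ofReal_le_one.2 (wt_le_one t))

omit [IsProbabilityMeasure ν] in
theorem lintegral_wt_rpow_eq (hd : 1 ≤ d) (a : ℝ≥0) :
    ∫⁻ t in Set.Icc 0 a, ENNReal.ofReal (wt d θ ν t ^ (1 / 2 : ℝ)) ∂θ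
      = ENNReal.ofReal (∫ t in Set.Icc 0 a, wt d θ ν t ^ (1 / 2 : ℝ) ∂θ) := by
  have hw := measurable_wt (d := d) (θ := θ) (ν := ν) hd
  exact setLIntegral_eq_ofReal_setIntegral measurableSet_Icc (by fun_prop) (fun _ _ => rfl)
    (fun _ _ => Real.rpow_nonneg (wt_pos _).le _)
    (setLIntegral_Icc_ne_top ENNReal.one_ne_top fun t _ =>
      ENNReal.ofReal_le_one.2 (wt_rpow_le_one t))

theorem coe_tsub_pow_le {t s b : ℝ≥0} (h : t ≤ b) :
    ((t - s : ℝ≥0) : ℝ≥0∞) ^ d ≤ (b : ℝ≥0∞) ^ d :=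
  pow_le_pow_left₀ zero_le (ENNReal.coe_le_coe.2 (tsub_le_self.trans h)) d

omit [IsProbabilityMeasure ν] in
theorem lintegral_lower_term_eq (hd : 1 ≤ d) (a : ℝ≥0) :
    ∫⁻ t in Set.Icc 0 a, ∫⁻ s in Set.Icc 0 t, ((t - s : ℝ≥0) : ℝ≥0∞) ^ d *
        ENNReal.ofReal (wt d θ ν s) * ENNReal.ofReal (wt d θ ν t) ∂θ ∂θ
      = ENNReal.ofReal (∫ t in Set.Icc 0 a, ∫ s in Set.Icc 0 t,
          ((t : ℝ) - (s : ℝ)) ^ d * wt d θ ν s * wt d θ ν t ∂θ ∂θ) := by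
  have hw := measurable_wt (d := d) (θ := θ) (ν := ν) hd
  have hb : ∀ t s : ℝ≥0, t ≤ a → ((t - s : ℝ≥0) : ℝ≥0∞) ^ d *
        ENNReal.ofReal (wt d θ ν s) * ENNReal.ofReal (wt d θ ν t) ≤ (a : ℝ≥0∞) ^ d := by
    intro t s hta
    refine (mul_le_of_le_one_right zero_le (ENNReal.ofReal_le_one.2 (wt_le_one t))).trans ?_
    refine (mul_le_of_le_one_right zero_le (ENNReal.ofReal_le_one.2 (wt_le_one s))).trans ?_
    exact coe_tsub_pow_le hta
  have hinner : ∀ t : ℝ≥0, t ≤ a → ∫⁻ s in Set.Icc 0 t, ((t - s : ℝ≥0) : ℝ≥0∞) ^ d *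
        ENNReal.ofReal (wt d θ ν s) * ENNReal.ofReal (wt d θ ν t) ∂θ
        ≤ (a : ℝ≥0∞) ^ d * θ (Set.Icc 0 a) := by
    intro t hta
    rw [← setLIntegral_const]
    refine (lintegral_mono fun s => hb t s hta).trans (lintegral_mono_set ?_)
    exact Set.Icc_subset_Icc_right hta
  have hC : (a : ℝ≥0∞) ^ d * θ (Set.Icc 0 a) ≠ ∞ :=
    ENNReal.mul_ne_top (by finiteness) (measure_Icc_lt_top' 0 a).ne
  refine setLIntegral_eq_ofReal_setIntegral measurableSet_Icc ?_ ?_ ?_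
    (setLIntegral_Icc_ne_top hC fun t ht => hinner t ht.2)
  · have h1 : ∀ t : ℝ≥0, ∫⁻ s in Set.Icc 0 t, ((t - s : ℝ≥0) : ℝ≥0∞) ^ d *
        ENNReal.ofReal (wt d θ ν s) * ENNReal.ofReal (wt d θ ν t) ∂θ
        = ∫⁻ s, ((t - s : ℝ≥0) : ℝ≥0∞) ^ d *
          (ENNReal.ofReal (wt d θ ν s) * ENNReal.ofReal (wt d θ ν t)) ∂θ := fun t => by
      rw [lintegral_tsub_pow_mul hd]
      simp_rw [mul_assoc]
    simp_rw [h1]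
    have : Measurable fun p : ℝ≥0 × ℝ≥0 => ((p.1 - p.2 : ℝ≥0) : ℝ≥0∞) ^ d *
      (ENNReal.ofReal (wt d θ ν p.2) * ENNReal.ofReal (wt d θ ν p.1)) := by fun_prop
    exact this.lintegral_prod_right'
  · intro t ht
    refine setLIntegral_eq_ofReal_setIntegral measurableSet_Icc (by fun_prop) ?_ ?_
      (ne_top_of_le_ne_top hC (hinner t ht.2))
    · intro s hs
      have h0 : (0 : ℝ) ≤ ((t : ℝ) - s) ^ d := sub_pow_nonneg hs.2 d
      have h1 := (wt_pos (d := d) (θ := θ) (ν := ν) s).le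
      rw [ENNReal.ofReal_mul (by positivity), ENNReal.ofReal_mul h0, ofReal_sub_pow hs.2]
    · intro s hs
      have h0 : (0 : ℝ) ≤ ((t : ℝ) - s) ^ d := sub_pow_nonneg hs.2 d
      have h1 := (wt_pos (d := d) (θ := θ) (ν := ν) s).le
      have h2 := (wt_pos (d := d) (θ := θ) (ν := ν) t).le
      positivity
  · intro t ht
    refine setIntegral_nonneg measurableSet_Icc fun s hs => ?_
    have h0 : (0 : ℝ) ≤ ((t : ℝ) - s) ^ d := sub_pow_nonneg hs.2 d
    have h1 := (wt_pos (d := d) (θ := θ) (ν := ν) s).le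
    have h2 := (wt_pos (d := d) (θ := θ) (ν := ν) t).le
    positivity

theorem measurable_setLIntegral_Icc_min {F : (ℝ≥0 × ℝ≥0) × ℝ≥0 → ℝ≥0∞} (hF : Measurable F) :
    Measurable fun z : ℝ≥0 × ℝ≥0 => ∫⁻ s in Set.Icc 0 (min z.1 z.2), F (z, s) ∂θ := by
  have hset : MeasurableSet {p : (ℝ≥0 × ℝ≥0) × ℝ≥0 | p.2 ≤ min p.1.1 p.1.2} :=
    measurableSet_le (by fun_prop) (by fun_prop)
  have h1 : ∀ z : ℝ≥0 × ℝ≥0, ∫⁻ s in Set.Icc 0 (min z.1 z.2), F (z, s) ∂θ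
      = ∫⁻ s, {p : (ℝ≥0 × ℝ≥0) × ℝ≥0 | p.2 ≤ min p.1.1 p.1.2}.indicator F (z, s) ∂θ := by
    intro z
    rw [← lintegral_indicator measurableSet_Icc]
    refine lintegral_congr fun s => ?_
    simp [Set.indicator]
  simp_rw [h1]
  exact (hF.indicator hset).lintegral_prod_right'

omit [IsProbabilityMeasure ν] in
theorem lintegral_upper_term_eq (hd : 1 ≤ d) (a : ℝ≥0) :
    ∫⁻ t₁ in Set.Icc 0 a, ∫⁻ t₂ in Set.Icc 0 a, ∫⁻ s in Set.Icc 0 (min t₁ t₂),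
            ((t₁ - s : ℝ≥0) : ℝ≥0∞) ^ d * ((t₂ - s : ℝ≥0) : ℝ≥0∞) ^ d *
            ENNReal.ofReal (wt d θ ν t₁ ^ (1 / 2 : ℝ)) *
            ENNReal.ofReal (wt d θ ν t₂ ^ (1 / 2 : ℝ)) ∂θ ∂θ ∂θ
      = ENNReal.ofReal (∫ t in Set.Icc 0 a ×ˢ Set.Icc 0 a, ∫ s in Set.Icc 0 (min t.1 t.2),
                ((t.1 : ℝ) - (s : ℝ)) ^ d * ((t.2 : ℝ) - (s : ℝ)) ^ d *
                  wt d θ ν t.1 ^ (1 / 2 : ℝ) * wt d θ ν t.2 ^ (1 / 2 : ℝ) ∂θ ∂(θ.prod θ)) := by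
  have hw := measurable_wt (d := d) (θ := θ) (ν := ν) hd
  have hS : MeasurableSet (Set.Icc 0 a ×ˢ Set.Icc 0 a : Set (ℝ≥0 × ℝ≥0)) :=
    measurableSet_Icc.prod measurableSet_Icc
  have hm := measurable_setLIntegral_Icc_min (θ := θ) (F := fun p =>
    ((p.1.1 - p.2 : ℝ≥0) : ℝ≥0∞) ^ d * ((p.1.2 - p.2 : ℝ≥0) : ℝ≥0∞) ^ d *
            ENNReal.ofReal (wt d θ ν p.1.1 ^ (1 / 2 : ℝ)) *
            ENNReal.ofReal (wt d θ ν p.1.2 ^ (1 / 2 : ℝ))) (by fun_prop)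
  have hC : (a : ℝ≥0∞) ^ d * (a : ℝ≥0∞) ^ d * θ (Set.Icc 0 a) ≠ ∞ :=
    ENNReal.mul_ne_top (by finiteness) (measure_Icc_lt_top' 0 a).ne
  have hinner : ∀ z ∈ (Set.Icc 0 a ×ˢ Set.Icc 0 a : Set (ℝ≥0 × ℝ≥0)),
      ∫⁻ s in Set.Icc 0 (min z.1 z.2),
        ((z.1 - s : ℝ≥0) : ℝ≥0∞) ^ d * ((z.2 - s : ℝ≥0) : ℝ≥0∞) ^ d *
            ENNReal.ofReal (wt d θ ν z.1 ^ (1 / 2 : ℝ)) *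
            ENNReal.ofReal (wt d θ ν z.2 ^ (1 / 2 : ℝ)) ∂θ
        ≤ (a : ℝ≥0∞) ^ d * (a : ℝ≥0∞) ^ d * θ (Set.Icc 0 a) := by
    rintro z ⟨h1, h2⟩
    rw [← setLIntegral_const]
    refine (lintegral_mono fun s => ?_).trans (lintegral_mono_set
      (Set.Icc_subset_Icc_right ((min_le_left _ _).trans h1.2)))
    refine (mul_le_of_le_one_right zero_le (ENNReal.ofReal_le_one.2 (wt_rpow_le_one _))).trans ?_
    refine (mul_le_of_le_one_right zero_le (ENNReal.ofReal_le_one.2 (wt_rpow_le_one _))).trans ?_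
    exact mul_le_mul' (coe_tsub_pow_le h1.2) (coe_tsub_pow_le h2.2)
  have hsplit := lintegral_prod (μ := θ.restrict (Set.Icc 0 a)) (ν := θ.restrict (Set.Icc 0 a))
    _ hm.aemeasurable
  simp only at hsplit
  rw [← hsplit, Measure.prod_restrict]
  refine setLIntegral_eq_ofReal_setIntegral hS hm ?_ ?_ ?_
  · intro z hz
    refine setLIntegral_eq_ofReal_setIntegral measurableSet_Icc (by fun_prop) ?_ ?_
      (ne_top_of_le_ne_top hC (hinner z hz))
    · intro s hs
      have hs1 : s ≤ z.1 := hs.2.trans (min_le_left _ _)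
      have hs2 : s ≤ z.2 := hs.2.trans (min_le_right _ _)
      have h1 : (0 : ℝ) ≤ ((z.1 : ℝ) - s) ^ d := sub_pow_nonneg hs1 d
      have h2 : (0 : ℝ) ≤ ((z.2 : ℝ) - s) ^ d := sub_pow_nonneg hs2 d
      have h3 := (wt_pos (d := d) (θ := θ) (ν := ν) z.1).le
      rw [ENNReal.ofReal_mul (by positivity), ENNReal.ofReal_mul (by positivity),
        ENNReal.ofReal_mul h1, ofReal_sub_pow hs1, ofReal_sub_pow hs2]
    · intro s hs
      have hs1 : s ≤ z.1 := hs.2.trans (min_le_left _ _)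
      have hs2 : s ≤ z.2 := hs.2.trans (min_le_right _ _)
      have h1 : (0 : ℝ) ≤ ((z.1 : ℝ) - s) ^ d := sub_pow_nonneg hs1 d
      have h2 : (0 : ℝ) ≤ ((z.2 : ℝ) - s) ^ d := sub_pow_nonneg hs2 d
      have h3 := (wt_pos (d := d) (θ := θ) (ν := ν) z.1).le
      have h4 := (wt_pos (d := d) (θ := θ) (ν := ν) z.2).le
      positivity
  · intro z hz
    refine setIntegral_nonneg measurableSet_Icc fun s hs => ?_
    have hs1 : s ≤ z.1 := hs.2.trans (min_le_left _ _)
    have hs2 : s ≤ z.2 := hs.2.trans (min_le_right _ _)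
    have h1 : (0 : ℝ) ≤ ((z.1 : ℝ) - s) ^ d := sub_pow_nonneg hs1 d
    have h2 : (0 : ℝ) ≤ ((z.2 : ℝ) - s) ^ d := sub_pow_nonneg hs2 d
    have h3 := (wt_pos (d := d) (θ := θ) (ν := ν) z.1).le
    have h4 := (wt_pos (d := d) (θ := θ) (ν := ν) z.2).le
    positivity
  · refine ne_top_of_le_ne_top (ENNReal.mul_ne_top hC (b := (θ.prod θ)
      (Set.Icc 0 a ×ˢ Set.Icc 0 a)) ?_) ?_
    · rw [Measure.prod_prod]
      exact ENNReal.mul_ne_top (measure_Icc_lt_top' 0 a).ne (measure_Icc_lt_top' 0 a).ne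
    · rw [← setLIntegral_const]
      exact setLIntegral_mono measurable_const hinner

theorem WindowCondition.measurableSet {W : Set (EuclideanSpace ℝ (Fin d))}
    (hW : WindowCondition W) : MeasurableSet W := hW.1.measurableSet

theorem WindowCondition.volume_ne_top {W : Set (EuclideanSpace ℝ (Fin d))}
    (hW : WindowCondition W) : volume W ≠ ∞ := hW.1.measure_lt_top.ne

theorem WindowCondition.volume_real_pos {W : Set (EuclideanSpace ℝ (Fin d))}
    (hW : WindowCondition W) : 0 < volume.real W := by
  rw [measureReal_def, ENNReal.toReal_pos_iff]
  exact ⟨Measure.measure_pos_of_nonempty_interior _ hW.2.2, hW.volume_ne_top.lt_top⟩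

variable {Ω : Type*} [MeasurableSpace Ω] {P : Measure Ω} [IsProbabilityMeasure P]
  {η : Ω → Measure (Seed d)} {W : Set (EuclideanSpace ℝ (Fin d))}

theorem le_variance_div (hd : 1 ≤ d) (hν : SpeedCondition d ν)
    (h : IsPoissonProcess η (intensity d θ ν) P) (hW : WindowCondition W) (a : ℝ≥0) :
    (∫ t in Set.Icc 0 a, wt d θ ν t ∂θ)
        - 2 * ballVol d * speedMoment ν d *
          (∫ t in Set.Icc 0 a, ∫ s in Set.Icc 0 t,
            ((t : ℝ) - (s : ℝ)) ^ d * wt d θ ν s * wt d θ ν t ∂θ ∂θ)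
      ≤ variance (fun ω => exposedCount W a (η ω)) P / volume.real W := by
  have key := le_ofReal_variance_exposedCount hd hν h hW.measurableSet hW.volume_ne_top a
  rw [lintegral_wt_eq hd, lintegral_lower_term_eq hd, hν.lintegral_pow (by omega),
    ← ofReal_measureReal hW.volume_ne_top] at key
  have hL := hW.volume_real_pos
  have hω := (ballVol_pos d).le
  have hν0 := speedMoment_nonneg ν d
  have hD : 0 ≤ ∫ t in Set.Icc 0 a, ∫ s in Set.Icc 0 t,
      ((t : ℝ) - (s : ℝ)) ^ d * wt d θ ν s * wt d θ ν t ∂θ ∂θ := by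
    refine setIntegral_nonneg measurableSet_Icc fun t ht => ?_
    refine setIntegral_nonneg measurableSet_Icc fun s hs => ?_
    have h0 : (0 : ℝ) ≤ ((t : ℝ) - s) ^ d := sub_pow_nonneg hs.2 d
    exact mul_nonneg (mul_nonneg h0 (wt_pos s).le) (wt_pos t).le
  have hV := variance_nonneg (fun ω => exposedCount W a (η ω)) P
  rw [← ENNReal.ofReal_mul hω, ← ENNReal.ofReal_mul hL.le,
    ← ENNReal.ofReal_mul (by positivity), ← ENNReal.ofReal_mul hL.le, two_mul,
    ← ENNReal.ofReal_add (by positivity) (by positivity), ← ENNReal.ofReal_add hV (by positivity),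
    ENNReal.ofReal_le_ofReal_iff (by positivity)] at key
  rw [le_div_iff₀ hL]
  linarith

/-- The upper variance bound, with `w` rather than `2 w ^ (1 / 2)` in its first term. -/
theorem variance_div_le (hd : 1 ≤ d) (hν : SpeedCondition d ν)
    (h : IsPoissonProcess η (intensity d θ ν) P) (hW : WindowCondition W) (a : ℝ≥0) :
    variance (fun ω => exposedCount W a (η ω)) P / volume.real W
      ≤ (∫ t in Set.Icc 0 a, wt d θ ν t ∂θ)
        + ballVol d ^ 2 * speedMoment ν (2 * d) *
          (∫ t in Set.Icc 0 a ×ˢ Set.Icc 0 a, ∫ s in Set.Icc 0 (min t.1 t.2),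
            ((t.1 : ℝ) - (s : ℝ)) ^ d * ((t.2 : ℝ) - (s : ℝ)) ^ d *
              wt d θ ν t.1 ^ (1 / 2 : ℝ) * wt d θ ν t.2 ^ (1 / 2 : ℝ) ∂θ ∂(θ.prod θ)) := by
  have key := ofReal_variance_exposedCount_le hd hν h hW.measurableSet hW.volume_ne_top a
  rw [lintegral_wt_eq hd, lintegral_upper_term_eq hd, hν.lintegral_pow (by omega),
    ← ofReal_measureReal hW.volume_ne_top] at key
  have hL := hW.volume_real_pos
  have hω := (ballVol_pos d).le
  have hν0 := speedMoment_nonneg ν (2 * d)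
  have hA : 0 ≤ ∫ t in Set.Icc 0 a, wt d θ ν t ∂θ :=
    setIntegral_nonneg measurableSet_Icc fun t _ => (wt_pos t).le
  have hD : 0 ≤ ∫ t in Set.Icc 0 a ×ˢ Set.Icc 0 a, ∫ s in Set.Icc 0 (min t.1 t.2),
            ((t.1 : ℝ) - (s : ℝ)) ^ d * ((t.2 : ℝ) - (s : ℝ)) ^ d *
              wt d θ ν t.1 ^ (1 / 2 : ℝ) * wt d θ ν t.2 ^ (1 / 2 : ℝ) ∂θ ∂(θ.prod θ) := by
    refine integral_nonneg fun z => ?_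
    refine setIntegral_nonneg measurableSet_Icc fun s hs => ?_
    have hs1 : s ≤ z.1 := hs.2.trans (min_le_left _ _)
    have hs2 : s ≤ z.2 := hs.2.trans (min_le_right _ _)
    have h1 : (0 : ℝ) ≤ ((z.1 : ℝ) - s) ^ d := sub_pow_nonneg hs1 d
    have h2 : (0 : ℝ) ≤ ((z.2 : ℝ) - s) ^ d := sub_pow_nonneg hs2 d
    have h3 := (wt_pos (d := d) (θ := θ) (ν := ν) z.1).le
    have h4 := (wt_pos (d := d) (θ := θ) (ν := ν) z.2).le
    positivity
  rw [← ENNReal.ofReal_pow hω, ← ENNReal.ofReal_mul (by positivity),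
    ← ENNReal.ofReal_mul (by positivity), ← ENNReal.ofReal_add hA (by positivity),
    ← ENNReal.ofReal_mul hL.le, ENNReal.ofReal_le_ofReal_iff (by positivity)] at key
  rw [div_le_iff₀ hL]
  linarith

omit [IsProbabilityMeasure ν] in
-- Since w ≤ 1, already w ≤ w^(1/2); the factor 2 is slack.
theorem integral_wt_le (hd : 1 ≤ d) (a : ℝ≥0) :
    ∫ t in Set.Icc 0 a, wt d θ ν t ∂θ ≤ 2 * ∫ t in Set.Icc 0 a, wt d θ ν t ^ (1 / 2 : ℝ) ∂θ := by
  have h1 : ENNReal.ofReal (∫ t in Set.Icc 0 a, wt d θ ν t ∂θ)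
      ≤ ENNReal.ofReal (∫ t in Set.Icc 0 a, wt d θ ν t ^ (1 / 2 : ℝ) ∂θ) := by
    rw [← lintegral_wt_eq hd, ← lintegral_wt_rpow_eq hd]
    refine lintegral_mono fun t => ENNReal.ofReal_le_ofReal ?_
    exact Real.self_le_rpow_of_le_one (wt_pos t).le (wt_le_one t) (by norm_num)
  have h0 : 0 ≤ ∫ t in Set.Icc 0 a, wt d θ ν t ^ (1 / 2 : ℝ) ∂θ :=
    integral_nonneg fun t => Real.rpow_nonneg (wt_pos t).le _
  have h2 := (ENNReal.ofReal_le_ofReal_iff h0).1 h1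
  linarith

end RealBounds

/-! ### Integrals of `t ^ τ * exp (-b t ^ p)` -/

section PowExp

/-- `∫₀ᵃ t ^ τ exp (-b t ^ p) dt`. -/
noncomputable def powExpInt (τ p b a : ℝ) : ℝ :=
  ∫ t in (0 : ℝ)..a, t ^ τ * Real.exp (-(b * t ^ p))

variable {τ p : ℝ}

theorem continuous_exp_neg_mul_rpow (hp : 0 < p) (b : ℝ) :
    Continuous fun t : ℝ => Real.exp (-(b * t ^ p)) := by
  have := Real.continuous_rpow_const hp.le
  fun_prop

theorem intervalIntegrable_rpow_mul {f : ℝ → ℝ} (hτ : -1 < τ) (hf : Continuous f) (a b : ℝ) :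
    IntervalIntegrable (fun t : ℝ => t ^ τ * f t) volume a b :=
  (intervalIntegral.intervalIntegrable_rpow' hτ).mul_continuousOn hf.continuousOn

theorem intervalIntegrable_powExp (hτ : -1 < τ) (hp : 0 < p) (b x y : ℝ) :
    IntervalIntegrable (fun t : ℝ => t ^ τ * Real.exp (-(b * t ^ p))) volume x y :=
  intervalIntegrable_rpow_mul hτ (continuous_exp_neg_mul_rpow hp b) x y

theorem powExpInt_anti (hτ : -1 < τ) (hp : 0 < p) {a b c : ℝ} (ha : 0 ≤ a) (hbc : b ≤ c) :
    powExpInt τ p c a ≤ powExpInt τ p b a := by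
  refine intervalIntegral.integral_mono_on ha (intervalIntegrable_powExp hτ hp c 0 a)
    (intervalIntegrable_powExp hτ hp b 0 a) fun t ht => ?_
  have h0 := Real.rpow_nonneg ht.1 τ
  have h1 := Real.rpow_nonneg ht.1 p
  gcongr

theorem powExpInt_pos (hτ : -1 < τ) (hp : 0 < p) {a : ℝ} (ha : 0 < a) (b : ℝ) :
    0 < powExpInt τ p b a := by
  refine intervalIntegral.intervalIntegral_pos_of_pos_on (intervalIntegrable_powExp hτ hp b 0 a)
    (fun t ht => ?_) ha
  have := Real.rpow_pos_of_pos ht.1 τ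
  positivity

theorem powExpInt_le_rpow (hτ : -1 < τ) (hp : 0 < p) {a b : ℝ} (ha : 0 ≤ a) (hb : 0 ≤ b) :
    powExpInt τ p b a ≤ a ^ (τ + 1) / (τ + 1) := by
  refine (powExpInt_anti hτ hp ha hb).trans_eq ?_
  simp only [powExpInt, zero_mul, neg_zero, Real.exp_zero, mul_one]
  rw [integral_rpow (Or.inl hτ), Real.zero_rpow (by linarith), sub_zero]

theorem powExpInt_le_Gamma (hτ : -1 < τ) (hp : 0 < p) {a b : ℝ} (ha : 0 ≤ a) (hb : 0 < b) :
    powExpInt τ p b a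
      ≤ b ^ (-((τ + 1) / p)) * (1 / p) * Real.Gamma ((τ + 1) / p) := by
  have e := integral_rpow_mul_exp_neg_mul_rpow hp hτ hb
  rw [neg_div] at e
  rw [← e, powExpInt, intervalIntegral.integral_of_le ha]
  -- A non-integrable function would have integral 0 by convention, whereas the Gamma formula gives
  -- a positive value.
  have hint : IntegrableOn (fun x : ℝ => x ^ τ * Real.exp (-b * x ^ p)) (Set.Ioi 0) := by
    by_contra hcon
    rw [integral_undef hcon] at e
    have h1 : 0 < Real.Gamma ((τ + 1) / p) := Real.Gamma_pos_of_pos (div_pos (by linarith) hp)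
    have h2 := Real.rpow_pos_of_pos hb (-((τ + 1) / p))
    have : 0 < b ^ (-((τ + 1) / p)) * (1 / p) * Real.Gamma ((τ + 1) / p) := by positivity
    linarith
  simp only [← neg_mul]
  refine setIntegral_mono_set hint ?_ (Set.Ioc_subset_Ioi_self).eventuallyLE
  filter_upwards [ae_restrict_mem measurableSet_Ioi] with x hx
  have := Real.rpow_nonneg (le_of_lt hx) τ
  simp only [Pi.zero_apply]
  positivity

theorem intervalIntegrable_lowerGamma {q : ℝ} (hq : 0 < q) (x y : ℝ) :
    IntervalIntegrable (fun t : ℝ => t ^ (q - 1) * Real.exp (-t)) volume x y :=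
  intervalIntegrable_rpow_mul (by linarith) (by fun_prop) x y

theorem lowerGamma_mono {q : ℝ} (hq : 0 < q) {x y : ℝ} (hx : 0 ≤ x) (hxy : x ≤ y) :
    lowerGamma q x ≤ lowerGamma q y := by
  refine intervalIntegral.integral_mono_interval le_rfl hx hxy ?_
    (intervalIntegrable_lowerGamma hq 0 y)
  filter_upwards [ae_restrict_mem measurableSet_Ioc] with t ht
  have := Real.rpow_nonneg ht.1.le (q - 1)
  simp only [Pi.zero_apply]
  positivity

/-- Substitute y = t^p and then u = b y. -/
theorem powExpInt_eq_lowerGamma (hp : 0 < p) {a b : ℝ} (ha : 0 ≤ a) (hb : 0 < b) :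
    powExpInt τ p b a
      = 1 / p * (b ^ (-((τ + 1) / p)) * lowerGamma ((τ + 1) / p) (a ^ p * b)) := by
  set q := (τ + 1) / p with hq
  have hap : 0 ≤ a ^ p := Real.rpow_nonneg ha p
  have hpq : p * q = τ + 1 := by rw [hq]; field_simp
  have e1 : powExpInt τ p b a
      = 1 / p * ∫ y in (0 : ℝ)..(a ^ p), y ^ (q - 1) * Real.exp (-(b * y)) := by
    -- The change of variables is available on the half-line, so the upper limit is encoded by an
    -- indicator.
    have h := integral_comp_rpow_Ioi_of_pos (p := p)
      (g := (Set.Iic (a ^ p)).indicator fun y : ℝ => y ^ (q - 1) * Real.exp (-(b * y))) hp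
    rw [setIntegral_indicator measurableSet_Iic, Set.Ioi_inter_Iic,
      ← intervalIntegral.integral_of_le hap] at h
    rw [← h, powExpInt, intervalIntegral.integral_of_le ha, ← integral_const_mul,
      ← Set.Ioi_inter_Iic, ← setIntegral_indicator measurableSet_Iic]
    refine setIntegral_congr_fun measurableSet_Ioi fun x hx => ?_
    have hx0 : (0 : ℝ) < x := hx
    by_cases hxa : x ≤ a
    · have hxp : x ^ p ≤ a ^ p := Real.rpow_le_rpow hx0.le hxa hp.le
      simp only [Set.indicator, Set.mem_Iic, hxa, hxp, if_true, smul_eq_mul]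
      have : x ^ (p - 1) * (x ^ p) ^ (q - 1) = x ^ τ := by
        rw [← Real.rpow_mul hx0.le, ← Real.rpow_add hx0]
        congr 1
        linear_combination hpq
      rw [← this]
      field_simp
    · have hxp : ¬ x ^ p ≤ a ^ p := by
        rw [not_le] at hxa ⊢
        exact Real.rpow_lt_rpow ha hxa hp
      simp [Set.indicator, hxa, hxp]
  have e2 : ∫ y in (0 : ℝ)..(a ^ p), y ^ (q - 1) * Real.exp (-(b * y))
      = b ^ (-q) * lowerGamma q (a ^ p * b) := by
    have h := intervalIntegral.integral_comp_mul_left (a := 0) (b := a ^ p)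
      (fun u : ℝ => u ^ (q - 1) * Real.exp (-u)) hb.ne'
    rw [mul_zero, mul_comm b (a ^ p)] at h
    have h2 : ∫ y in (0 : ℝ)..(a ^ p), (b * y) ^ (q - 1) * Real.exp (-(b * y))
        = b ^ (q - 1) * ∫ y in (0 : ℝ)..(a ^ p), y ^ (q - 1) * Real.exp (-(b * y)) := by
      rw [← intervalIntegral.integral_const_mul]
      refine intervalIntegral.integral_congr fun y hy => ?_
      rw [Set.uIcc_of_le hap] at hy
      rw [Real.mul_rpow hb.le hy.1, mul_assoc]
    rw [h2, smul_eq_mul] at h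
    have hbq : b ^ (-q) = b⁻¹ * (b ^ (q - 1))⁻¹ := by
      rw [← Real.rpow_neg hb.le, ← Real.rpow_neg_one b, ← Real.rpow_add hb]
      congr 1
      ring
    have hpos := Real.rpow_pos_of_pos hb (q - 1)
    rw [hbq, lowerGamma, mul_right_comm, ← h]
    field_simp
  rw [e1, e2]

/-- The factor does not depend on `a` or `x`. For c ≥ 1 the integral decreases with the rate; for c
≤ 1 the incomplete Gamma form gains c^(-(τ+1)/p) and its upper limit shrinks. It serves to absorb
the geometric factor of the decay rate. -/
theorem powExpInt_mul_le (hτ : -1 < τ) (hp : 0 < p) {a c x : ℝ} (ha : 0 ≤ a) (hc : 0 < c)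
    (hx : 0 < x) :
    powExpInt τ p (c * x) a ≤ max 1 (c ^ (-((τ + 1) / p))) * powExpInt τ p x a := by
  have hq : 0 < (τ + 1) / p := div_pos (by linarith) hp
  have hG : 0 ≤ powExpInt τ p x a := by
    refine intervalIntegral.integral_nonneg ha fun t ht => ?_
    have := Real.rpow_nonneg ht.1 τ
    positivity
  rcases le_total 1 c with h | h
  · calc powExpInt τ p (c * x) a ≤ powExpInt τ p x a :=
        powExpInt_anti hτ hp ha (le_mul_of_one_le_left hx.le h)
      _ ≤ _ := le_mul_of_one_le_left hG (le_max_left _ _)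
  · calc powExpInt τ p (c * x) a ≤ c ^ (-((τ + 1) / p)) * powExpInt τ p x a := by
          rw [powExpInt_eq_lowerGamma hp ha (by positivity),
            powExpInt_eq_lowerGamma hp ha hx, Real.mul_rpow hc.le hx.le]
          have h1 : lowerGamma ((τ + 1) / p) (a ^ p * (c * x))
              ≤ lowerGamma ((τ + 1) / p) (a ^ p * x) := by
            refine lowerGamma_mono hq (by positivity) ?_
            gcongr
            exact mul_le_of_le_one_left hx.le h
          have := mul_le_mul_of_nonneg_left h1
            (show 0 ≤ 1 / p * (c ^ (-((τ + 1) / p)) * x ^ (-((τ + 1) / p))) by positivity)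
          linarith
      _ ≤ _ := mul_le_mul_of_nonneg_right (le_max_right _ _) hG

theorem le_powExpInt_mul (hτ : -1 < τ) (hp : 0 < p) {a c x : ℝ} (ha : 0 ≤ a) (hc : 0 < c)
    (hx : 0 < x) :
    min 1 (c ^ (-((τ + 1) / p))) * powExpInt τ p x a ≤ powExpInt τ p (c * x) a := by
  have hq : 0 < (τ + 1) / p := div_pos (by linarith) hp
  have hG : 0 ≤ powExpInt τ p x a := by
    refine intervalIntegral.integral_nonneg ha fun t ht => ?_
    have := Real.rpow_nonneg ht.1 τ
    positivity
  rcases le_total c 1 with h | h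
  · calc _ ≤ powExpInt τ p x a := mul_le_of_le_one_left hG (min_le_left _ _)
      _ ≤ _ := powExpInt_anti hτ hp ha (mul_le_of_le_one_left hx.le h)
  · calc _ ≤ c ^ (-((τ + 1) / p)) * powExpInt τ p x a :=
          mul_le_mul_of_nonneg_right (min_le_right _ _) hG
      _ ≤ _ := by
          rw [powExpInt_eq_lowerGamma hp ha (by positivity : 0 < c * x),
            powExpInt_eq_lowerGamma hp ha hx, Real.mul_rpow hc.le hx.le]
          have h1 : lowerGamma ((τ + 1) / p) (a ^ p * x)
              ≤ lowerGamma ((τ + 1) / p) (a ^ p * (c * x)) := by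
            refine lowerGamma_mono hq (by positivity) ?_
            gcongr
            exact le_mul_of_one_le_left hx.le h
          have := mul_le_mul_of_nonneg_left h1
            (show 0 ≤ 1 / p * (c ^ (-((τ + 1) / p)) * x ^ (-((τ + 1) / p))) by positivity)
          linarith

/-- Integration by parts for `t ^ (τ + 1) exp (-b t ^ p)`. -/
theorem integral_rpow_add_mul_exp (hτ : -1 < τ) (hp : 0 < p) {a b : ℝ} (ha : 0 ≤ a) :
    p * (b * ∫ t in (0 : ℝ)..a, t ^ τ * (t ^ p * Real.exp (-(b * t ^ p))))
      = (τ + 1) * powExpInt τ p b a - a ^ (τ + 1) * Real.exp (-(b * a ^ p)) := by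
  have hc := continuous_exp_neg_mul_rpow hp b
  have hcp := Real.continuous_rpow_const hp.le
  have hcτ := Real.continuous_rpow_const (show 0 ≤ τ + 1 by linarith)
  have hi1 := intervalIntegrable_powExp hτ hp b 0 a
  have hi2 : IntervalIntegrable (fun t : ℝ => t ^ τ * (t ^ p * Real.exp (-(b * t ^ p))))
      volume 0 a := intervalIntegrable_rpow_mul hτ (by fun_prop) 0 a
  have h := intervalIntegral.integral_eq_sub_of_hasDerivAt_of_le ha
    (f := fun t : ℝ => t ^ (τ + 1) * Real.exp (-(b * t ^ p)))
    (f' := fun t => (τ + 1) * (t ^ τ * Real.exp (-(b * t ^ p)))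
      - (p * b) * (t ^ τ * (t ^ p * Real.exp (-(b * t ^ p)))))
    (by fun_prop) (fun t ht => ?_) ((hi1.const_mul _).sub (hi2.const_mul _))
  · rw [intervalIntegral.integral_sub (hi1.const_mul _) (hi2.const_mul _),
      intervalIntegral.integral_const_mul, intervalIntegral.integral_const_mul,
      Real.zero_rpow (by linarith), zero_mul, sub_zero] at h
    rw [powExpInt, ← h]
    ring
  · have ht0 : (0 : ℝ) < t := ht.1
    have d1 := Real.hasDerivAt_rpow_const (x := t) (p := τ + 1) (Or.inl ht0.ne')
    have d2 := ((Real.hasDerivAt_rpow_const (x := t) (p := p) (Or.inl ht0.ne')).const_mul b).neg.exp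
    refine (d1.mul d2).congr_deriv ?_
    have e1 : t ^ (τ + 1) * t ^ (p - 1) = t ^ τ * t ^ p := by
      rw [← Real.rpow_add ht0, ← Real.rpow_add ht0]
      congr 1
      ring
    rw [add_sub_cancel_right]
    simp only [Pi.neg_apply]
    linear_combination (-(Real.exp (-(b * t ^ p)) * b * p)) * e1

/-- The extra t^p is absorbed by y ≤ e^y at y = b t^p / 4, which lowers the rate from b/2 to b/4. -/
theorem integral_rpow_add_mul_exp_half_le (hτ : -1 < τ) (hp : 0 < p) {a b : ℝ} (ha : 0 ≤ a)
    (hb : 0 < b) :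
    ∫ t in (0 : ℝ)..a, t ^ τ * (t ^ p * Real.exp (-(b / 2 * t ^ p)))
      ≤ 4 / b * powExpInt τ p (b / 4) a := by
  have hc := continuous_exp_neg_mul_rpow hp (b / 2)
  have hcp := Real.continuous_rpow_const hp.le
  rw [powExpInt, ← intervalIntegral.integral_const_mul]
  refine intervalIntegral.integral_mono_on ha (intervalIntegrable_rpow_mul hτ (by fun_prop) 0 a)
    ((intervalIntegrable_powExp hτ hp _ 0 a).const_mul _) fun t ht => ?_
  have h0 := Real.rpow_nonneg ht.1 τ
  have h1 : b / 4 * t ^ p ≤ Real.exp (b / 4 * t ^ p) := by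
    linarith [Real.add_one_le_exp (b / 4 * t ^ p)]
  have h2 : t ^ p * Real.exp (-(b / 2 * t ^ p)) ≤ 4 / b * Real.exp (-(b / 4 * t ^ p)) := by
    have e : Real.exp (-(b / 4 * t ^ p))
        = Real.exp (b / 4 * t ^ p) * Real.exp (-(b / 2 * t ^ p)) := by
      rw [← Real.exp_add]
      congr 1
      ring
    rw [e, ← mul_assoc]
    refine mul_le_mul_of_nonneg_right ?_ (Real.exp_pos _).le
    calc t ^ p = 4 / b * (b / 4 * t ^ p) := by field_simp
      _ ≤ _ := by gcongr
  calc _ ≤ t ^ τ * (4 / b * Real.exp (-(b / 4 * t ^ p))) := mul_le_mul_of_nonneg_left h2 h0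
    _ = _ := by ring

/-- A lower bound that is uniform in `a` and `b`, for `2 (τ + 1) ≤ p`. -/
theorem exists_pos_mul_powExpInt_le (hτ : -1 < τ) (hp : 0 < p) (hτp : 2 * (τ + 1) ≤ p) {κ : ℝ}
    (hκ : 0 < κ) :
    ∃ c : ℝ, 0 < c ∧ ∀ a b : ℝ, 0 < a → 0 < b →
      c * powExpInt τ p b a ≤ powExpInt τ p b a
        - 2 * (b * ∫ t in (0 : ℝ)..a, t ^ τ * (t ^ p * Real.exp (-(b * t ^ p))))
        + κ * b ^ 2 * ∫ t in (0 : ℝ)..a, t ^ τ * ((t ^ p) ^ 2 * Real.exp (-(2 * b * t ^ p))) := by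
  have hΓ : 0 < Real.Gamma ((τ + 1) / p) := Real.Gamma_pos_of_pos (div_pos (by linarith) hp)
  have hτ1 : 0 < τ + 1 := by linarith
  have hcp := Real.continuous_rpow_const hp.le
  -- `c₁` serves b a^p ≤ 1, where the boundary term of the integration by parts is comparable to
  -- a^(τ+1); `c₂` serves b a^p > 1, where that term may be negligible and the quadratic term takes
  -- over.
  set c₁ := 2 * (τ + 1) / p * Real.exp (-1) with hc₁
  set c₂ := κ * Real.exp (-2) * p / ((τ + 2 * p + 1) * Real.Gamma ((τ + 1) / p)) with hc₂
  have hc₁0 : 0 < c₁ := by positivity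
  have hτ2 : 0 < τ + 2 * p + 1 := by linarith
  have hc₂0 : 0 < c₂ := by positivity
  refine ⟨min c₁ c₂, lt_min hc₁0 hc₂0, fun a b ha hb => ?_⟩
  have hG := powExpInt_pos hτ hp ha b
  have hparts := integral_rpow_add_mul_exp (b := b) hτ hp ha.le
  set I₂ := ∫ t in (0 : ℝ)..a, t ^ τ * ((t ^ p) ^ 2 * Real.exp (-(2 * b * t ^ p))) with hI₂
  have hI₂0 : 0 ≤ I₂ := by
    refine intervalIntegral.integral_nonneg ha.le fun t ht => ?_
    have := Real.rpow_nonneg ht.1 τ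
    positivity
  have hE : 0 ≤ a ^ (τ + 1) * Real.exp (-(b * a ^ p)) := by positivity
  -- Integration by parts leaves (1 - 2(τ+1)/p) times the integral plus the boundary term; the first
  -- coefficient is non-negative by `hτp`.
  have hbase : 2 / p * (a ^ (τ + 1) * Real.exp (-(b * a ^ p))) ≤ powExpInt τ p b a
        - 2 * (b * ∫ t in (0 : ℝ)..a, t ^ τ * (t ^ p * Real.exp (-(b * t ^ p)))) := by
    have h1 : b * ∫ t in (0 : ℝ)..a, t ^ τ * (t ^ p * Real.exp (-(b * t ^ p)))
        = ((τ + 1) * powExpInt τ p b a - a ^ (τ + 1) * Real.exp (-(b * a ^ p))) / p := by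
      rw [← hparts]
      field_simp
    rw [h1]
    have h2 : 2 * (τ + 1) * powExpInt τ p b a ≤ p * powExpInt τ p b a :=
      mul_le_mul_of_nonneg_right hτp hG.le
    have h3 : 2 * ((τ + 1) * powExpInt τ p b a) / p ≤ powExpInt τ p b a := by
      rw [div_le_iff₀ hp]
      linarith
    have h4 : 2 * (((τ + 1) * powExpInt τ p b a - a ^ (τ + 1) * Real.exp (-(b * a ^ p))) / p)
        = 2 * ((τ + 1) * powExpInt τ p b a) / p
          - 2 / p * (a ^ (τ + 1) * Real.exp (-(b * a ^ p))) := by ring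
    rw [h4]
    linarith
  rcases le_or_gt (b * a ^ p) 1 with hz | hz
  · have h1 : c₁ * powExpInt τ p b a ≤ 2 / p * (a ^ (τ + 1) * Real.exp (-(b * a ^ p))) := by
      calc c₁ * powExpInt τ p b a ≤ c₁ * (a ^ (τ + 1) / (τ + 1)) :=
            mul_le_mul_of_nonneg_left (powExpInt_le_rpow hτ hp ha.le hb.le) hc₁0.le
        _ = 2 / p * (a ^ (τ + 1) * Real.exp (-1)) := by
            rw [hc₁]
            field_simp
        _ ≤ _ := by gcongr
    have h2 : min c₁ c₂ * powExpInt τ p b a ≤ c₁ * powExpInt τ p b a :=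
      mul_le_mul_of_nonneg_right (min_le_left _ _) hG.le
    have h3 : 0 ≤ κ * b ^ 2 * I₂ := by positivity
    linarith
  -- `a₀` is the time at which b t^p = 1. Up to it the exponential in `I₂` is at least e^(-2), and
  -- b² a₀^(τ+2p+1) has exactly the scaling of the Gamma bound for the full integral.
  · set a₀ := b ^ (-(1 / p)) with ha₀
    have ha₀0 : 0 < a₀ := Real.rpow_pos_of_pos hb _
    have ha₀p : a₀ ^ p = b⁻¹ := by
      rw [ha₀, ← Real.rpow_mul hb.le, ← Real.rpow_neg_one b]
      congr 1
      field_simp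
    have haa : a₀ ≤ a := by
      by_contra! hlt
      have h1 : a ^ p ≤ a₀ ^ p := Real.rpow_le_rpow ha.le hlt.le hp.le
      rw [ha₀p] at h1
      have h2 := mul_le_mul_of_nonneg_left h1 hb.le
      rw [mul_inv_cancel₀ hb.ne'] at h2
      linarith
    have hint : ∀ x y, IntervalIntegrable
        (fun t : ℝ => t ^ τ * ((t ^ p) ^ 2 * Real.exp (-(2 * b * t ^ p)))) volume x y := by
      have hc := continuous_exp_neg_mul_rpow hp (2 * b)
      exact fun x y => intervalIntegrable_rpow_mul hτ (by fun_prop) x y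
    have h1 : Real.exp (-2) * (a₀ ^ (τ + 2 * p + 1) / (τ + 2 * p + 1)) ≤ I₂ := by
      calc Real.exp (-2) * (a₀ ^ (τ + 2 * p + 1) / (τ + 2 * p + 1))
          = ∫ t in (0 : ℝ)..a₀, Real.exp (-2) * t ^ (τ + 2 * p) := by
            rw [intervalIntegral.integral_const_mul, integral_rpow (Or.inl (by linarith)),
              Real.zero_rpow (by linarith), sub_zero]
        _ ≤ ∫ t in (0 : ℝ)..a₀, t ^ τ * ((t ^ p) ^ 2 * Real.exp (-(2 * b * t ^ p))) := by
            refine intervalIntegral.integral_mono_on_of_le_Ioo ha₀0.le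
              ((intervalIntegral.intervalIntegrable_rpow' (by linarith)).const_mul _)
              (hint _ _) fun t ht => ?_
            have ht0 : (0 : ℝ) < t := ht.1
            have e : t ^ (τ + 2 * p) = t ^ τ * (t ^ p) ^ 2 := by
              rw [Real.rpow_add ht0, mul_comm 2 p, Real.rpow_mul ht0.le, Real.rpow_two]
            have hle : b * t ^ p ≤ 1 := by
              have h1 : t ^ p ≤ a₀ ^ p := Real.rpow_le_rpow ht0.le ht.2.le hp.le
              rw [ha₀p] at h1
              have h2 := mul_le_mul_of_nonneg_left h1 hb.le
              rwa [mul_inv_cancel₀ hb.ne'] at h2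
            have hexp : Real.exp (-2) ≤ Real.exp (-(2 * b * t ^ p)) :=
              Real.exp_le_exp.2 (by linarith)
            have h3 : 0 ≤ t ^ τ * (t ^ p) ^ 2 := by positivity
            have h4 := mul_le_mul_of_nonneg_left hexp h3
            rw [e]
            linarith
        _ ≤ I₂ := by
            refine intervalIntegral.integral_mono_interval le_rfl ha₀0.le haa ?_ (hint _ _)
            filter_upwards [ae_restrict_mem measurableSet_Ioc] with t ht
            have := Real.rpow_nonneg ht.1.le τ
            simp only [Pi.zero_apply]
            positivity
    have h2 : b ^ 2 * a₀ ^ (τ + 2 * p + 1) = b ^ (-((τ + 1) / p)) := by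
      rw [ha₀, ← Real.rpow_mul hb.le, ← Real.rpow_two, ← Real.rpow_add hb]
      congr 1
      field_simp
      ring
    have h3 : c₂ * powExpInt τ p b a ≤ κ * b ^ 2 * I₂ := by
      calc c₂ * powExpInt τ p b a
          ≤ c₂ * (b ^ (-((τ + 1) / p)) * (1 / p) * Real.Gamma ((τ + 1) / p)) :=
            mul_le_mul_of_nonneg_left (powExpInt_le_Gamma hτ hp ha.le hb) hc₂0.le
        _ = κ * b ^ 2 * (Real.exp (-2) * (a₀ ^ (τ + 2 * p + 1) / (τ + 2 * p + 1))) := by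
            rw [← h2, hc₂]
            field_simp
        _ ≤ _ := by gcongr
    have h4 : min c₁ c₂ * powExpInt τ p b a ≤ c₂ * powExpInt τ p b a :=
      mul_le_mul_of_nonneg_right (min_le_right _ _) hG.le
    have h5 : 0 ≤ 2 / p * (a ^ (τ + 1) * Real.exp (-(b * a ^ p))) := by positivity
    linarith

theorem integral_rpow_sub_one_mul_exp_le (hp : 0 < p) {a b : ℝ} (ha : 0 ≤ a) (hb : 0 < b) :
    powExpInt (p - 1) p b a ≤ 1 / (p * b) := by
  refine (powExpInt_le_Gamma (by linarith) hp ha hb).trans_eq ?_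
  rw [sub_add_cancel, div_self hp.ne', Real.Gamma_one, Real.rpow_neg_one]
  field_simp

/-- `∫₀¹ u ^ β (1 - u) ^ k du`. -/
noncomputable def betaInt (β : ℝ) (k : ℕ) : ℝ := ∫ u in (0 : ℝ)..1, u ^ β * (1 - u) ^ k

theorem betaInt_pos {β : ℝ} (hβ : -1 < β) (k : ℕ) : 0 < betaInt β k := by
  refine intervalIntegral.intervalIntegral_pos_of_pos_on
    (intervalIntegrable_rpow_mul hβ (by fun_prop) 0 1) (fun t ht => ?_) one_pos
  have h1 := Real.rpow_pos_of_pos ht.1 β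
  have h2 : 0 < 1 - t := sub_pos.2 ht.2
  positivity

/-- Scaling s = t u for t > 0; at t = 0 both sides vanish because the exponent is positive. -/
theorem integral_rpow_mul_sub_pow {β : ℝ} (hβ : -1 < β) (k : ℕ) {t : ℝ} (ht : 0 ≤ t) :
    ∫ s in (0 : ℝ)..t, s ^ β * (t - s) ^ k = betaInt β k * t ^ (β + k + 1) := by
  have hk : (0 : ℝ) ≤ k := Nat.cast_nonneg k
  rcases ht.eq_or_lt with rfl | ht0
  · rw [Real.zero_rpow (by linarith)]
    simp
  · have h := intervalIntegral.integral_comp_mul_left (a := 0) (b := 1)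
      (fun s : ℝ => s ^ β * (t - s) ^ k) ht0.ne'
    rw [mul_zero, mul_one] at h
    have h2 : ∫ u in (0 : ℝ)..1, (t * u) ^ β * (t - t * u) ^ k
        = t ^ (β + k) * betaInt β k := by
      rw [betaInt, ← intervalIntegral.integral_const_mul]
      refine intervalIntegral.integral_congr fun u hu => ?_
      rw [Set.uIcc_of_le zero_le_one] at hu
      rw [Real.mul_rpow ht hu.1, Real.rpow_add ht0, Real.rpow_natCast,
        show t - t * u = t * (1 - u) by ring, mul_pow]
      ring
    rw [h2, smul_eq_mul] at h
    rw [Real.rpow_add_one ht0.ne', mul_comm (betaInt β k), mul_right_comm, h]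
    field_simp

end PowExp

/-! ### The model with birth times of intensity `t ^ τ` -/

section PowerLaw

variable {τ : ℝ}

theorem toNNReal_preimage_Iic (b : ℝ≥0) : Real.toNNReal ⁻¹' (Set.Iic b) = Set.Iic (b : ℝ) := by
  ext t
  simp [Real.toNNReal_le_iff_le_coe]

theorem toNNReal_preimage_Icc (b : ℝ≥0) : Real.toNNReal ⁻¹' (Set.Icc 0 b) = Set.Iic (b : ℝ) := by
  ext t
  simp [Real.toNNReal_le_iff_le_coe]

theorem restrict_Ioi_restrict_Iic (b : ℝ≥0) :
    ((volume : Measure ℝ).restrict (Set.Ioi 0)).restrict (Set.Iic (b : ℝ))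
      = volume.restrict (Set.Ioc 0 (b : ℝ)) := by
  rw [Measure.restrict_restrict measurableSet_Iic, Set.Iic_inter_Ioi]

theorem isLocallyFiniteMeasure_powerTheta (hτ : -1 < τ) :
    IsLocallyFiniteMeasure (powerTheta τ) := by
  refine ⟨fun x => ⟨Set.Iic (x + 1), Iic_mem_nhds (by simp), ?_⟩⟩
  rw [powerTheta, Measure.map_apply measurable_real_toNNReal measurableSet_Iic,
    toNNReal_preimage_Iic, withDensity_apply _ measurableSet_Iic, restrict_Ioi_restrict_Iic]
  have h := (intervalIntegral.intervalIntegrable_rpow' hτ (a := 0) (b := ((x + 1 : ℝ≥0) : ℝ))).1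
  exact Integrable.lintegral_lt_top h

theorem setIntegral_powerTheta (τ : ℝ) (a : ℝ≥0) {g : ℝ → ℝ} (hg : Measurable g) :
    ∫ t in Set.Icc 0 a, g (t : ℝ) ∂(powerTheta τ) = ∫ t in (0 : ℝ)..a, t ^ τ * g t := by
  have hgm : Measurable fun t : ℝ≥0 => g (t : ℝ) := by fun_prop
  rw [powerTheta, setIntegral_map measurableSet_Icc hgm.aestronglyMeasurable
    measurable_real_toNNReal.aemeasurable, toNNReal_preimage_Icc,
    restrict_withDensity measurableSet_Iic, restrict_Ioi_restrict_Iic,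
    integral_withDensity_eq_integral_toReal_smul (by fun_prop)
      (Filter.Eventually.of_forall fun _ => ENNReal.ofReal_lt_top),
    intervalIntegral.integral_of_le a.coe_nonneg]
  refine setIntegral_congr_fun measurableSet_Ioc fun t ht => ?_
  have h := Real.rpow_nonneg ht.1.le τ
  simp only [smul_eq_mul]
  rw [ENNReal.toReal_ofReal h, Real.coe_toNNReal t ht.1.le]

variable {d : ℕ} {ν : Measure ℝ≥0} [IsProbabilityMeasure ν]

/-- The rate in `w(t) = exp (-b t ^ (d + τ + 1))`. -/
noncomputable def decayRate (d : ℕ) (τ : ℝ) (ν : Measure ℝ≥0) : ℝ :=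
  speedMoment ν d * (ballVol d * betaInt τ d)

theorem Lam_powerTheta (hτ : -1 < τ) (t : ℝ≥0) :
    Lam d (powerTheta τ) t = ballVol d * (betaInt τ d * (t : ℝ) ^ ((d : ℝ) + τ + 1)) := by
  rw [Lam, setIntegral_powerTheta τ t (g := fun s => ((t : ℝ) - s) ^ d) (by fun_prop),
    integral_rpow_mul_sub_pow hτ d t.coe_nonneg, add_comm τ]

omit [IsProbabilityMeasure ν] in
theorem wt_powerTheta (hτ : -1 < τ) (t : ℝ≥0) :
    wt d (powerTheta τ) ν t
      = Real.exp (-(decayRate d τ ν * (t : ℝ) ^ ((d : ℝ) + τ + 1))) := by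
  rw [wt, Lam_powerTheta hτ, decayRate]
  congr 1
  ring

theorem exponent_pos (d : ℕ) (hτ : -1 < τ) : 0 < (d : ℝ) + τ + 1 := by
  have : (0 : ℝ) ≤ d := Nat.cast_nonneg d
  linarith

omit [IsProbabilityMeasure ν] in
theorem integral_wt_powerTheta (hτ : -1 < τ) (a : ℝ≥0) :
    ∫ t in Set.Icc 0 a, wt d (powerTheta τ) ν t ∂(powerTheta τ)
      = powExpInt τ ((d : ℝ) + τ + 1) (decayRate d τ ν) a := by
  simp_rw [wt_powerTheta hτ]
  exact setIntegral_powerTheta τ a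
    (continuous_exp_neg_mul_rpow (exponent_pos d hτ) _).measurable

theorem integrableOn_powerTheta (hτ : -1 < τ) (a : ℝ≥0) {g : ℝ≥0 → ℝ} (hg : Continuous g) :
    IntegrableOn g (Set.Icc 0 a) (powerTheta τ) := by
  have := isLocallyFiniteMeasure_powerTheta hτ
  exact hg.continuousOn.integrableOn_compact isCompact_Icc

omit [IsProbabilityMeasure ν] in
theorem decayRate_nonneg (hτ : -1 < τ) : 0 ≤ decayRate d τ ν :=
  mul_nonneg (speedMoment_nonneg ν d) (mul_nonneg (ballVol_pos d).le (betaInt_pos hτ d).le)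

omit [IsProbabilityMeasure ν] in
-- With y = b s^p and e = exp(-b t^p), for s ≤ t one has 1 - exp(-y) ≥ y exp(-y) ≥ y e. Replacing
-- w(s) by 1 - y e rather than by 1 yields the subtracted term, which is what saves the lower bound
-- at τ = d - 1.
theorem lower_inner_powerTheta_le (hd : 1 ≤ d) (hτ : -1 < τ) (t : ℝ≥0) :
    ∫ s in Set.Icc 0 t, ((t : ℝ) - (s : ℝ)) ^ d * wt d (powerTheta τ) ν s *
        wt d (powerTheta τ) ν t ∂(powerTheta τ)
      ≤ betaInt τ d * ((t : ℝ) ^ ((d : ℝ) + τ + 1) *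
          Real.exp (-(decayRate d τ ν * (t : ℝ) ^ ((d : ℝ) + τ + 1))))
        - decayRate d τ ν * betaInt (τ + ((d : ℝ) + τ + 1)) d *
          (((t : ℝ) ^ ((d : ℝ) + τ + 1)) ^ 2 *
            Real.exp (-(2 * decayRate d τ ν * (t : ℝ) ^ ((d : ℝ) + τ + 1)))) := by
  have hp := exponent_pos d hτ
  have hb := decayRate_nonneg (d := d) (ν := ν) hτ
  have hd1 : (1 : ℝ) ≤ d := Nat.one_le_cast.2 hd
  set p := (d : ℝ) + τ + 1 with hpd
  set b := decayRate d τ ν with hbd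
  set e := Real.exp (-(b * (t : ℝ) ^ p)) with he
  have hcp := Real.continuous_rpow_const hp.le
  have he0 : 0 ≤ e := (Real.exp_pos _).le
  have hτp : -1 < τ + p := by linarith
  simp_rw [wt_powerTheta hτ]
  rw [← hpd, ← hbd]
  calc ∫ s in Set.Icc 0 t, ((t : ℝ) - (s : ℝ)) ^ d * Real.exp (-(b * (s : ℝ) ^ p)) * e
        ∂(powerTheta τ)
      ≤ ∫ s in Set.Icc 0 t, ((t : ℝ) - (s : ℝ)) ^ d * (1 - b * e * (s : ℝ) ^ p) * e
        ∂(powerTheta τ) := by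
        refine setIntegral_mono_on (integrableOn_powerTheta hτ t (by fun_prop))
          (integrableOn_powerTheta hτ t (by fun_prop)) measurableSet_Icc fun s hs => ?_
        have h0 : 0 ≤ ((t : ℝ) - s) ^ d := sub_pow_nonneg hs.2 d
        have hsp : (0 : ℝ) ≤ (s : ℝ) ^ p := by positivity
        have hst : (s : ℝ) ^ p ≤ (t : ℝ) ^ p :=
          Real.rpow_le_rpow s.coe_nonneg (NNReal.coe_le_coe.2 hs.2) hp.le
        have h1 : Real.exp (-(b * (s : ℝ) ^ p)) ≤ 1 - b * e * (s : ℝ) ^ p := by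
          have h2 : e ≤ Real.exp (-(b * (s : ℝ) ^ p)) :=
            Real.exp_le_exp.2 (neg_le_neg (mul_le_mul_of_nonneg_left hst hb))
          have h3 : b * (s : ℝ) ^ p * Real.exp (-(b * (s : ℝ) ^ p))
              ≤ 1 - Real.exp (-(b * (s : ℝ) ^ p)) := by
            have h4 := Real.add_one_le_exp (b * (s : ℝ) ^ p)
            have h5 := mul_le_mul_of_nonneg_right h4 (Real.exp_pos (-(b * (s : ℝ) ^ p))).le
            rw [← Real.exp_add, add_neg_cancel, Real.exp_zero] at h5
            linarith
          have h6 := mul_le_mul_of_nonneg_left h2 (mul_nonneg hb hsp)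
          linarith
        gcongr
    _ = ∫ s in (0 : ℝ)..t, s ^ τ * (((t : ℝ) - s) ^ d * (1 - b * e * s ^ p) * e) :=
        setIntegral_powerTheta τ t
          (g := fun s => ((t : ℝ) - s) ^ d * (1 - b * e * s ^ p) * e) (by fun_prop)
    _ = ∫ s in (0 : ℝ)..t, (e * (s ^ τ * ((t : ℝ) - s) ^ d)
          - b * e ^ 2 * (s ^ (τ + p) * ((t : ℝ) - s) ^ d)) := by
        refine intervalIntegral.integral_congr fun s hs => ?_
        rw [Set.uIcc_of_le t.coe_nonneg] at hs
        rw [Real.rpow_add' hs.1 (show τ + p ≠ 0 by linarith)]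
        ring
    _ = e * (betaInt τ d * (t : ℝ) ^ (τ + d + 1))
          - b * e ^ 2 * (betaInt (τ + p) d * (t : ℝ) ^ (τ + p + d + 1)) := by
        rw [intervalIntegral.integral_sub
          ((intervalIntegrable_rpow_mul hτ (by fun_prop) 0 _).const_mul _)
          ((intervalIntegrable_rpow_mul hτp (by fun_prop) 0 _).const_mul _),
          intervalIntegral.integral_const_mul, intervalIntegral.integral_const_mul,
          integral_rpow_mul_sub_pow hτ d t.coe_nonneg, integral_rpow_mul_sub_pow hτp d t.coe_nonneg]
    _ = _ := by
        have e1 : τ + d + 1 = p := by rw [hpd]; ring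
        have e2 : τ + p + d + 1 = p * (2 : ℕ) := by rw [hpd]; push_cast; ring
        have e3 : Real.exp (-(2 * b * (t : ℝ) ^ p)) = e ^ 2 := by
          rw [he, ← Real.exp_nat_mul]
          congr 1
          push_cast
          ring
        rw [e1, e2, e3, Real.rpow_mul_natCast t.coe_nonneg]
        ring

omit [IsProbabilityMeasure ν] in
theorem lower_term_powerTheta_le (hd : 1 ≤ d) (hτ : -1 < τ) (a : ℝ≥0) :
    ∫ t in Set.Icc 0 a, ∫ s in Set.Icc 0 t, ((t : ℝ) - (s : ℝ)) ^ d *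
        wt d (powerTheta τ) ν s * wt d (powerTheta τ) ν t ∂(powerTheta τ) ∂(powerTheta τ)
      ≤ betaInt τ d * (∫ t in (0 : ℝ)..a, t ^ τ * (t ^ ((d : ℝ) + τ + 1) *
          Real.exp (-(decayRate d τ ν * t ^ ((d : ℝ) + τ + 1)))))
        - decayRate d τ ν * betaInt (τ + ((d : ℝ) + τ + 1)) d *
          ∫ t in (0 : ℝ)..a, t ^ τ * ((t ^ ((d : ℝ) + τ + 1)) ^ 2 *
            Real.exp (-(2 * decayRate d τ ν * t ^ ((d : ℝ) + τ + 1)))) := by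
  have hp := exponent_pos d hτ
  have hinner := lower_inner_powerTheta_le (ν := ν) hd hτ
  set p := (d : ℝ) + τ + 1 with hpd
  set b := decayRate d τ ν with hbd
  have hcp := Real.continuous_rpow_const hp.le
  have hg : Continuous fun t : ℝ => betaInt τ d * (t ^ p * Real.exp (-(b * t ^ p)))
      - b * betaInt (τ + p) d * ((t ^ p) ^ 2 * Real.exp (-(2 * b * t ^ p))) := by fun_prop
  calc _ ≤ ∫ t in Set.Icc 0 a, (betaInt τ d * ((t : ℝ) ^ p * Real.exp (-(b * (t : ℝ) ^ p)))
      - b * betaInt (τ + p) d * (((t : ℝ) ^ p) ^ 2 * Real.exp (-(2 * b * (t : ℝ) ^ p))))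
        ∂(powerTheta τ) := by
        -- For a non-negative smaller integrand only the majorant has to be integrable.
        refine integral_mono_of_nonneg (Filter.Eventually.of_forall fun t => ?_)
          (integrableOn_powerTheta hτ a (hg.comp NNReal.continuous_coe))
          (Filter.Eventually.of_forall hinner)
        refine setIntegral_nonneg measurableSet_Icc fun s hs => ?_
        exact mul_nonneg (mul_nonneg (sub_pow_nonneg hs.2 d) (wt_pos s).le) (wt_pos t).le
    _ = ∫ t in (0 : ℝ)..a, t ^ τ * (betaInt τ d * (t ^ p * Real.exp (-(b * t ^ p)))
      - b * betaInt (τ + p) d * ((t ^ p) ^ 2 * Real.exp (-(2 * b * t ^ p)))) :=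
        setIntegral_powerTheta τ a hg.measurable
    _ = ∫ t in (0 : ℝ)..a, (betaInt τ d * (t ^ τ * (t ^ p * Real.exp (-(b * t ^ p))))
      - b * betaInt (τ + p) d * (t ^ τ * ((t ^ p) ^ 2 * Real.exp (-(2 * b * t ^ p))))) := by
        refine intervalIntegral.integral_congr fun t _ => ?_
        ring
    _ = _ := by
        rw [intervalIntegral.integral_sub
          ((intervalIntegrable_rpow_mul hτ (by fun_prop) 0 _).const_mul _)
          ((intervalIntegrable_rpow_mul hτ (by fun_prop) 0 _).const_mul _),
          intervalIntegral.integral_const_mul, intervalIntegral.integral_const_mul]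

omit [IsProbabilityMeasure ν] in
theorem wt_powerTheta_rpow (hτ : -1 < τ) (t : ℝ≥0) :
    wt d (powerTheta τ) ν t ^ (1 / 2 : ℝ)
      = Real.exp (-(decayRate d τ ν / 2 * (t : ℝ) ^ ((d : ℝ) + τ + 1))) := by
  rw [wt_powerTheta hτ, ← Real.exp_mul]
  congr 1
  ring

omit [IsProbabilityMeasure ν] in
-- Bounding each (t_i - s)^d by t_i^d and θ[0, t₁ ∧ t₂] by t₁^(τ+1)/(τ+1) separates the variables.
-- The t₁ factor gives (4/b) times the integral at rate b/4, the t₂ factor at most 2/(p b); the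
-- resulting b^(-2) is the source of ν_d^(-2) in the final bound.
theorem upper_term_powerTheta_le (hτ : -1 < τ) (hb : 0 < decayRate d τ ν) (a : ℝ≥0) :
    ∫ t in Set.Icc 0 a ×ˢ Set.Icc 0 a, ∫ s in Set.Icc 0 (min t.1 t.2),
        ((t.1 : ℝ) - (s : ℝ)) ^ d * ((t.2 : ℝ) - (s : ℝ)) ^ d *
          wt d (powerTheta τ) ν t.1 ^ (1 / 2 : ℝ) * wt d (powerTheta τ) ν t.2 ^ (1 / 2 : ℝ)
          ∂(powerTheta τ) ∂((powerTheta τ).prod (powerTheta τ))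
      ≤ 8 / ((τ + 1) * ((d : ℝ) + τ + 1) * decayRate d τ ν ^ 2) *
        powExpInt τ ((d : ℝ) + τ + 1) (decayRate d τ ν / 4) a := by
  have hlf := isLocallyFiniteMeasure_powerTheta hτ
  have hp := exponent_pos d hτ
  have hτ1 : 0 < τ + 1 := by linarith
  set p := (d : ℝ) + τ + 1 with hpd
  set b := decayRate d τ ν with hbd
  have hcp := Real.continuous_rpow_const hp.le
  set g₁ : ℝ → ℝ := fun t => (τ + 1)⁻¹ * (t ^ p * Real.exp (-(b / 2 * t ^ p))) with hg₁
  set g₂ : ℝ → ℝ := fun t => t ^ d * Real.exp (-(b / 2 * t ^ p)) with hg₂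
  have hg₁c : Continuous g₁ := by fun_prop
  have hg₂c : Continuous g₂ := by fun_prop
  have hone : ∀ m : ℝ≥0, ∫ s in Set.Icc 0 m, (1 : ℝ) ∂(powerTheta τ)
      = (m : ℝ) ^ (τ + 1) / (τ + 1) := by
    intro m
    rw [setIntegral_powerTheta τ m (g := fun _ => 1) measurable_const]
    simp only [mul_one]
    rw [integral_rpow (Or.inl hτ), Real.zero_rpow hτ1.ne', sub_zero]
  have hinner : ∀ z : ℝ≥0 × ℝ≥0, ∫ s in Set.Icc 0 (min z.1 z.2),
      ((z.1 : ℝ) - (s : ℝ)) ^ d * ((z.2 : ℝ) - (s : ℝ)) ^ d *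
        wt d (powerTheta τ) ν z.1 ^ (1 / 2 : ℝ) * wt d (powerTheta τ) ν z.2 ^ (1 / 2 : ℝ)
        ∂(powerTheta τ) ≤ g₁ z.1 * g₂ z.2 := by
    rintro ⟨t₁, t₂⟩
    simp_rw [wt_powerTheta_rpow hτ]
    rw [← hpd, ← hbd]
    set e₁ := Real.exp (-(b / 2 * (t₁ : ℝ) ^ p)) with he₁
    set e₂ := Real.exp (-(b / 2 * (t₂ : ℝ) ^ p)) with he₂
    have he₁0 : 0 ≤ e₁ := (Real.exp_pos _).le
    have he₂0 : 0 ≤ e₂ := (Real.exp_pos _).le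
    calc ∫ s in Set.Icc 0 (min t₁ t₂),
          ((t₁ : ℝ) - (s : ℝ)) ^ d * ((t₂ : ℝ) - (s : ℝ)) ^ d * e₁ * e₂ ∂(powerTheta τ)
        ≤ ∫ s in Set.Icc 0 (min t₁ t₂), (t₁ : ℝ) ^ d * (t₂ : ℝ) ^ d * e₁ * e₂ * 1
          ∂(powerTheta τ) := by
          refine setIntegral_mono_on (integrableOn_powerTheta hτ _ (by fun_prop))
            (integrableOn_powerTheta hτ _ (by fun_prop)) measurableSet_Icc fun s hs => ?_
          have hs1 : (s : ℝ) ≤ t₁ := NNReal.coe_le_coe.2 (hs.2.trans (min_le_left _ _))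
          have hs2 : (s : ℝ) ≤ t₂ := NNReal.coe_le_coe.2 (hs.2.trans (min_le_right _ _))
          have h1 : ((t₁ : ℝ) - s) ^ d ≤ (t₁ : ℝ) ^ d :=
            pow_le_pow_left₀ (sub_nonneg.2 hs1) (sub_le_self _ s.coe_nonneg) d
          have h2 : ((t₂ : ℝ) - s) ^ d ≤ (t₂ : ℝ) ^ d :=
            pow_le_pow_left₀ (sub_nonneg.2 hs2) (sub_le_self _ s.coe_nonneg) d
          have h3 : 0 ≤ ((t₂ : ℝ) - s) ^ d := pow_nonneg (sub_nonneg.2 hs2) d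
          rw [mul_one]
          gcongr
      _ = (t₁ : ℝ) ^ d * (t₂ : ℝ) ^ d * e₁ * e₂ *
            (((min t₁ t₂ : ℝ≥0) : ℝ) ^ (τ + 1) / (τ + 1)) := by
          rw [integral_const_mul, hone]
      _ ≤ (t₁ : ℝ) ^ d * (t₂ : ℝ) ^ d * e₁ * e₂ * ((t₁ : ℝ) ^ (τ + 1) / (τ + 1)) := by
          have : ((min t₁ t₂ : ℝ≥0) : ℝ) ≤ t₁ := NNReal.coe_le_coe.2 (min_le_left _ _)
          gcongr
      _ = g₁ t₁ * g₂ t₂ := by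
          have : (t₁ : ℝ) ^ p = (t₁ : ℝ) ^ d * (t₁ : ℝ) ^ (τ + 1) := by
            rw [← Real.rpow_natCast, ← Real.rpow_add' t₁.coe_nonneg (by linarith)]
            congr 1
            rw [hpd]
            ring
          simp only [hg₁, hg₂]
          rw [← he₁, ← he₂, this]
          field_simp
  have hI₁ : ∫ t in Set.Icc 0 a, g₁ (t : ℝ) ∂(powerTheta τ)
      ≤ (τ + 1)⁻¹ * (4 / b * powExpInt τ p (b / 4) a) := by
    rw [setIntegral_powerTheta τ a hg₁c.measurable]
    have : ∫ t in (0 : ℝ)..a, t ^ τ * g₁ t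
        = (τ + 1)⁻¹ * ∫ t in (0 : ℝ)..a, t ^ τ * (t ^ p * Real.exp (-(b / 2 * t ^ p))) := by
      rw [← intervalIntegral.integral_const_mul]
      refine intervalIntegral.integral_congr fun t _ => ?_
      simp only [hg₁]
      ring
    rw [this]
    exact mul_le_mul_of_nonneg_left (integral_rpow_add_mul_exp_half_le hτ hp a.coe_nonneg hb)
      (inv_nonneg.2 hτ1.le)
  have hI₂ : ∫ t in Set.Icc 0 a, g₂ (t : ℝ) ∂(powerTheta τ) ≤ 2 / (p * b) := by
    rw [setIntegral_powerTheta τ a hg₂c.measurable]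
    have : ∫ t in (0 : ℝ)..a, t ^ τ * g₂ t = powExpInt (p - 1) p (b / 2) a := by
      rw [powExpInt, intervalIntegral.integral_of_le a.coe_nonneg,
        intervalIntegral.integral_of_le a.coe_nonneg]
      refine setIntegral_congr_fun measurableSet_Ioc fun t ht => ?_
      have : t ^ (p - 1) = t ^ τ * t ^ d := by
        rw [← Real.rpow_natCast t d, ← Real.rpow_add ht.1]
        congr 1
        rw [hpd]
        ring
      simp only [hg₂]
      rw [this, mul_assoc]
    rw [this]
    refine (integral_rpow_sub_one_mul_exp_le hp a.coe_nonneg (half_pos hb)).trans_eq ?_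
    field_simp
  have hG := (powExpInt_pos hτ hp (b := b / 4) (a := (a : ℝ)))
  calc _ ≤ ∫ t in Set.Icc 0 a ×ˢ Set.Icc 0 a, g₁ t.1 * g₂ t.2
          ∂((powerTheta τ).prod (powerTheta τ)) := by
        refine integral_mono_of_nonneg (Filter.Eventually.of_forall fun z => ?_) ?_
          (Filter.Eventually.of_forall hinner)
        · refine setIntegral_nonneg measurableSet_Icc fun s hs => ?_
          have h1 := sub_pow_nonneg (hs.2.trans (min_le_left z.1 z.2)) d
          have h2 := sub_pow_nonneg (hs.2.trans (min_le_right z.1 z.2)) d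
          have h3 := (wt_pos (d := d) (θ := powerTheta τ) (ν := ν) z.1).le
          have h4 := (wt_pos (d := d) (θ := powerTheta τ) (ν := ν) z.2).le
          positivity
        · rw [← Measure.prod_restrict]
          exact (integrableOn_powerTheta hτ a (hg₁c.comp NNReal.continuous_coe)).mul_prod
            (integrableOn_powerTheta hτ a (hg₂c.comp NNReal.continuous_coe))
    _ = (∫ t in Set.Icc 0 a, g₁ (t : ℝ) ∂(powerTheta τ)) *
          ∫ t in Set.Icc 0 a, g₂ (t : ℝ) ∂(powerTheta τ) :=
        setIntegral_prod_mul (fun t : ℝ≥0 => g₁ t) (fun t : ℝ≥0 => g₂ t) _ _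
    _ ≤ ((τ + 1)⁻¹ * (4 / b * powExpInt τ p (b / 4) a)) * (2 / (p * b)) := by
        refine mul_le_mul hI₁ hI₂ ?_ ?_
        · refine integral_nonneg fun t => ?_
          simp only [hg₂, Pi.zero_apply]
          positivity
        · refine (integral_nonneg fun t => ?_).trans hI₁
          simp only [hg₁, Pi.zero_apply]
          positivity
    _ = _ := by
        field_simp
        ring

omit [IsProbabilityMeasure ν] in
theorem lFun_eq_powExpInt (hτ : -1 < τ) (a : ℝ≥0) {x : ℝ} (hx : 0 < x) :
    lFun d a τ x = ((d : ℝ) + τ + 1) * powExpInt τ ((d : ℝ) + τ + 1) x a := by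
  have hp := exponent_pos d hτ
  rw [powExpInt_eq_lowerGamma hp a.coe_nonneg hx, lFun]
  field_simp

theorem speedMoment_pos (hν : SpeedCondition d ν) (h0 : ν {0} < 1) {k : ℕ} (hk : k ≤ 7 * d) :
    0 < speedMoment ν k := by
  rw [speedMoment, integral_pos_iff_support_of_nonneg (fun v => by positivity)
    (hν.integrable_pow hk), pos_iff_ne_zero]
  intro hzero
  have hsub : ({0}ᶜ : Set ℝ≥0) ⊆ Function.support fun v : ℝ≥0 => (v : ℝ) ^ k := by
    intro v hv
    exact pow_ne_zero k (NNReal.coe_ne_zero.2 hv)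
  have h1 : ν ({0}ᶜ : Set ℝ≥0) = 0 := measure_mono_null hsub hzero
  rw [prob_compl_eq_zero_iff (measurableSet_singleton 0)] at h1
  exact h0.ne h1

theorem exists_power_lower_constants (hd : 1 ≤ d) (hτ : -1 < τ) :
    ∃ C₁ C₁' : ℝ, 0 < C₁ ∧ C₁ * ((d : ℝ) - 1 - τ) < C₁' ∧
      ∀ (Ω : Type*) [MeasurableSpace Ω] (P : Measure Ω) [IsProbabilityMeasure P]
        (ν : Measure ℝ≥0) [IsProbabilityMeasure ν]
        (W : Set (EuclideanSpace ℝ (Fin d))) (a : ℝ≥0) (η : Ω → Measure (Seed d)),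
        ν {0} < 1 → 0 < a → WindowCondition W → SpeedCondition d ν →
        IsPoissonProcess η (intensity d (powerTheta τ) ν) P →
        C₁' ≤ variance (fun ω => exposedCount W a (η ω)) P
            / (volume.real W * lFun d a τ (speedMoment ν d)) := by
  have hlf := isLocallyFiniteMeasure_powerTheta hτ
  have hp := exponent_pos d hτ
  rcases lt_or_ge ((d : ℝ) - 1) τ with hcase | hcase
  -- Here d - 1 - τ < 0, so non-negativity of the variance suffices.
  · refine ⟨1, 0, one_pos, by linarith, ?_⟩
    intro Ω _ P _ ν _ W a η h0 ha hW hν h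
    have hx := speedMoment_pos hν h0 (k := d) (by omega)
    have hG := powExpInt_pos hτ hp (NNReal.coe_pos.2 ha) (speedMoment ν d)
    have hV := variance_nonneg (fun ω => exposedCount W a (η ω)) P
    rw [lFun_eq_powExpInt hτ a hx]
    positivity
  · have hB0 := betaInt_pos hτ d
    have hB1 := betaInt_pos (β := τ + ((d : ℝ) + τ + 1)) (by linarith) d
    have hω := ballVol_pos d
    -- The case assumption τ ≤ d - 1 is the condition 2(τ+1) ≤ p. As 2 ω_d ν_d = 2 b / `betaInt τ
    -- d`, the quadratic term enters with this κ times b².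
    obtain ⟨c, hc, hmain⟩ := exists_pos_mul_powExpInt_le hτ hp (by linarith)
      (κ := 2 * betaInt (τ + ((d : ℝ) + τ + 1)) d / betaInt τ d) (by positivity)
    set K := min 1 ((ballVol d * betaInt τ d) ^ (-((τ + 1) / ((d : ℝ) + τ + 1)))) with hK
    have hK0 : 0 < K := lt_min one_pos (by positivity)
    have hC : 0 < c * K / ((d : ℝ) + τ + 1) := by positivity
    have hdτ : 0 < (d : ℝ) - τ := by linarith
    -- With C₁ = C₁'/(d - τ), the required strict inequality is d - 1 - τ < d - τ.
    refine ⟨c * K / ((d : ℝ) + τ + 1) / ((d : ℝ) - τ), c * K / ((d : ℝ) + τ + 1),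
      by positivity, ?_, ?_⟩
    · rw [div_mul_eq_mul_div, div_lt_iff₀ hdτ]
      exact mul_lt_mul_of_pos_left (by linarith) hC
    · intro Ω _ P _ ν _ W a η h0 ha hW hν h
      have hx := speedMoment_pos hν h0 (k := d) (by omega)
      have hG := powExpInt_pos hτ hp (NNReal.coe_pos.2 ha) (speedMoment ν d)
      have hL := hW.volume_real_pos
      have hb : 0 < decayRate d τ ν := by
        rw [decayRate]
        positivity
      have h1 := le_variance_div hd hν h hW a
      rw [integral_wt_powerTheta hτ] at h1
      have h2 := lower_term_powerTheta_le (ν := ν) hd hτ a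
      have h3 := hmain a (decayRate d τ ν) (NNReal.coe_pos.2 ha) hb
      have h4 := le_powExpInt_mul hτ hp a.coe_nonneg (c := ballVol d * betaInt τ d)
        (by positivity) hx
      rw [mul_comm (ballVol d * betaInt τ d), ← hK] at h4
      change K * _ ≤ powExpInt τ _ (decayRate d τ ν) a at h4
      have h5 : c * (K * powExpInt τ ((d : ℝ) + τ + 1) (speedMoment ν d) a)
          ≤ variance (fun ω => exposedCount W a (η ω)) P / volume.real W := by
        refine (mul_le_mul_of_nonneg_left h4 hc.le).trans (h3.trans (le_trans (le_of_eq_of_le ?_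
          (sub_le_sub_left (mul_le_mul_of_nonneg_left h2 (show 0 ≤ 2 * ballVol d *
            speedMoment ν d by positivity)) _)) h1))
        rw [decayRate]
        field_simp
        ring
      rw [lFun_eq_powExpInt hτ a hx, ← div_div, le_div_iff₀ (by positivity)]
      refine le_of_eq_of_le ?_ h5
      field_simp

theorem exists_power_upper_constant (hd : 1 ≤ d) (hτ : -1 < τ) :
    ∃ C₂ : ℝ, 0 < C₂ ∧
      ∀ (Ω : Type*) [MeasurableSpace Ω] (P : Measure Ω) [IsProbabilityMeasure P]
        (ν : Measure ℝ≥0) [IsProbabilityMeasure ν]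
        (W : Set (EuclideanSpace ℝ (Fin d))) (a : ℝ≥0) (η : Ω → Measure (Seed d)),
        ν {0} < 1 → 0 < a → WindowCondition W → SpeedCondition d ν →
        IsPoissonProcess η (intensity d (powerTheta τ) ν) P →
        variance (fun ω => exposedCount W a (η ω)) P
            / (volume.real W * lFun d a τ (speedMoment ν d))
          ≤ C₂ * (1 + speedMoment ν (2 * d) * (speedMoment ν d ^ 2)⁻¹) := by
  have hlf := isLocallyFiniteMeasure_powerTheta hτ
  have hp := exponent_pos d hτ
  have hτ1 : 0 < τ + 1 := by linarith
  have hB0 := betaInt_pos hτ d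
  have hω := ballVol_pos d
  set K₁ := max 1 ((ballVol d * betaInt τ d) ^ (-((τ + 1) / ((d : ℝ) + τ + 1)))) with hK₁
  set K₂ := max 1 ((ballVol d * betaInt τ d / 4) ^ (-((τ + 1) / ((d : ℝ) + τ + 1)))) with hK₂
  have hK₁0 : 0 < K₁ := lt_max_of_lt_left one_pos
  have hK₂0 : 0 < K₂ := lt_max_of_lt_left one_pos
  -- `A` comes from the integral of w and `B` from the triple integral; ω_d² cancels in `B` against
  -- the square of the decay rate. Each is divided by p because l is p times the integral.
  set A := K₁ / ((d : ℝ) + τ + 1) with hA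
  set B := 8 * K₂ / ((τ + 1) * ((d : ℝ) + τ + 1) * betaInt τ d ^ 2) / ((d : ℝ) + τ + 1) with hB
  have hA0 : 0 < A := by positivity
  have hB0' : 0 < B := by positivity
  refine ⟨A + B, by positivity, ?_⟩
  intro Ω _ P _ ν _ W a η h0 ha hW hν h
  have hx := speedMoment_pos hν h0 (k := d) (by omega)
  have hy := speedMoment_nonneg ν (2 * d)
  have hG := powExpInt_pos hτ hp (NNReal.coe_pos.2 ha) (speedMoment ν d)
  have hL := hW.volume_real_pos
  have hb : 0 < decayRate d τ ν := by
    rw [decayRate]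
    positivity
  have h1 := variance_div_le hd hν h hW a
  rw [integral_wt_powerTheta hτ] at h1
  have h2 := upper_term_powerTheta_le hτ hb a
  have h3 := powExpInt_mul_le hτ hp a.coe_nonneg (c := ballVol d * betaInt τ d) (by positivity) hx
  rw [mul_comm (ballVol d * betaInt τ d), ← hK₁] at h3
  change powExpInt τ _ (decayRate d τ ν) a ≤ _ at h3
  have h4 := powExpInt_mul_le hτ hp a.coe_nonneg (c := ballVol d * betaInt τ d / 4)
    (by positivity) hx
  rw [show ballVol d * betaInt τ d / 4 * speedMoment ν d = decayRate d τ ν / 4 by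
    rw [decayRate]; ring, ← hK₂] at h4
  set G := powExpInt τ ((d : ℝ) + τ + 1) (speedMoment ν d) a with hGd
  have h5 : variance (fun ω => exposedCount W a (η ω)) P / volume.real W
      ≤ K₁ * G + ballVol d ^ 2 * speedMoment ν (2 * d) *
        (8 / ((τ + 1) * ((d : ℝ) + τ + 1) * decayRate d τ ν ^ 2) * (K₂ * G)) := by
    refine h1.trans (add_le_add h3 (mul_le_mul_of_nonneg_left (h2.trans ?_) (by positivity)))
    exact mul_le_mul_of_nonneg_left h4 (by positivity)
  rw [lFun_eq_powExpInt hτ a hx, ← hGd, ← div_div, div_le_iff₀ (by positivity)]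
  refine h5.trans ?_
  have e1 : K₁ * G = A * (((d : ℝ) + τ + 1) * G) := by
    rw [hA]
    field_simp
  have e2 : ballVol d ^ 2 * speedMoment ν (2 * d) *
        (8 / ((τ + 1) * ((d : ℝ) + τ + 1) * decayRate d τ ν ^ 2) * (K₂ * G))
      = B * (speedMoment ν (2 * d) * (speedMoment ν d ^ 2)⁻¹) * (((d : ℝ) + τ + 1) * G) := by
    rw [hB, decayRate]
    field_simp
  rw [e1, e2, ← add_mul]
  refine mul_le_mul_of_nonneg_right ?_ (by positivity)
  have hr : 0 ≤ speedMoment ν (2 * d) * (speedMoment ν d ^ 2)⁻¹ := by positivity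
  have h6 := mul_nonneg hA0.le hr
  linarith

end PowerLaw

end BirthGrowth

theorem proposition2p2 (d : ℕ) (hd : 1 ≤ d) :
    (∀ (Ω : Type*) [MeasurableSpace Ω] (P : Measure Ω) [IsProbabilityMeasure P]
        (θ ν : Measure ℝ≥0) [IsLocallyFiniteMeasure θ] [IsProbabilityMeasure ν]
        (W : Set (EuclideanSpace ℝ (Fin d))) (a : ℝ≥0) (η : Ω → Measure (Seed d)),
        θ ≠ 0 → ν {0} < 1 → 0 < a →
        WindowCondition W → TimeCondition d θ → SpeedCondition d ν →
        IsPoissonProcess η (intensity d θ ν) P →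
        MemLp (fun ω => exposedCount W a (η ω)) 2 P ∧
        (∀ t v : ℝ≥0, ∫ ω, exposure ((0, t, v) : Seed d) (η ω) ∂P = wt d θ ν t) ∧
        (∫ t in Set.Icc 0 a, wt d θ ν t ∂θ)
            - 2 * ballVol d * speedMoment ν d *
              (∫ t in Set.Icc 0 a, ∫ s in Set.Icc 0 t,
                ((t : ℝ) - (s : ℝ)) ^ d * wt d θ ν s * wt d θ ν t ∂θ ∂θ)
          ≤ variance (fun ω => exposedCount W a (η ω)) P / volume.real W ∧
        variance (fun ω => exposedCount W a (η ω)) P / volume.real W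
          ≤ 2 * (∫ t in Set.Icc 0 a, wt d θ ν t ^ (1 / 2 : ℝ) ∂θ)
            + ballVol d ^ 2 * speedMoment ν (2 * d) *
              (∫ t in Set.Icc 0 a ×ˢ Set.Icc 0 a, ∫ s in Set.Icc 0 (min t.1 t.2),
                ((t.1 : ℝ) - (s : ℝ)) ^ d * ((t.2 : ℝ) - (s : ℝ)) ^ d *
                  wt d θ ν t.1 ^ (1 / 2 : ℝ) * wt d θ ν t.2 ^ (1 / 2 : ℝ) ∂θ ∂(θ.prod θ))) ∧
    (∀ τ : ℝ, -1 < τ → ∃ C₁ C₁' C₂ : ℝ, 0 < C₁ ∧ 0 < C₂ ∧ C₁ * ((d : ℝ) - 1 - τ) < C₁' ∧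
      ∀ (Ω : Type*) [MeasurableSpace Ω] (P : Measure Ω) [IsProbabilityMeasure P]
        (ν : Measure ℝ≥0) [IsProbabilityMeasure ν]
        (W : Set (EuclideanSpace ℝ (Fin d))) (a : ℝ≥0) (η : Ω → Measure (Seed d)),
        ν {0} < 1 → 0 < a → WindowCondition W → SpeedCondition d ν →
        IsPoissonProcess η (intensity d (powerTheta τ) ν) P →
        C₁' ≤ variance (fun ω => exposedCount W a (η ω)) P
            / (volume.real W * lFun d a τ (speedMoment ν d)) ∧
        variance (fun ω => exposedCount W a (η ω)) P
            / (volume.real W * lFun d a τ (speedMoment ν d))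
          ≤ C₂ * (1 + speedMoment ν (2 * d) * (speedMoment ν d ^ 2)⁻¹)) := by
  refine ⟨?_, fun τ hτ => ?_⟩
  · intro Ω _ P _ θ ν _ _ W a η _ _ _ hW _ hν h
    exact ⟨memLp_exposedCount hd hν h hW.measurableSet hW.volume_ne_top a,
      fun t v => integral_exposure hd hν h (0, t, v), le_variance_div hd hν h hW a,
      (variance_div_le hd hν h hW a).trans (add_le_add (integral_wt_le hd a) le_rfl)⟩
  · obtain ⟨C₁, C₁', hC₁, hlt, hlower⟩ := exists_power_lower_constants hd hτ
    obtain ⟨C₂, hC₂, hupper⟩ := exists_power_upper_constant hd hτ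
    refine ⟨C₁, C₁', C₂, hC₁, hC₂, hlt, ?_⟩
    intro Ω _ P _ ν _ W a η h0 ha hW hν h
    exact ⟨hlower Ω P ν W a η h0 ha hW hν h, hupper Ω P ν W a η h0 ha hW hν h⟩
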